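/- Let $m$ be Lebesgue measure on $(0,1)$ and let $S(0,1)$ be the space of a.e. classes of measurable real functions on $(0,1)$. For $x\in S(0,1)$ let $\mu(t;x)=\inf\{s\ge 0: m(\{|x|>s\})\le t\}$, $0<t<1$, be its decreasing rearrangement. A symmetric quasi-Banach function space on $(0,1)$ is a linear subspace $E\subset S(0,1)$ with a complete quasi-norm $\|\cdot\|_E$ such that, for $x\in E$ and $y\in S(0,1)$: (a) if $|y|\le|x|$ a.e., then $y\in E$ and $\|y\|_E\le\|x\|_E$; (b) if $\mu(y)=\mu(x)$, then $y\in E$ and $\|y\|_E=\|x\|_E$. Let $(\mathcal F_n)_{n\ge0}$ be the standard dyadic filtration on $(0,1)$ ($\mathcal F_n$ is generated by the intervals $[k2^{-n},(k+1)2^{-n})$, $0\le k<2^n$), let $\mathbb E_n$ be the conditional expectation onto $\mathcal F_n$, put $\mathbb E_{-1}=0$, and for $x\in L_1=L_1(0,1)$ let $$Tx=\sum_{m\ge 0}\left(\mathbb E_{2m}x-\mathbb E_{2m-1}x\right),$$ where the series converges in measure. For a decreasing integrable function $g\ge0$ on $(0,1)$ let $$(Sg)(t)=\frac1t\int_0^t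 g(s)\,ds+\int_t^1\frac{g(s)}{s}\,ds,\qquad 0<t<1.$$ Let $E\subset L_1$ be a symmetric quasi-Banach function space on $(0,1)$, and let $$\mathcal S_E=\{x\in L_{1,\infty}(0,1):\ \mu(x)\le S\mu(y)\text{ on }(0,1)\text{ for some }y\in E\},\qquad \|x\|_{\mathcal S_E}=\inf\{\|y\|_E:\ y\in E,\ \mu(x)\le S\mu(y)\},$$ where $L_{1,\infty}(0,1)=\{x\in S(0,1):\sup_{0<t<1}t\,\mu(t;x)<\infty\}$. Then $\mathcal S_E$ is the optimal symmetric quasi-Banach range of $T$ on $E$, that is: 1. $(\mathcal S_E,\|\cdot\|_{\mathcal S_E})$ is a symmetric quasi-Banach function space on $(0,1)$; 2. for every $x\in E$ the series defining $Tx$ converges in measure, and $T$ is bounded from $E$ into $\mathcal S_E$: there is a constant $C$ with $Tx\in\mathcal S_E$ and $\|Tx\|_{\mathcal S_E}\le C\|x\|_E$ for all $x\in E$; 3. if $G$ is any symmetric quasi-Banach function space on $(0,1)$ such that $T$ is bounded from $E$ into $G$, then $\mathcal S_E\subset G$ and there is a constant $C'$ with $\|x\|_G\le C'\|x\|_{\mathcal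 S_E}$ for all $x\in\mathcal S_E$. -/

import Mathlib

open MeasureTheory Set Filter Topology

noncomputable section

/-- Lebesgue measure on the interval `(0,1)`. -/
def m01 : Measure ℝ := volume.restrict (Ioo (0 : ℝ) 1)

/-- The space `S(0,1)` of (a.e. classes of) measurable real functions on `(0,1)`. -/
abbrev S01 : Type := ℝ →ₘ[m01] ℝ

/-- The decreasing right-continuous rearrangement `μ(t; x)` of `|x|`, meaningful for `0 < t`. -/
def rearr (x : S01) (t : ℝ) : ℝ :=
  sInf {s : ℝ | 0 ≤ s ∧ m01 {u : ℝ | s < |x u|} ≤ ENNReal.ofReal t}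

/-- The Calderón operator
`(Sg)(t) = (1/t) ∫_0^t g(s) ds + ∫_t^1 g(s)/s ds` on `(0,1)`. -/
def calderon (g : ℝ → ℝ) (t : ℝ) : ℝ :=
  (1 / t) * (∫ s in (0 : ℝ)..t, g s) + ∫ s in t..(1 : ℝ), g s / s

/-- Membership in `L_1(0,1)`. -/
def MemL1 (x : S01) : Prop := Integrable (fun t => x t) m01

/-- Membership in weak `L_1`: `sup_{0 < t ≤ 1} t μ(t; x) < ∞`. -/
def MemWeakL1 (x : S01) : Prop := BddAbove ((fun t : ℝ => t * rearr x t) '' Ioc (0 : ℝ) 1)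

/-- The `σ`-algebra generated by the dyadic intervals `[k 2⁻ⁿ, (k+1) 2⁻ⁿ)`, `0 ≤ k < 2ⁿ`. -/
abbrev dyadicSigma (n : ℕ) : MeasurableSpace ℝ :=
  MeasurableSpace.generateFrom
    {A : Set ℝ | ∃ k : ℕ, k < 2 ^ n ∧ A = Ico ((k : ℝ) / 2 ^ n) (((k : ℝ) + 1) / 2 ^ n)}

lemma dyadicSigma_le_succ (n : ℕ) : dyadicSigma n ≤ dyadicSigma (n + 1) := by
  refine MeasurableSpace.generateFrom_le ?_
  rintro A ⟨k, hk, rfl⟩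
  have h2 : (0 : ℝ) < 2 ^ n := by positivity
  have e0 : (k : ℝ) / 2 ^ n = ((2 * k : ℕ) : ℝ) / 2 ^ (n + 1) := by
    push_cast; field_simp; ring
  have e1 : ((k : ℝ) + 1) / 2 ^ n = (((2 * k + 1 : ℕ) : ℝ) + 1) / 2 ^ (n + 1) := by
    push_cast; field_simp; ring
  have e2 : Ico ((k : ℝ) / 2 ^ n) (((k : ℝ) + 1) / 2 ^ n) =
      Ico (((2 * k : ℕ) : ℝ) / 2 ^ (n + 1)) ((((2 * k : ℕ) : ℝ) + 1) / 2 ^ (n + 1)) ∪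
      Ico (((2 * k + 1 : ℕ) : ℝ) / 2 ^ (n + 1))
        ((((2 * k + 1 : ℕ) : ℝ) + 1) / 2 ^ (n + 1)) := by
    rw [e0, e1]
    have h3 : (((2 * k : ℕ) : ℝ) + 1) = ((2 * k + 1 : ℕ) : ℝ) := by push_cast; ring
    rw [h3, Ico_union_Ico_eq_Ico]
    · gcongr; omega
    · gcongr; linarith
  rw [e2]
  have hp : 2 ^ (n + 1) = 2 * 2 ^ n := by ring
  refine @MeasurableSet.union ℝ (dyadicSigma (n + 1)) _ _ ?_ ?_
  · exact MeasurableSpace.measurableSet_generateFrom ⟨2 * k, by omega, rfl⟩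
  · exact MeasurableSpace.measurableSet_generateFrom ⟨2 * k + 1, by omega, rfl⟩

/-- The standard dyadic filtration `(F_n)_{n ≥ 0}`. -/
def dyadicFiltration : Filtration ℕ (inferInstance : MeasurableSpace ℝ) where
  seq := dyadicSigma
  mono' := monotone_nat_of_le_succ dyadicSigma_le_succ
  le' := by
    intro n
    refine MeasurableSpace.generateFrom_le ?_
    rintro A ⟨k, -, rfl⟩
    exact measurableSet_Ico

/-- The conditional expectation `E_n x` of `x` onto `F_n`. -/
def dyadicExp (n : ℕ) (x : S01) : ℝ → ℝ := condExp (dyadicFiltration n) m01 (fun t => x t)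

/-- The martingale difference `E_n x - E_{n-1} x`, where `E_{-1} = 0`. -/
def dyadicDiff : ℕ → S01 → ℝ → ℝ
  | 0, x => dyadicExp 0 x
  | n + 1, x => dyadicExp (n + 1) x - dyadicExp n x

/-- `IsT x y` says that `y = T x = ∑_{m ≥ 0} (E_{2m} x - E_{2m-1} x)`, the series being understood
in the sense of convergence in measure. -/
def IsT (x y : S01) : Prop :=
  TendstoInMeasure m01 (fun (N : ℕ) (t : ℝ) => ∑ m ∈ Finset.range N, dyadicDiff (2 * m) x t)
    atTop (fun t => y t)

/-- A set of measurable functions on `(0,1)` together with a real functional, which is relevant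
only on that set; the laws are stated in `IsSymmetricQuasiBanach`. -/
structure FunSpace where
  carrier : Set S01
  qnorm : S01 → ℝ

/-- `E` is a symmetric quasi-Banach function space on `(0,1)`. -/
structure IsSymmetricQuasiBanach (E : FunSpace) : Prop where
  zero_mem : (0 : S01) ∈ E.carrier
  add_mem : ∀ x ∈ E.carrier, ∀ y ∈ E.carrier, x + y ∈ E.carrier
  smul_mem : ∀ (c : ℝ), ∀ x ∈ E.carrier, c • x ∈ E.carrier
  nonneg : ∀ x ∈ E.carrier, 0 ≤ E.qnorm x
  eq_zero : ∀ x ∈ E.carrier, E.qnorm x = 0 → x = 0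
  qnorm_smul : ∀ (c : ℝ), ∀ x ∈ E.carrier, E.qnorm (c • x) = |c| * E.qnorm x
  quasi_triangle : ∃ K : ℝ, ∀ x ∈ E.carrier, ∀ y ∈ E.carrier,
    E.qnorm (x + y) ≤ K * (E.qnorm x + E.qnorm y)
  complete : ∀ u : ℕ → S01, (∀ n, u n ∈ E.carrier) →
    (∀ ε > 0, ∃ N : ℕ, ∀ i ≥ N, ∀ j ≥ N, E.qnorm (u i - u j) < ε) →
    ∃ x ∈ E.carrier, Tendsto (fun n => E.qnorm (u n - x)) atTop (𝓝 0)
  solid : ∀ x ∈ E.carrier, ∀ y : S01, |y| ≤ |x| → y ∈ E.carrier ∧ E.qnorm y ≤ E.qnorm x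
  symmetric : ∀ x ∈ E.carrier, ∀ y : S01, (∀ t ∈ Ioo (0 : ℝ) 1, rearr y t = rearr x t) →
    y ∈ E.carrier ∧ E.qnorm y = E.qnorm x

/-- `μ(x) ≤ S μ(y)` on `(0,1)`. -/
def RearrLeCalderon (x y : S01) : Prop :=
  ∀ t ∈ Ioo (0 : ℝ) 1, rearr x t ≤ calderon (rearr y) t

/-- The space `S_E = {x ∈ L_{1,∞} : ∃ y ∈ E, μ(x) ≤ S μ(y)}` with
`‖x‖ = inf {‖y‖_E : y ∈ E, μ(x) ≤ S μ(y)}`. -/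
def calderonSpace (E : FunSpace) : FunSpace where
  carrier := {x : S01 | MemWeakL1 x ∧ ∃ y ∈ E.carrier, RearrLeCalderon x y}
  qnorm := fun x => sInf {r : ℝ | ∃ y ∈ E.carrier, RearrLeCalderon x y ∧ r = E.qnorm y}

/-- `T` is (everywhere defined and) bounded from `E` into `F`. -/
def IsBoundedT (E F : FunSpace) : Prop :=
  ∃ C : ℝ, ∀ x ∈ E.carrier, ∃ y ∈ F.carrier, IsT x y ∧ F.qnorm y ≤ C * E.qnorm x

/-- `F ⊂ G` with a continuous embedding. -/
def ContinuouslyEmbedded (F G : FunSpace) : Prop :=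
  ∃ C : ℝ, ∀ x ∈ F.carrier, x ∈ G.carrier ∧ G.qnorm x ≤ C * F.qnorm x

/-- `F` is the optimal symmetric quasi-Banach range of `T` on `E`: the smallest symmetric
quasi-Banach function space into which `T` is bounded from `E`. -/
structure IsOptimalSymmetricRangeT (E F : FunSpace) : Prop where
  isSymmetricQuasiBanach : IsSymmetricQuasiBanach F
  bounded : IsBoundedT E F
  minimal : ∀ G : FunSpace, IsSymmetricQuasiBanach G → IsBoundedT E G → ContinuouslyEmbedded F G

end

noncomputable section

open scoped ENNReal

/-! ### Distribution functions and decreasing rearrangements -/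

/-! The theorem rests on a two-sided comparison of $T$ with the Calderón operator $S$.

Upper side (`IsT.rearrLeCalderon`): $T$ is a martingale transform with coefficients $1,0,1,0,\dots$,
so its partial sums are of weak type $(1,1)$ (via Burkholder's function `burk`), contract $L_2$ and
are self-adjoint. Cut $x$ at height $\mu(t;x)$. The large part is handled by the weak-type bound and
yields the average over $(0,t)$. The bounded part is handled by duality: it is paired with $T$ of a
sign function on a level set, and Hardy–Littlewood yields $\int_t^1\mu(s;x)\,ds/s$. Together these
give $\mu(Tx)\le 14\,S\mu(x)$.

Lower side (`calderon_le_rearr_of_isT`): for $y\in E$ let $f$ be constant on the dyadic shells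
$[2^{-k-1},2^{-k})$, equal to $\mu(2^{-k};y)$ for even $k$ and to $0$ for odd $k$. Then
$|f|\le\mu(y)$, and the gaps make every even martingale difference of $f$ near $0$ nonnegative,
equal to half an average of $f$. Nothing cancels, so $Tf$ on even shells dominates $S\mu(y)$ up to a
constant: $S\mu(y)(t)\le 24\,\mu(t/8;Tf)$. If $T$ maps $E$ into $G$, then $Tf\in G$, and boundedness
of dilations on $G$ puts every $x$ with $\mu(x)\le S\mu(y)$ into $G$.

That $\mathcal S_E$ is itself a symmetric quasi-Banach space uses $Sg(t/2)\le 2\,Sg(t)$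
(`calderon_half`) for the quasi-triangle inequality and completeness, and the automatic continuity
of $E\subset L_1$ (`exists_integral_le`) for definiteness. -/

instance : IsProbabilityMeasure m01 := ⟨by simp [m01]⟩

lemma m01_apply (A : Set ℝ) : m01 A = volume (A ∩ Ioo 0 1) :=
  Measure.restrict_apply' measurableSet_Ioo

/-- The distribution function of `|f|` on `(0,1)`. -/
def distr (f : ℝ → ℝ) (s : ℝ) : ℝ≥0∞ := m01 {u : ℝ | s < |f u|}

lemma distr_le_one (f : ℝ → ℝ) (s : ℝ) : distr f s ≤ 1 := prob_le_one

lemma distr_ne_top (f : ℝ → ℝ) (s : ℝ) : distr f s ≠ ∞ := measure_ne_top _ _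

lemma distr_antitone (f : ℝ → ℝ) : Antitone (distr f) := fun _ _ h =>
  measure_mono fun _ hu => lt_of_le_of_lt h hu

lemma distr_congr {f g : ℝ → ℝ} (h : f =ᵐ[m01] g) (s : ℝ) : distr f s = distr g s := by
  refine measure_congr ?_
  filter_upwards [h] with u hu
  simp only [eq_iff_iff]
  show s < |f u| ↔ s < |g u|
  rw [hu]

lemma distr_mono_ae {f g : ℝ → ℝ} (h : ∀ᵐ u ∂m01, |f u| ≤ |g u|) (s : ℝ) :
    distr f s ≤ distr g s := by
  refine measure_mono_ae ?_
  filter_upwards [h] with u hu hs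
  exact lt_of_lt_of_le hs hu

lemma distr_add_le (f g : ℝ → ℝ) (s t : ℝ) : distr (f + g) (s + t) ≤ distr f s + distr g t := by
  refine (measure_mono ?_).trans (measure_union_le _ _)
  intro u hu
  by_contra hcon
  simp only [mem_union, mem_ofPred_eq, not_or, not_lt] at hcon
  have h1 : s + t < |f u + g u| := hu
  linarith [abs_add_le (f u) (g u)]

/-- Right continuity of the distribution function, from the increasing union of the sets
$\{|f|>s+1/(n+1)\}$. It is what makes the infimum in `rearr` attained. -/
lemma distr_le_of_forall_gt {f : ℝ → ℝ} {s : ℝ} {a : ℝ≥0∞} (h : ∀ r > s, distr f r ≤ a) :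
    distr f s ≤ a := by
  have e : {u : ℝ | s < |f u|} = ⋃ n : ℕ, {u : ℝ | s + 1 / ((n : ℝ) + 1) < |f u|} := by
    ext u
    simp only [mem_ofPred_eq, mem_iUnion]
    constructor
    · intro hu
      obtain ⟨n, hn⟩ := exists_nat_one_div_lt (sub_pos.2 hu)
      exact ⟨n, by linarith⟩
    · rintro ⟨n, hn⟩
      have : (0 : ℝ) < 1 / ((n : ℝ) + 1) := by positivity
      linarith
  have hm : Monotone fun n : ℕ => {u : ℝ | s + 1 / ((n : ℝ) + 1) < |f u|} := by
    intro m n hmn u hu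
    simp only [mem_ofPred_eq] at hu ⊢
    have : (1 : ℝ) / ((n : ℝ) + 1) ≤ 1 / ((m : ℝ) + 1) := by gcongr
    linarith
  rw [distr, e, hm.measure_iUnion]
  refine iSup_le fun n => h _ ?_
  have : (0 : ℝ) < 1 / ((n : ℝ) + 1) := by positivity
  linarith

/-- Nonemptiness of the set whose infimum is `rearr`: $f$ is real-valued and the measure is finite.
Without it `sInf` could take its default value $0$. -/
lemma exists_distr_le {f : ℝ → ℝ} (hf : AEMeasurable f m01) {a : ℝ≥0∞} (ha : 0 < a) :
    ∃ s, 0 ≤ s ∧ distr f s ≤ a := by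
  have h0 : Tendsto (fun n : ℕ => distr f n) atTop (𝓝 0) := by
    have : Tendsto (fun n : ℕ => m01 {u : ℝ | (n : ℝ) < |f u|}) atTop
        (𝓝 (m01 (⋂ n : ℕ, {u : ℝ | (n : ℝ) < |f u|}))) := by
      refine tendsto_measure_iInter_atTop (fun n => ?_) ?_ ⟨0, measure_ne_top _ _⟩
      · exact nullMeasurableSet_lt aemeasurable_const (by fun_prop)
      · intro m n hmn u hu
        simp only [mem_ofPred_eq] at hu ⊢
        exact lt_of_le_of_lt (by exact_mod_cast hmn) hu
    have e : (⋂ n : ℕ, {u : ℝ | (n : ℝ) < |f u|}) = ∅ := by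
      refine eq_empty_iff_forall_notMem.2 fun u hu => ?_
      obtain ⟨n, hn⟩ := exists_nat_ge |f u|
      have h1 : (n : ℝ) < |f u| := mem_iInter.1 hu n
      exact h1.not_ge hn
    rwa [e, measure_empty] at this
  obtain ⟨n, hn⟩ := (h0.eventually (gt_mem_nhds ha)).exists
  exact ⟨n, Nat.cast_nonneg n, hn.le⟩

lemma aemeasurable_coe (x : S01) : AEMeasurable (fun t => x t) m01 :=
  x.aestronglyMeasurable.aemeasurable

lemma rearr_bddBelow (x : S01) (t : ℝ) :
    BddBelow {s : ℝ | 0 ≤ s ∧ m01 {u : ℝ | s < |x u|} ≤ ENNReal.ofReal t} :=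
  ⟨0, fun _ hs => hs.1⟩

lemma rearr_nonneg (x : S01) (t : ℝ) : 0 ≤ rearr x t := Real.sInf_nonneg fun _ hs => hs.1

/-- The Galois connection between rearrangement and distribution function, through which bounds on
`rearr` become bounds on measures of level sets. -/
lemma rearr_le_iff (x : S01) {t s : ℝ} (ht : 0 < t) (hs : 0 ≤ s) :
    rearr x t ≤ s ↔ distr x s ≤ ENNReal.ofReal t := by
  constructor
  · intro h
    refine distr_le_of_forall_gt fun r hr => ?_
    obtain ⟨q, hq, hqr⟩ := exists_lt_of_csInf_lt
      (exists_distr_le (aemeasurable_coe x) (ENNReal.ofReal_pos.2 ht)) (h.trans_lt hr)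
    exact (distr_antitone _ hqr.le).trans hq.2
  · intro h
    exact csInf_le (rearr_bddBelow x t) ⟨hs, h⟩

lemma lt_rearr_iff (x : S01) {t s : ℝ} (ht : 0 < t) (hs : 0 ≤ s) :
    s < rearr x t ↔ ENNReal.ofReal t < distr x s := by
  rw [← not_le, rearr_le_iff x ht hs, not_le]

lemma rearr_antitone (x : S01) : AntitoneOn (rearr x) (Ioi 0) := by
  intro a ha b hb hab
  rw [rearr_le_iff x hb (rearr_nonneg x a)]
  exact ((rearr_le_iff x ha (rearr_nonneg x a)).1 le_rfl).trans (ENNReal.ofReal_le_ofReal hab)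

lemma rearr_eq_zero_of_one_le (x : S01) {t : ℝ} (ht : 1 ≤ t) : rearr x t = 0 := by
  refine le_antisymm ?_ (rearr_nonneg x t)
  rw [rearr_le_iff x (by linarith) le_rfl]
  exact (distr_le_one _ _).trans (by simpa using ht)

lemma rearr_le_rearr_of_distr_le {x y : S01} (h : ∀ s, 0 ≤ s → distr x s ≤ distr y s) {t : ℝ}
    (ht : 0 < t) : rearr x t ≤ rearr y t := by
  rw [rearr_le_iff x ht (rearr_nonneg y t)]
  exact (h _ (rearr_nonneg y t)).trans ((rearr_le_iff y ht (rearr_nonneg y t)).1 le_rfl)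

lemma ofReal_lt_distr {f : ℝ → ℝ} {t s : ℝ} (h : ENNReal.ofReal t < distr f s) : t < 1 := by
  have := h.trans_le (distr_le_one f s)
  simpa using this

/-- Level sets of a rearrangement are intervals starting at $0$. This gives equimeasurability, and
their nestedness is the core of the Hardy–Littlewood inequality. -/
lemma setOf_lt_rearr (x : S01) {s : ℝ} (hs : 0 ≤ s) :
    {u : ℝ | s < |rearr x u|} ∩ Ioo 0 1 = Ioo 0 (distr x s).toReal := by
  ext u
  simp only [mem_inter_iff, mem_ofPred_eq, mem_Ioo, abs_of_nonneg (rearr_nonneg x u)]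
  constructor
  · rintro ⟨h1, h2, h3⟩
    rw [lt_rearr_iff x h2 hs] at h1
    exact ⟨h2, (ENNReal.ofReal_lt_iff_lt_toReal h2.le (distr_ne_top _ _)).1 h1⟩
  · rintro ⟨h1, h2⟩
    have h3 := (ENNReal.ofReal_lt_iff_lt_toReal h1.le (distr_ne_top _ _)).2 h2
    exact ⟨(lt_rearr_iff x h1 hs).2 h3, h1, ofReal_lt_distr h3⟩

lemma distr_rearr (x : S01) {s : ℝ} (hs : 0 ≤ s) : distr (rearr x) s = distr x s := by
  rw [distr, m01_apply, setOf_lt_rearr x hs, Real.volume_Ioo, sub_zero,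
    ENNReal.ofReal_toReal (distr_ne_top _ _)]

lemma ae_mem_Ioo : ∀ᵐ u ∂m01, u ∈ Ioo (0 : ℝ) 1 := ae_restrict_mem measurableSet_Ioo

lemma aemeasurable_of_antitoneOn {g : ℝ → ℝ} (hg : AntitoneOn g (Ioo 0 1)) :
    AEMeasurable g m01 := aemeasurable_restrict_of_antitoneOn measurableSet_Ioo hg

lemma aemeasurable_rearr (x : S01) : AEMeasurable (rearr x) m01 :=
  aemeasurable_of_antitoneOn ((rearr_antitone x).mono fun _ h => h.1)

/-- The class of an a.e. measurable function. -/
def toS (f : ℝ → ℝ) : S01 :=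
  open Classical in if h : AEStronglyMeasurable f m01 then AEEqFun.mk f h else 0

lemma coe_toS {f : ℝ → ℝ} (hf : AEMeasurable f m01) : (fun t => toS f t) =ᵐ[m01] f := by
  rw [toS, dif_pos hf.aestronglyMeasurable]
  exact AEEqFun.coeFn_mk _ _

lemma distr_toS {f : ℝ → ℝ} (hf : AEMeasurable f m01) (s : ℝ) : distr (toS f) s = distr f s :=
  distr_congr (coe_toS hf) s

lemma rearr_eq_of_distr_eq {x y : S01} (h : ∀ s, 0 ≤ s → distr x s = distr y s) {t : ℝ}
    (ht : 0 < t) : rearr x t = rearr y t :=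
  le_antisymm (rearr_le_rearr_of_distr_le (fun s hs => (h s hs).le) ht)
    (rearr_le_rearr_of_distr_le (fun s hs => (h s hs).ge) ht)

lemma rearr_toS_rearr (x : S01) {t : ℝ} (ht : 0 < t) : rearr (toS (rearr x)) t = rearr x t :=
  rearr_eq_of_distr_eq (fun s hs => by rw [distr_toS (aemeasurable_rearr x), distr_rearr x hs]) ht

lemma coe_le_coe_iff {x y : S01} : x ≤ y ↔ ∀ᵐ u ∂m01, x u ≤ y u :=
  (AEEqFun.coeFn_le).symm

lemma abs_le_abs_iff {x y : S01} : |x| ≤ |y| ↔ ∀ᵐ u ∂m01, |x u| ≤ |y u| := by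
  rw [coe_le_coe_iff]
  constructor
  · intro h
    filter_upwards [h, AEEqFun.coeFn_abs x, AEEqFun.coeFn_abs y] with u h1 h2 h3
    rwa [h2, h3] at h1
  · intro h
    filter_upwards [h, AEEqFun.coeFn_abs x, AEEqFun.coeFn_abs y] with u h1 h2 h3
    rwa [h2, h3]

lemma rearr_mono {x y : S01} (h : |x| ≤ |y|) {t : ℝ} (ht : 0 < t) : rearr x t ≤ rearr y t :=
  rearr_le_rearr_of_distr_le (fun s _ => distr_mono_ae (abs_le_abs_iff.1 h) s) ht

lemma rearr_le_add {x y z : S01} (h : ∀ᵐ u ∂m01, |z u| ≤ |x u| + |y u|) {s t : ℝ} (hs : 0 < s)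
    (ht : 0 < t) : rearr z (s + t) ≤ rearr x s + rearr y t := by
  have hx := rearr_nonneg x s
  have hy := rearr_nonneg y t
  rw [rearr_le_iff z (by linarith) (by linarith), ENNReal.ofReal_add hs.le ht.le]
  have h1 : distr z (rearr x s + rearr y t) ≤
      distr ((fun u => |x u|) + fun u => |y u|) (rearr x s + rearr y t) := by
    refine distr_mono_ae ?_ _
    filter_upwards [h] with u hu
    exact hu.trans (le_abs_self _)
  refine h1.trans ((distr_add_le _ _ _ _).trans (add_le_add ?_ ?_))
  · have := (rearr_le_iff x hs hx).1 le_rfl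
    simpa [distr] using this
  · have := (rearr_le_iff y ht hy).1 le_rfl
    simpa [distr] using this

lemma rearr_add_le (x y : S01) {s t : ℝ} (hs : 0 < s) (ht : 0 < t) :
    rearr (x + y) (s + t) ≤ rearr x s + rearr y t := by
  refine rearr_le_add ?_ hs ht
  filter_upwards [AEEqFun.coeFn_add x y] with u hu
  rw [hu]
  exact abs_add_le _ _

lemma rearr_smul (c : ℝ) (x : S01) {t : ℝ} (ht : 0 < t) : rearr (c • x) t = |c| * rearr x t := by
  have hd : ∀ s, distr (c • x : S01) s = distr (fun u => c * x u) s := by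
    refine distr_congr ?_
    filter_upwards [AEEqFun.coeFn_smul c x] with u hu
    rw [hu]; rfl
  rcases eq_or_ne c 0 with rfl | hc
  · refine le_antisymm ?_ ?_
    · rw [rearr_le_iff _ ht (by simp), hd]
      simp [distr]
    · simp [rearr_nonneg]
  · have hc' : 0 < |c| := abs_pos.2 hc
    have key : ∀ s, distr (fun u => c * x u) s = distr x (s / |c|) := by
      intro s
      simp only [distr, abs_mul, div_lt_iff₀' hc']
    refine le_antisymm ?_ ?_
    · rw [rearr_le_iff _ ht (mul_nonneg hc'.le (rearr_nonneg x t)), hd, key,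
        mul_div_cancel_left₀ _ hc'.ne', ← rearr_le_iff _ ht (rearr_nonneg x t)]
    · rw [← le_div_iff₀' hc', rearr_le_iff _ ht (div_nonneg (rearr_nonneg _ t) hc'.le), ← key, ← hd,
        ← rearr_le_iff _ ht (rearr_nonneg _ t)]

lemma rearr_zero {t : ℝ} (ht : 0 < t) : rearr 0 t = 0 := by
  have := rearr_smul 0 0 ht
  simpa using this

lemma eq_zero_of_rearr_eq_zero {x : S01} (h : ∀ t ∈ Ioo (0 : ℝ) 1, rearr x t = 0) : x = 0 := by
  have h0 : distr x 0 = 0 := by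
    refine le_antisymm ?_ zero_le
    refine ENNReal.le_of_forall_pos_le_add fun ε hε _ => ?_
    have h1 : (0 : ℝ) < min ε (1 / 2) := lt_min (by exact_mod_cast hε) (by norm_num)
    have := (rearr_le_iff x h1 le_rfl).1
      (h _ ⟨h1, lt_of_le_of_lt (min_le_right _ _) (by norm_num)⟩).le
    refine this.trans ?_
    rw [zero_add]
    exact (ENNReal.ofReal_le_ofReal (min_le_left _ _)).trans (by simp)
  apply AEEqFun.ext
  have h1 : ∀ᵐ u ∂m01, ¬ (0 < |x u|) := by
    rw [ae_iff]; simpa [distr] using h0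
  filter_upwards [h1, AEEqFun.coeFn_zero (μ := m01) (β := ℝ) (α := ℝ)] with u hu h0
  rw [h0]
  simpa using hu

/-! ### Decreasing right-continuous functions -/

/-- Nonnegative decreasing right-continuous functions on `(0,1)`. -/
structure IsRearr (g : ℝ → ℝ) : Prop where
  antitone : AntitoneOn g (Ioo 0 1)
  nonneg : ∀ t ∈ Ioo (0 : ℝ) 1, 0 ≤ g t
  cont : ∀ t ∈ Ioo (0 : ℝ) 1, ContinuousWithinAt g (Ioi t) t

lemma isRearr_rearr (x : S01) : IsRearr (rearr x) where
  antitone := (rearr_antitone x).mono fun _ h => h.1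
  nonneg t _ := rearr_nonneg x t
  cont := by
    intro t ht
    refine tendsto_order.2 ⟨fun a ha => ?_, fun a ha => ?_⟩
    · rcases lt_or_ge a 0 with h0 | h0
      · exact Eventually.of_forall fun u => h0.trans_le (rearr_nonneg x u)
      · rw [lt_rearr_iff x ht.1 h0, ENNReal.ofReal_lt_iff_lt_toReal ht.1.le (distr_ne_top _ _)] at ha
        filter_upwards [Ioo_mem_nhdsGT ha] with u hu
        have hu0 : 0 < u := ht.1.trans hu.1
        rw [lt_rearr_iff x hu0 h0]
        exact (ENNReal.ofReal_lt_iff_lt_toReal hu0.le (distr_ne_top _ _)).2 hu.2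
    · filter_upwards [self_mem_nhdsWithin] with u hu
      exact (rearr_antitone x ht.1 (ht.1.trans hu) (le_of_lt hu)).trans_lt ha

lemma IsRearr.add {f g : ℝ → ℝ} (hf : IsRearr f) (hg : IsRearr g) : IsRearr (fun t => f t + g t) where
  antitone := hf.antitone.add hg.antitone
  nonneg t ht := add_nonneg (hf.nonneg t ht) (hg.nonneg t ht)
  cont t ht := (hf.cont t ht).add (hg.cont t ht)

lemma IsRearr.aemeasurable {g : ℝ → ℝ} (hg : IsRearr g) : AEMeasurable g m01 :=
  aemeasurable_of_antitoneOn hg.antitone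

lemma m01_Ioo {a : ℝ} (ha1 : a ≤ 1) : m01 (Ioo 0 a) = ENNReal.ofReal a := by
  rw [m01_apply, Ioo_inter_Ioo]
  simp [ha1]

/-- Monotonicity gives `≤`. Right continuity gives `≥`: a strict inequality at $t$ persists slightly
beyond $t$, which makes a level set too large. This lets sums of rearrangements be treated as
rearrangements. -/
lemma IsRearr.rearr_toS {g : ℝ → ℝ} (hg : IsRearr g) {t : ℝ} (ht : t ∈ Ioo (0 : ℝ) 1) :
    rearr (toS g) t = g t := by
  refine le_antisymm ?_ ?_
  · rw [rearr_le_iff _ ht.1 (hg.nonneg t ht), distr_toS hg.aemeasurable, ← m01_Ioo ht.2.le]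
    refine measure_mono_ae ?_
    filter_upwards [ae_mem_Ioo] with u hu h
    have h' : g t < |g u| := h
    refine ⟨hu.1, ?_⟩
    by_contra hcon
    rw [abs_of_nonneg (hg.nonneg u hu)] at h'
    exact (hg.antitone ht hu (not_lt.1 hcon)).not_gt h'
  · by_contra! hcon
    have h1 := ((hg.cont t ht).eventually (lt_mem_nhds hcon)).and (Ioo_mem_nhdsGT ht.2)
    obtain ⟨u, hu, hu1, hu2⟩ := h1.exists
    refine lt_irrefl (rearr (toS g) t) ?_
    rw [lt_rearr_iff _ ht.1 (rearr_nonneg _ t), distr_toS hg.aemeasurable]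
    refine ((ENNReal.ofReal_lt_ofReal_iff (ht.1.trans hu1)).2 hu1).trans_le ?_
    rw [← m01_Ioo hu2.le]
    refine measure_mono fun v hv => ?_
    have hv' : v ∈ Ioo (0 : ℝ) 1 := ⟨hv.1, hv.2.trans hu2⟩
    exact hu.trans_le ((hg.antitone hv' ⟨ht.1.trans hu1, hu2⟩ hv.2.le).trans (le_abs_self _))

/-! ### Integrability of the rearrangement -/

lemma lintegral_eq_lintegral_distr {f : ℝ → ℝ} (hf : AEMeasurable f m01) :
    ∫⁻ u, ENNReal.ofReal |f u| ∂m01 = ∫⁻ s in Ioi 0, distr f s :=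
  lintegral_eq_lintegral_meas_lt _ (Eventually.of_forall fun _ => abs_nonneg _)
    (by fun_prop)

lemma lintegral_rearr (x : S01) :
    ∫⁻ u, ENNReal.ofReal (rearr x u) ∂m01 = ∫⁻ u, ENNReal.ofReal |x u| ∂m01 := by
  have h := lintegral_eq_lintegral_distr (aemeasurable_rearr x)
  simp only [abs_of_nonneg (rearr_nonneg x _)] at h
  rw [h, lintegral_eq_lintegral_distr (aemeasurable_coe x)]
  exact setLIntegral_congr_fun measurableSet_Ioi fun s hs => distr_rearr x (le_of_lt hs)

lemma MemL1.integrable_rearr {x : S01} (hx : MemL1 x) : Integrable (rearr x) m01 := by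
  refine ⟨(aemeasurable_rearr x).aestronglyMeasurable, ?_⟩
  have h := hx.2
  rw [hasFiniteIntegral_iff_norm] at h ⊢
  simp only [Real.norm_eq_abs, abs_of_nonneg (rearr_nonneg x _)] at h ⊢
  rwa [lintegral_rearr]

lemma integral_rearr {x : S01} (hx : MemL1 x) : ∫ u, rearr x u ∂m01 = ∫ u, |x u| ∂m01 := by
  rw [integral_eq_lintegral_of_nonneg_ae (Eventually.of_forall fun u => rearr_nonneg x u)
    (aemeasurable_rearr x).aestronglyMeasurable, integral_eq_lintegral_of_nonneg_ae
    (Eventually.of_forall fun u => abs_nonneg _) hx.1.norm, lintegral_rearr]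

lemma intervalIntegrable_m01 {g : ℝ → ℝ} (hg : Integrable g m01) {a b : ℝ} (ha : 0 ≤ a)
    (hab : a ≤ b) (hb : b ≤ 1) : IntervalIntegrable g volume a b := by
  rw [intervalIntegrable_iff_integrableOn_Ioo_of_le hab]
  exact IntegrableOn.mono_set (t := Ioo 0 1) hg (Ioo_subset_Ioo ha hb)

/-! ### Symmetric quasi-Banach function spaces -/

instance : AddLeftMono S01 := ⟨fun a b c h => by
  rw [coe_le_coe_iff] at h ⊢
  filter_upwards [h, AEEqFun.coeFn_add a b, AEEqFun.coeFn_add a c] with u h1 h2 h3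
  rw [h2, h3, Pi.add_apply, Pi.add_apply]
  exact add_le_add_right h1 _⟩

instance : AddRightMono S01 := addRightMono_of_addLeftMono _

namespace IsSymmetricQuasiBanach

variable {E : FunSpace}

lemma qnorm_zero (hE : IsSymmetricQuasiBanach E) : E.qnorm 0 = 0 := by
  simpa using hE.qnorm_smul 0 0 hE.zero_mem

lemma exists_const (hE : IsSymmetricQuasiBanach E) : ∃ K : ℝ, 1 ≤ K ∧ ∀ x ∈ E.carrier,
    ∀ y ∈ E.carrier, E.qnorm (x + y) ≤ K * (E.qnorm x + E.qnorm y) := by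
  obtain ⟨K, hK⟩ := hE.quasi_triangle
  refine ⟨max K 1, le_max_right _ _, fun x hx y hy => (hK x hx y hy).trans ?_⟩
  exact mul_le_mul_of_nonneg_right (le_max_left _ _) (add_nonneg (hE.nonneg x hx) (hE.nonneg y hy))

lemma toS_rearr (hE : IsSymmetricQuasiBanach E) {x : S01} (hx : x ∈ E.carrier) :
    toS (rearr x) ∈ E.carrier ∧ E.qnorm (toS (rearr x)) = E.qnorm x :=
  hE.symmetric x hx _ fun _ ht => rearr_toS_rearr x ht.1

/-- Solidity and symmetry combine by passing through the decreasing representatives, which are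
ordered pointwise. -/
lemma of_rearr_le (hE : IsSymmetricQuasiBanach E) {x y : S01} (hx : x ∈ E.carrier)
    (h : ∀ t ∈ Ioo (0 : ℝ) 1, rearr y t ≤ rearr x t) :
    y ∈ E.carrier ∧ E.qnorm y ≤ E.qnorm x := by
  obtain ⟨h1, h2⟩ := hE.toS_rearr hx
  have h3 : |toS (rearr y)| ≤ |toS (rearr x)| := by
    rw [abs_le_abs_iff]
    filter_upwards [coe_toS (aemeasurable_rearr x), coe_toS (aemeasurable_rearr y), ae_mem_Ioo]
      with u hu1 hu2 hu
    rw [hu1, hu2, abs_of_nonneg (rearr_nonneg _ _), abs_of_nonneg (rearr_nonneg _ _)]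
    exact h u hu
  obtain ⟨h4, h5⟩ := hE.solid _ h1 _ h3
  obtain ⟨h6, h7⟩ := hE.symmetric _ h4 y fun t ht => (rearr_toS_rearr y ht.1).symm
  exact ⟨h6, by rw [h7, ← h2]; exact h5⟩

lemma abs_mem (hE : IsSymmetricQuasiBanach E) {x : S01} (hx : x ∈ E.carrier) :
    |x| ∈ E.carrier ∧ E.qnorm |x| ≤ E.qnorm x :=
  hE.solid x hx _ (abs_abs x).le

lemma sum_mem (hE : IsSymmetricQuasiBanach E) {z : ℕ → S01} (hz : ∀ k, z k ∈ E.carrier) (n : ℕ) :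
    ∑ k ∈ Finset.range n, z k ∈ E.carrier := by
  induction n with
  | zero => simpa using hE.zero_mem
  | succ n ih => rw [Finset.sum_range_succ]; exact hE.add_mem _ ih _ (hz n)

lemma neg_mem (hE : IsSymmetricQuasiBanach E) {x : S01} (hx : x ∈ E.carrier) :
    -x ∈ E.carrier ∧ E.qnorm (-x) = E.qnorm x := by
  have h1 := hE.smul_mem (-1) x hx
  have h2 := hE.qnorm_smul (-1) x hx
  simpa using And.intro h1 h2

lemma sub_mem (hE : IsSymmetricQuasiBanach E) {x y : S01} (hx : x ∈ E.carrier)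
    (hy : y ∈ E.carrier) : x - y ∈ E.carrier := by
  rw [sub_eq_add_neg]
  exact hE.add_mem _ hx _ (hE.neg_mem hy).1

/-- Sequences in `E` of rapidly decreasing quasi-norm have order bounded partial sums. -/
lemma exists_dominating (hE : IsSymmetricQuasiBanach E) :
    ∃ δ : ℕ → ℝ, (∀ k, 0 < δ k) ∧ ∀ z : ℕ → S01, (∀ k, z k ∈ E.carrier) →
      (∀ k, E.qnorm (z k) ≤ δ k) → (∀ k, 0 ≤ z k) →
      ∃ s ∈ E.carrier, ∀ n, ∑ k ∈ Finset.range n, z k ≤ s := by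
  obtain ⟨K, hK1, hK⟩ := hE.exists_const
  have hK0 : 0 < K := by linarith
  -- The ratio $1/(2K)$ absorbs the quasi-triangle constant:
  -- $K\bigl(2K(2K)^{-m-1}+(2K)^{-m}\bigr)=2K(2K)^{-m}$.
  refine ⟨fun k => (1 / (2 * K)) ^ k, fun k => by positivity, fun z hz hzn hz0 => ?_⟩
  have tail : ∀ n m, E.qnorm (∑ i ∈ Finset.range n, z (m + i)) ≤ 2 * K * (1 / (2 * K)) ^ m := by
    intro n
    induction n with
    | zero =>
      intro m
      rw [Finset.sum_range_zero, hE.qnorm_zero]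
      positivity
    | succ n ih =>
      intro m
      -- The first term is split off, not the last, so that the constant $K$ does not compound.
      rw [Finset.sum_range_succ']
      have h1 := ih (m + 1)
      have h2 := hzn m
      have e : ∑ i ∈ Finset.range n, z (m + (i + 1)) = ∑ i ∈ Finset.range n, z (m + 1 + i) :=
        Finset.sum_congr rfl fun i _ => congrArg z (by ring)
      rw [e, add_zero]
      refine (hK _ (hE.sum_mem (fun i => hz _) n) _ (hz m)).trans ?_
      calc K * (E.qnorm (∑ i ∈ Finset.range n, z (m + 1 + i)) + E.qnorm (z m))
          ≤ K * (2 * K * (1 / (2 * K)) ^ (m + 1) + (1 / (2 * K)) ^ m) := by gcongr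
        _ = 2 * K * (1 / (2 * K)) ^ m := by rw [pow_succ]; field_simp; ring
  have diff : ∀ m j, m ≤ j → E.qnorm (∑ k ∈ Finset.range j, z k - ∑ k ∈ Finset.range m, z k) ≤
      2 * K * (1 / (2 * K)) ^ m := by
    intro m j hmj
    obtain ⟨n, rfl⟩ := Nat.exists_eq_add_of_le hmj
    rw [Finset.sum_range_add, add_sub_cancel_left]
    exact tail n m
  have hlim : Tendsto (fun m : ℕ => 2 * K * (1 / (2 * K)) ^ m) atTop (𝓝 0) := by
    have : Tendsto (fun m : ℕ => (1 / (2 * K)) ^ m) atTop (𝓝 0) :=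
      tendsto_pow_atTop_nhds_zero_of_lt_one (by positivity) (by
        rw [div_lt_one (by positivity)]; linarith)
    simpa using this.const_mul (2 * K)
  have hmem := hE.sum_mem hz
  obtain ⟨s, hs, hlims⟩ := hE.complete (fun n => ∑ k ∈ Finset.range n, z k) hmem (by
    intro ε hε
    obtain ⟨N, hN⟩ := eventually_atTop.1 (hlim.eventually (gt_mem_nhds hε))
    refine ⟨N, fun i hi j hj => ?_⟩
    rcases le_total i j with h | h
    · rw [← neg_sub, (hE.neg_mem (hE.sub_mem (hmem j) (hmem i))).2]
      exact (diff i j h).trans_lt (hN i hi)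
    · exact (diff j i h).trans_lt (hN j hj))
  refine ⟨s, hs, fun n => ?_⟩
  set S : ℕ → S01 := fun n => ∑ k ∈ Finset.range n, z k
  have hmono : Monotone S := by
    refine monotone_nat_of_le_succ fun k => ?_
    show S k ≤ ∑ k ∈ Finset.range (k + 1), z k
    rw [Finset.sum_range_succ]
    exact le_add_of_nonneg_right (hz0 k)
  -- Only convergence in quasi-norm is available. For $m\ge n$ monotonicity gives
  -- $(S_n-s)^+\le|S_m-s|$, so by solidity the quasi-norm of $(S_n-s)^+$ is below a null sequence
  -- and vanishes.
  have hpos : ∀ m ≥ n, |(S n - s)⁺| ≤ |S m - s| := by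
    intro m hm
    rw [abs_of_nonneg (posPart_nonneg _)]
    exact (posPart_mono (sub_le_sub_right (hmono hm) s)).trans (sup_le (le_abs_self _) (abs_nonneg _))
  have hsub : ∀ m, S m - s ∈ E.carrier := fun m => hE.sub_mem (hmem m) hs
  have hp0 : (S n - s)⁺ ∈ E.carrier := (hE.solid _ (hsub n) _ (hpos n le_rfl)).1
  have hzero : E.qnorm ((S n - s)⁺) = 0 := by
    refine le_antisymm ?_ (hE.nonneg _ hp0)
    refine ge_of_tendsto hlims ?_
    filter_upwards [eventually_ge_atTop n] with m hm
    exact (hE.solid _ (hsub m) _ (hpos m hm)).2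
  have := hE.eq_zero _ hp0 hzero
  rw [posPart_eq_zero] at this
  exact sub_nonpos.1 this

/-- A symmetric quasi-Banach space contained in `L_1` embeds continuously. -/
lemma exists_integral_le (hE : IsSymmetricQuasiBanach E) (hL1 : ∀ x ∈ E.carrier, MemL1 x) :
    ∃ C : ℝ, 0 < C ∧ ∀ y ∈ E.carrier, ∫ u, |y u| ∂m01 ≤ C * E.qnorm y := by
  obtain ⟨δ, hδ, hdom⟩ := hE.exists_dominating
  by_contra! hcon
  have hC : ∀ k : ℕ, 0 < ((k : ℝ) + 1) / δ k := fun k => div_pos (by positivity) (hδ k)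
  -- If no constant works, choose $y_k$ with integral larger than $(k+1)/\delta_k$ times its
  -- quasi-norm. After rescaling to quasi-norm at most $\delta_k$, all the $|y_k|$ lie below one
  -- $s\in E$, whose integral then exceeds every $k$.
  choose y hy hint using fun k => hcon _ (hC k)
  have hpos : ∀ k, 0 < E.qnorm (y k) := by
    intro k
    refine lt_of_le_of_ne (hE.nonneg _ (hy k)) fun h => ?_
    have h0 := hE.eq_zero _ (hy k) h.symm
    have := hint k
    rw [← h, mul_zero] at this
    have e : ∫ u, |y k u| ∂m01 = 0 := by
      rw [h0]
      refine integral_eq_zero_of_ae ?_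
      filter_upwards [AEEqFun.coeFn_zero (μ := m01) (β := ℝ) (α := ℝ)] with u hu
      simp [hu]
    linarith
  have hmem : ∀ k, (δ k / E.qnorm (y k)) • |y k| ∈ E.carrier := fun k =>
    hE.smul_mem _ _ (hE.abs_mem (hy k)).1
  have hc : ∀ k, 0 < δ k / E.qnorm (y k) := fun k => div_pos (hδ k) (hpos k)
  have hcoe : ∀ k, ∀ᵐ u ∂m01, ((δ k / E.qnorm (y k)) • |y k| : S01) u =
      δ k / E.qnorm (y k) * |y k u| := by
    intro k
    filter_upwards [AEEqFun.coeFn_smul (δ k / E.qnorm (y k)) |y k|, AEEqFun.coeFn_abs (y k)]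
      with u h1 h2
    rw [h1, Pi.smul_apply, h2, smul_eq_mul]
  obtain ⟨s, hs, hle⟩ := hdom _ hmem (fun k => by
    rw [hE.qnorm_smul _ _ (hE.abs_mem (hy k)).1, abs_of_pos (hc k)]
    calc _ ≤ δ k / E.qnorm (y k) * E.qnorm (y k) :=
          mul_le_mul_of_nonneg_left (hE.abs_mem (hy k)).2 (hc k).le
      _ = δ k := div_mul_cancel₀ _ (hpos k).ne') (fun k => by
    rw [coe_le_coe_iff]
    filter_upwards [hcoe k, AEEqFun.coeFn_zero (μ := m01) (β := ℝ) (α := ℝ)] with u h1 h2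
    rw [h1, h2]
    exact mul_nonneg (hc k).le (abs_nonneg _))
  have hz0 : ∀ k, (0 : S01) ≤ (δ k / E.qnorm (y k)) • |y k| := fun k => by
    rw [coe_le_coe_iff]
    filter_upwards [hcoe k, AEEqFun.coeFn_zero (μ := m01) (β := ℝ) (α := ℝ)] with u h1 h2
    rw [h1, h2]
    exact mul_nonneg (hc k).le (abs_nonneg _)
  have hk : ∀ k : ℕ, (k : ℝ) + 1 ≤ ∫ u, s u ∂m01 := by
    intro k
    have h1 : (δ k / E.qnorm (y k)) • |y k| ≤ s := by
      refine le_trans ?_ (hle (k + 1))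
      exact Finset.single_le_sum (f := fun k => (δ k / E.qnorm (y k)) • |y k|)
        (fun i _ => hz0 i) (Finset.self_mem_range_succ k)
    have h2 : ∫ u, δ k / E.qnorm (y k) * |y k u| ∂m01 ≤ ∫ u, s u ∂m01 := by
      refine integral_mono_ae ((hL1 _ (hy k)).abs.const_mul _) (hL1 _ hs) ?_
      filter_upwards [coe_le_coe_iff.1 h1, hcoe k] with u h1 h2
      rw [← h2]; exact h1
    refine le_trans ?_ h2
    rw [integral_const_mul]
    have h3 := mul_le_mul_of_nonneg_left (hint k).le (hc k).le
    refine le_trans (le_of_eq ?_) h3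
    have := (hpos k).ne'
    have := (hδ k).ne'
    field_simp
  obtain ⟨n, hn⟩ := exists_nat_ge (∫ u, s u ∂m01)
  linarith [hk n]

/-- A weighted sum of rearrangements of elements of rapidly decreasing quasi-norm is dominated
by the rearrangement of an element of the space. -/
lemma exists_rearr_dominating (hE : IsSymmetricQuasiBanach E) (c : ℕ → ℝ) (hc : ∀ k, 0 < c k) :
    ∃ δ : ℕ → ℝ, (∀ k, 0 < δ k) ∧ ∀ y : ℕ → S01, (∀ k, y k ∈ E.carrier) →
      (∀ k, E.qnorm (y k) ≤ δ k) → ∃ s ∈ E.carrier, ∀ n, ∀ t ∈ Ioo (0 : ℝ) 1,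
        ∑ k ∈ Finset.range n, c k * rearr (y k) t ≤ rearr s t := by
  obtain ⟨δ, hδ, hdom⟩ := hE.exists_dominating
  refine ⟨fun k => δ k / c k, fun k => div_pos (hδ k) (hc k), fun y hy hyn => ?_⟩
  have hcoe : ∀ k, ∀ᵐ u ∂m01, (c k • toS (rearr (y k)) : S01) u = c k * rearr (y k) u := by
    intro k
    filter_upwards [AEEqFun.coeFn_smul (c k) (toS (rearr (y k))),
      coe_toS (aemeasurable_rearr (y k))] with u h1 h2
    rw [h1, Pi.smul_apply, h2, smul_eq_mul]
  obtain ⟨s, hs, hle⟩ := hdom (fun k => c k • toS (rearr (y k)))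
    (fun k => hE.smul_mem _ _ (hE.toS_rearr (hy k)).1) (fun k => by
      rw [hE.qnorm_smul _ _ (hE.toS_rearr (hy k)).1, (hE.toS_rearr (hy k)).2, abs_of_pos (hc k),
        ← le_div_iff₀' (hc k)]
      exact hyn k) (fun k => by
      rw [coe_le_coe_iff]
      filter_upwards [hcoe k, AEEqFun.coeFn_zero (μ := m01) (β := ℝ) (α := ℝ)] with u h1 h2
      rw [h1, h2]
      exact mul_nonneg (hc k).le (rearr_nonneg _ _))
  refine ⟨s, hs, fun n t ht => ?_⟩
  -- The partial sums are decreasing and right-continuous, hence their own rearrangements, so the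
  -- order bound by $s$ passes to rearrangements.
  have hR : ∀ n, IsRearr fun t => ∑ k ∈ Finset.range n, c k * rearr (y k) t := by
    intro n
    induction n with
    | zero => exact ⟨by simp [AntitoneOn], by simp, by simp [continuousWithinAt_const]⟩
    | succ n ih =>
      simp only [Finset.sum_range_succ]
      have h := isRearr_rearr (y n)
      refine ih.add ⟨fun a ha b hb hab => mul_le_mul_of_nonneg_left (h.antitone ha hb hab)
        (hc n).le, fun t ht => mul_nonneg (hc n).le (h.nonneg t ht), fun t ht =>
        (h.cont t ht).const_mul _⟩
  rw [← (hR n).rearr_toS ht]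
  refine rearr_mono ?_ ht.1
  rw [abs_le_abs_iff]
  have hsum : ∀ n, ∀ᵐ u ∂m01, (∑ k ∈ Finset.range n, c k • toS (rearr (y k)) : S01) u =
      ∑ k ∈ Finset.range n, c k * rearr (y k) u := by
    intro n
    induction n with
    | zero =>
      filter_upwards [AEEqFun.coeFn_zero (μ := m01) (β := ℝ) (α := ℝ)] with u hu
      rw [Finset.sum_range_zero, hu, Finset.sum_range_zero, Pi.zero_apply]
    | succ n ih =>
      simp only [Finset.sum_range_succ]
      filter_upwards [ih, hcoe n, AEEqFun.coeFn_add (∑ k ∈ Finset.range n, c k • toS (rearr (y k)))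
        (c n • toS (rearr (y n)))] with u h1 h2 h3
      rw [h3, Pi.add_apply, h1, h2]
  filter_upwards [coe_toS (hR n).aemeasurable, hsum n, coe_le_coe_iff.1 (hle n), ae_mem_Ioo]
    with u h1 h2 h3 hu
  rw [h1, abs_of_nonneg ((hR n).nonneg u hu), ← h2]
  exact h3.trans (le_abs_self _)

/-- The dilation `x ↦ μ(x)(·/2)` is bounded. -/
lemma exists_dilation (hE : IsSymmetricQuasiBanach E) : ∃ K : ℝ, 1 ≤ K ∧ ∀ x ∈ E.carrier,
    ∃ z ∈ E.carrier, E.qnorm z ≤ K * E.qnorm x ∧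
      ∀ t ∈ Ioo (0 : ℝ) 1, rearr x (t / 2) ≤ rearr z t := by
  obtain ⟨K, hK1, hK⟩ := hE.exists_const
  refine ⟨2 * K, by linarith, fun x hx => ?_⟩
  -- Two disjoint copies of $\mu(x)|_{(0,1/2)}$, one in each half of $(0,1)$: each is controlled by
  -- $x$, and their sum doubles the measure of level sets.
  set f : ℝ → ℝ := (Ioo (0 : ℝ) (1 / 2)).indicator (rearr x) with hf
  set g : ℝ → ℝ := (Ioo (1 / 2 : ℝ) 1).indicator (fun u => rearr x (u - 1 / 2)) with hg
  have hfm : AEMeasurable f m01 := (aemeasurable_rearr x).indicator measurableSet_Ioo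
  have hgm : AEMeasurable g m01 := by
    rw [hg, aemeasurable_indicator_iff measurableSet_Ioo]
    have : m01.restrict (Ioo (1 / 2 : ℝ) 1) = volume.restrict (Ioo (1 / 2 : ℝ) 1) := by
      rw [m01, Measure.restrict_restrict measurableSet_Ioo, inter_eq_left.2]
      exact Ioo_subset_Ioo_left (by norm_num)
    rw [this]
    refine aemeasurable_restrict_of_antitoneOn measurableSet_Ioo ?_
    intro a ha b hb hab
    exact rearr_antitone x (by simpa using ha.1) (by simpa using hb.1) (by linarith)
  have hf0 : ∀ u, 0 ≤ f u := fun u => indicator_nonneg (fun _ _ => rearr_nonneg _ _) u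
  have hg0 : ∀ u, 0 ≤ g u := fun u => indicator_nonneg (fun _ _ => rearr_nonneg _ _) u
  have hfE := hE.of_rearr_le (y := toS f) hx fun t ht => by
    refine (rearr_le_rearr_of_distr_le (y := toS (rearr x)) (fun s hs => ?_) ht.1).trans
      (rearr_toS_rearr x ht.1).le
    rw [distr_toS hfm, distr_toS (aemeasurable_rearr x)]
    refine distr_mono_ae (Eventually.of_forall fun u => ?_) s
    rw [abs_of_nonneg (hf0 u), abs_of_nonneg (rearr_nonneg _ _)]
    exact indicator_le_self' (fun _ _ => rearr_nonneg _ _) u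
  have hgE := hE.of_rearr_le (y := toS g) hx fun t ht => by
    refine rearr_le_rearr_of_distr_le (fun s hs => ?_) ht.1
    rw [distr_toS hgm, distr, m01_apply]
    have h1 : {u | s < |g u|} ∩ Ioo 0 1 ⊆ Ioo (1 / 2) (1 / 2 + (distr x s).toReal) := by
      rintro u ⟨hu, -⟩
      have hu' : s < |g u| := hu
      rw [abs_of_nonneg (hg0 u)] at hu'
      have hmem : u ∈ Ioo (1 / 2 : ℝ) 1 := by
        by_contra hcon
        rw [hg, indicator_of_notMem hcon] at hu'
        exact hs.not_gt hu'
      rw [hg, indicator_of_mem hmem, lt_rearr_iff x (by linarith [hmem.1]) hs,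
        ENNReal.ofReal_lt_iff_lt_toReal (by linarith [hmem.1]) (distr_ne_top _ _)] at hu'
      exact ⟨hmem.1, by linarith⟩
    refine (measure_mono h1).trans ?_
    rw [Real.volume_Ioo, add_sub_cancel_left, ENNReal.ofReal_toReal (distr_ne_top _ _)]
  refine ⟨toS f + toS g, hE.add_mem _ hfE.1 _ hgE.1, ?_, fun t ht => ?_⟩
  · refine (hK _ hfE.1 _ hgE.1).trans ?_
    have := hfE.2
    have := hgE.2
    nlinarith
  · by_contra! hcon
    set s := rearr (toS f + toS g) t with hs
    have hs0 : 0 ≤ s := rearr_nonneg _ _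
    -- Right continuity provides $r>t/2$ where $\mu(r;x)$ still exceeds $s$. The two copies exceed
    -- $s$ on a set of measure $2r>t$, a contradiction.
    have hc := ((isRearr_rearr x).cont (t / 2) ⟨by linarith [ht.1], by linarith [ht.2]⟩).eventually
      (lt_mem_nhds hcon)
    have hc2 : ∀ᶠ u in 𝓝[>] (t / 2), u ∈ Ioo (t / 2) (1 / 2) :=
      Ioo_mem_nhdsGT (by linarith [ht.2])
    obtain ⟨r, hr, hr1, hr2⟩ := (hc.and hc2).exists
    have hr0 : 0 < r := by linarith [ht.1]
    refine lt_irrefl s ?_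
    conv_rhs => rw [hs]
    rw [lt_rearr_iff _ ht.1 hs0]
    have hd : distr (toS f + toS g : S01) s = distr (fun u => f u + g u) s := by
      refine distr_congr ?_ s
      filter_upwards [AEEqFun.coeFn_add (toS f) (toS g), coe_toS hfm, coe_toS hgm] with u h1 h2 h3
      rw [h1, Pi.add_apply, h2, h3]
    have hsub : Ioo 0 r ∪ Ioo (1 / 2) (1 / 2 + r) ⊆ {u | s < |f u + g u|} ∩ Ioo 0 1 := by
      rintro u (hu | hu)
      · refine ⟨?_, hu.1, by linarith [hu.2]⟩
        have h1 : f u = rearr x u := indicator_of_mem (show u ∈ Ioo (0 : ℝ) (1 / 2) from ⟨hu.1, hu.2.trans hr2⟩) _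
        show s < |f u + g u|
        rw [abs_of_nonneg (add_nonneg (hf0 u) (hg0 u)), h1]
        have := rearr_antitone x hu.1 hr0 hu.2.le
        linarith [hg0 u]
      · refine ⟨?_, by linarith [hu.1], by linarith [hu.2]⟩
        have h1 : g u = rearr x (u - 1 / 2) :=
          indicator_of_mem (s := Ioo (1 / 2 : ℝ) 1) ⟨hu.1, by linarith [hu.2]⟩
          (fun u => rearr x (u - 1 / 2))
        show s < |f u + g u|
        rw [abs_of_nonneg (add_nonneg (hf0 u) (hg0 u)), h1]
        have := rearr_antitone x (show u - 1 / 2 ∈ Ioi 0 by simpa using hu.1) hr0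
          (by linarith [hu.2])
        linarith [hf0 u]
    rw [hd, distr, m01_apply]
    refine lt_of_lt_of_le ?_ (measure_mono hsub)
    rw [measure_union _ measurableSet_Ioo, Real.volume_Ioo, Real.volume_Ioo, ← ENNReal.ofReal_add,
      ENNReal.ofReal_lt_ofReal_iff]
    · linarith
    · linarith
    · linarith
    · linarith
    · rw [disjoint_left]
      intro u h1 h2
      linarith [h1.2, h2.1]

end IsSymmetricQuasiBanach

/-! ### The Calderón operator -/

section Calderon

variable {f g : ℝ → ℝ} {t : ℝ}

lemma intervalIntegrable_div (hg : Integrable g m01) {a b : ℝ} (ha : 0 < a) (hab : a ≤ b)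
    (hb : b ≤ 1) : IntervalIntegrable (fun s => g s / s) volume a b := by
  simp_rw [div_eq_mul_inv]
  refine (intervalIntegrable_m01 hg ha.le hab hb).mul_continuousOn ?_
  refine continuousOn_inv₀.mono fun s hs => ?_
  rw [uIcc_of_le hab] at hs
  exact (ha.trans_le hs.1).ne'

lemma calderon_mono (hf : Integrable f m01) (hg : Integrable g m01)
    (h : ∀ s ∈ Ioo (0 : ℝ) 1, f s ≤ g s) (ht : t ∈ Ioo (0 : ℝ) 1) :
    calderon f t ≤ calderon g t := by
  refine add_le_add (mul_le_mul_of_nonneg_left ?_ (by have := ht.1; positivity)) ?_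
  · refine intervalIntegral.integral_mono_on_of_le_Ioo ht.1.le
      (intervalIntegrable_m01 hf le_rfl ht.1.le ht.2.le)
      (intervalIntegrable_m01 hg le_rfl ht.1.le ht.2.le) fun s hs => ?_
    exact h s ⟨hs.1, hs.2.trans ht.2⟩
  · refine intervalIntegral.integral_mono_on_of_le_Ioo ht.2.le
      (intervalIntegrable_div hf ht.1 ht.2.le le_rfl)
      (intervalIntegrable_div hg ht.1 ht.2.le le_rfl) fun s hs => ?_
    have hs0 := ht.1.trans hs.1
    exact div_le_div_of_nonneg_right (h s ⟨hs0, hs.2⟩) hs0.le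

lemma calderon_add (hf : Integrable f m01) (hg : Integrable g m01) (ht : t ∈ Ioo (0 : ℝ) 1) :
    calderon (fun s => f s + g s) t = calderon f t + calderon g t := by
  simp only [calderon, add_div]
  rw [intervalIntegral.integral_add (intervalIntegrable_m01 hf le_rfl ht.1.le ht.2.le)
    (intervalIntegrable_m01 hg le_rfl ht.1.le ht.2.le),
    intervalIntegral.integral_add (intervalIntegrable_div hf ht.1 ht.2.le le_rfl)
    (intervalIntegrable_div hg ht.1 ht.2.le le_rfl)]
  ring

lemma calderon_const_mul (c : ℝ) : calderon (fun s => c * g s) t = c * calderon g t := by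
  simp only [calderon, mul_div_assoc, intervalIntegral.integral_const_mul]
  ring

lemma calderon_congr (h : ∀ s ∈ Ioo (0 : ℝ) 1, f s = g s) (ht : t ∈ Ioo (0 : ℝ) 1) :
    calderon f t = calderon g t := by
  simp only [calderon]
  rw [intervalIntegral.integral_of_le ht.1.le, intervalIntegral.integral_of_le ht.1.le,
    intervalIntegral.integral_of_le ht.2.le, intervalIntegral.integral_of_le ht.2.le]
  simp only [integral_Ioc_eq_integral_Ioo]
  have e₁ : ∫ s in Ioo 0 t, f s = ∫ s in Ioo 0 t, g s :=
    setIntegral_congr_fun measurableSet_Ioo fun s hs => h s ⟨hs.1, hs.2.trans ht.2⟩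
  have e₂ : ∫ s in Ioo t 1, f s / s = ∫ s in Ioo t 1, g s / s :=
    setIntegral_congr_fun measurableSet_Ioo fun s hs => by
      simp only [h s ⟨ht.1.trans hs.1, hs.2⟩]
  rw [e₁, e₂]

lemma calderon_nonneg (h : ∀ s ∈ Ioo (0 : ℝ) 1, 0 ≤ g s) (ht : t ∈ Ioo (0 : ℝ) 1) :
    0 ≤ calderon g t := by
  have h0 := ht.1
  refine add_nonneg (mul_nonneg (by positivity) ?_) ?_
  · rw [intervalIntegral.integral_of_le h0.le, integral_Ioc_eq_integral_Ioo]
    exact setIntegral_nonneg measurableSet_Ioo fun s hs => h s ⟨hs.1, hs.2.trans ht.2⟩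
  · rw [intervalIntegral.integral_of_le ht.2.le, integral_Ioc_eq_integral_Ioo]
    exact setIntegral_nonneg measurableSet_Ioo fun s hs =>
      div_nonneg (h s ⟨h0.trans hs.1, hs.2⟩) (h0.trans hs.1).le

lemma intervalIntegral_div_le (hg : Integrable g m01) (h : ∀ s ∈ Ioo (0 : ℝ) 1, 0 ≤ g s)
    {a b : ℝ} (ha : 0 < a) (hab : a ≤ b) (hb : b ≤ 1) :
    ∫ s in a..b, g s / s ≤ 1 / a * ∫ s in a..b, g s := by
  rw [← intervalIntegral.integral_const_mul]
  refine intervalIntegral.integral_mono_on_of_le_Ioo hab (intervalIntegrable_div hg ha hab hb)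
    ((intervalIntegrable_m01 hg ha.le hab hb).const_mul _) fun s hs => ?_
  rw [div_eq_mul_one_div, mul_comm]
  exact mul_le_mul_of_nonneg_right (one_div_le_one_div_of_le ha hs.1.le)
    (h s ⟨ha.trans hs.1, hs.2.trans_le hb⟩)

lemma integral_m01 (g : ℝ → ℝ) : ∫ s, g s ∂m01 = ∫ s in (0 : ℝ)..1, g s := by
  rw [intervalIntegral.integral_of_le zero_le_one, integral_Ioc_eq_integral_Ioo, m01]

/-- Since $1/s\le1/t$ on $(t,1)$, both terms merge into one mean. This places $\mathcal S_E$ in weak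
$L_1$. -/
lemma calderon_le (hg : Integrable g m01) (h : ∀ s ∈ Ioo (0 : ℝ) 1, 0 ≤ g s)
    (ht : t ∈ Ioo (0 : ℝ) 1) : calderon g t ≤ 1 / t * ∫ s, g s ∂m01 := by
  rw [integral_m01, ← intervalIntegral.integral_add_adjacent_intervals
    (intervalIntegrable_m01 hg le_rfl ht.1.le ht.2.le)
    (intervalIntegrable_m01 hg ht.1.le ht.2.le le_rfl), mul_add]
  exact add_le_add le_rfl (intervalIntegral_div_le hg h ht.1 ht.2.le le_rfl)

/-- On $(t/2,t)$ one has $1/s\le 2/t$, so that piece joins the mean term. This doubling bound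
compensates for the dilations that arise when rearrangements of sums are estimated. -/
lemma calderon_half (hg : Integrable g m01) (h : ∀ s ∈ Ioo (0 : ℝ) 1, 0 ≤ g s)
    (ht : t ∈ Ioo (0 : ℝ) 1) : calderon g (t / 2) ≤ 2 * calderon g t := by
  have h0 := ht.1
  have h1 := intervalIntegral_div_le hg h (half_pos h0) (half_le_self h0.le) ht.2.le
  have h2 := intervalIntegral.integral_add_adjacent_intervals
    (intervalIntegrable_m01 hg le_rfl (half_pos h0).le (by linarith [ht.2]))
    (intervalIntegrable_m01 hg (half_pos h0).le (half_le_self h0.le) ht.2.le)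
  have h3 := intervalIntegral.integral_add_adjacent_intervals
    (intervalIntegrable_div hg (half_pos h0) (half_le_self h0.le) ht.2.le)
    (intervalIntegrable_div hg h0 ht.2.le le_rfl)
  have h4 : 0 ≤ ∫ s in t..1, g s / s := by
    rw [intervalIntegral.integral_of_le ht.2.le, integral_Ioc_eq_integral_Ioo]
    exact setIntegral_nonneg measurableSet_Ioo fun s hs =>
      div_nonneg (h s ⟨h0.trans hs.1, hs.2⟩) (h0.trans hs.1).le
  simp only [calderon]
  rw [← h3, ← h2]
  have e : 1 / (t / 2) = 2 * (1 / t) := by field_simp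
  rw [e] at h1 ⊢
  linarith

lemma calderon_mul_half_pow (hg : Integrable g m01) (h : ∀ s ∈ Ioo (0 : ℝ) 1, 0 ≤ g s)
    (ht : t ∈ Ioo (0 : ℝ) 1) (k : ℕ) : calderon g (t * (1 / 2) ^ k) ≤ 2 ^ k * calderon g t := by
  induction k with
  | zero => simp
  | succ k ih =>
    have h1 : t * (1 / 2) ^ k ∈ Ioo (0 : ℝ) 1 := by
      have h2 : ((1 : ℝ) / 2) ^ k ≤ 1 := pow_le_one₀ (by norm_num) (by norm_num)
      have h3 : (0 : ℝ) < (1 / 2) ^ k := by positivity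
      exact ⟨mul_pos ht.1 h3, by nlinarith [ht.1, ht.2]⟩
    have e : t * (1 / 2) ^ (k + 1) = t * (1 / 2) ^ k / 2 := by rw [pow_succ]; ring
    rw [e, pow_succ]
    linarith [calderon_half hg h h1]

/-- From $a$ to $b$ the second term loses $\int_a^b g(s)\,ds/s$, at least the $\frac1b\int_a^b g$
that the mean term gains. -/
lemma calderon_antitone (hg : Integrable g m01) (hR : IsRearr g) :
    AntitoneOn (calderon g) (Ioo 0 1) := by
  intro a ha b hb hab
  have h0 := ha.1
  have hb0 := hb.1
  have hI1 := intervalIntegrable_m01 hg le_rfl h0.le ha.2.le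
  have hI2 := intervalIntegrable_m01 hg h0.le hab hb.2.le
  have h2 := intervalIntegral.integral_add_adjacent_intervals hI1 hI2
  have h3 := intervalIntegral.integral_add_adjacent_intervals
    (intervalIntegrable_div hg h0 hab hb.2.le) (intervalIntegrable_div hg hb0 hb.2.le le_rfl)
  have h4 : 1 / b * ∫ s in a..b, g s ≤ ∫ s in a..b, g s / s := by
    rw [← intervalIntegral.integral_const_mul]
    refine intervalIntegral.integral_mono_on_of_le_Ioo hab (hI2.const_mul _)
      (intervalIntegrable_div hg h0 hab hb.2.le) fun s hs => ?_
    have hs0 := h0.trans hs.1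
    rw [div_eq_mul_one_div (g s), mul_comm]
    exact mul_le_mul_of_nonneg_left (one_div_le_one_div_of_le hs0 hs.2.le)
      (hR.nonneg s ⟨hs0, hs.2.trans hb.2⟩)
  have h5 : 0 ≤ ∫ s in (0 : ℝ)..a, g s := by
    rw [intervalIntegral.integral_of_le h0.le, integral_Ioc_eq_integral_Ioo]
    exact setIntegral_nonneg measurableSet_Ioo fun s hs => hR.nonneg s ⟨hs.1, hs.2.trans ha.2⟩
  have h6 : 1 / b * (∫ s in (0 : ℝ)..a, g s) ≤ 1 / a * ∫ s in (0 : ℝ)..a, g s :=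
    mul_le_mul_of_nonneg_right (one_div_le_one_div_of_le h0 hab) h5
  simp only [calderon]
  rw [← h3, ← h2, mul_add]
  linarith

end Calderon

/-! ### The space `S_E` -/

/-- Off a set of measure `t`, partial sums of `∑ |w_k|` are bounded by `∑ μ(t 2^{-k-1}; w_k)`. -/
lemma measure_not_sum_abs_le (w : ℕ → S01) {t : ℝ} (ht : 0 < t) {L : ℝ}
    (hL : ∀ n, ∑ k ∈ Finset.range n, rearr (w k) (t * (1 / 2) ^ (k + 1)) ≤ L) :
    m01 {u | ¬ ∀ n, ∑ k ∈ Finset.range n, |w k u| ≤ L} ≤ ENNReal.ofReal t := by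
  have hpos : ∀ k : ℕ, 0 < t * (1 / 2) ^ (k + 1) := fun k => by positivity
  have hsub : {u | ¬ ∀ n, ∑ k ∈ Finset.range n, |w k u| ≤ L} ⊆
      ⋃ k, {u | rearr (w k) (t * (1 / 2) ^ (k + 1)) < |w k u|} := by
    intro u hu
    by_contra hcon
    simp only [mem_iUnion, mem_ofPred_eq, not_exists, not_lt] at hcon
    exact hu fun n => (Finset.sum_le_sum fun k _ => hcon k).trans (hL n)
  have hsum : HasSum (fun k : ℕ => t * (1 / 2) ^ (k + 1)) t := by
    have := (hasSum_geometric_two).mul_left (t / 2)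
    have e : t / 2 * 2 = t := by ring
    rw [e] at this
    refine this.congr_fun fun k => ?_
    rw [pow_succ]; ring
  calc _ ≤ _ := measure_mono hsub
    _ ≤ ∑' k, m01 {u | rearr (w k) (t * (1 / 2) ^ (k + 1)) < |w k u|} := measure_iUnion_le _
    _ ≤ ∑' k : ℕ, ENNReal.ofReal (t * (1 / 2) ^ (k + 1)) :=
        ENNReal.tsum_le_tsum fun k => (rearr_le_iff _ (hpos k) (rearr_nonneg _ _)).1 le_rfl
    _ = ENNReal.ofReal t := by
        rw [← ENNReal.ofReal_tsum_of_nonneg (fun k => (hpos k).le) hsum.summable, hsum.tsum_eq]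

namespace IsSymmetricQuasiBanach

variable {E : FunSpace}

/-- The weak-$L_1$ requirement is automatic: $t\,\mu(t;x)\le t\,S\mu(y)(t)\le\|y\|_1$. -/
lemma mem_calderonSpace (hL1 : ∀ x ∈ E.carrier, MemL1 x) {x y : S01} (hy : y ∈ E.carrier)
    (h : RearrLeCalderon x y) : x ∈ (calderonSpace E).carrier := by
  refine ⟨⟨∫ u, rearr y u ∂m01, ?_⟩, y, hy, h⟩
  rintro _ ⟨t, ht, rfl⟩
  simp only
  -- `MemWeakL1` includes $t=1$, which `RearrLeCalderon` does not cover; there the rearrangement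
  -- vanishes.
  rcases eq_or_lt_of_le ht.2 with rfl | ht1
  · rw [rearr_eq_zero_of_one_le x le_rfl, mul_zero]
    exact integral_nonneg fun u => rearr_nonneg y u
  · have h1 := (h t ⟨ht.1, ht1⟩).trans (calderon_le (hL1 y hy).integrable_rearr
      (fun s _ => rearr_nonneg y s) ⟨ht.1, ht1⟩)
    rw [one_div, ← div_eq_inv_mul, le_div_iff₀' ht.1] at h1
    exact h1

lemma qnorm_calderonSpace_le (hE : IsSymmetricQuasiBanach E) {x y : S01} (hy : y ∈ E.carrier)
    (h : RearrLeCalderon x y) : (calderonSpace E).qnorm x ≤ E.qnorm y := by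
  refine csInf_le ⟨0, ?_⟩ ⟨y, hy, h, rfl⟩
  rintro _ ⟨z, hz, -, rfl⟩
  exact hE.nonneg z hz

lemma qnorm_calderonSpace_nonneg (hE : IsSymmetricQuasiBanach E) (x : S01) :
    0 ≤ (calderonSpace E).qnorm x := by
  refine Real.sInf_nonneg ?_
  rintro _ ⟨z, hz, -, rfl⟩
  exact hE.nonneg z hz

lemma exists_of_qnorm_lt {x : S01} (hx : x ∈ (calderonSpace E).carrier) {r : ℝ}
    (h : (calderonSpace E).qnorm x < r) :
    ∃ y ∈ E.carrier, RearrLeCalderon x y ∧ E.qnorm y < r := by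
  obtain ⟨-, y, hy, hxy⟩ := hx
  have hne : {r : ℝ | ∃ y ∈ E.carrier, RearrLeCalderon x y ∧ r = E.qnorm y}.Nonempty :=
    ⟨_, y, hy, hxy, rfl⟩
  obtain ⟨_, ⟨z, hz, hxz, rfl⟩, h2⟩ := exists_lt_of_csInf_lt hne h
  exact ⟨z, hz, hxz, h2⟩

lemma rearrLeCalderon_smul {x y : S01} (c : ℝ) (h : RearrLeCalderon x y) :
    RearrLeCalderon (c • x) (c • y) := by
  intro t ht
  rw [rearr_smul c x ht.1, calderon_congr (g := fun s => |c| * rearr y s)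
    (fun s hs => rearr_smul c y hs.1) ht, calderon_const_mul]
  exact mul_le_mul_of_nonneg_left (h t ht) (abs_nonneg c)

/-- $\mu(t;x_1+x_2)\le\mu(t/2;x_1)+\mu(t/2;x_2)$ and `calderon_half` give the bound
$2S(\mu(y_1)+\mu(y_2))(t)$. The sum of the two rearrangements is the rearrangement of an element of
$E$, so the witness is twice that element. -/
lemma exists_rearrLeCalderon_add (hE : IsSymmetricQuasiBanach E)
    (hL1 : ∀ x ∈ E.carrier, MemL1 x) : ∃ K : ℝ, 0 ≤ K ∧ ∀ x₁ x₂ : S01, ∀ y₁ ∈ E.carrier,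
      ∀ y₂ ∈ E.carrier, RearrLeCalderon x₁ y₁ → RearrLeCalderon x₂ y₂ →
      ∃ y ∈ E.carrier, RearrLeCalderon (x₁ + x₂) y ∧ E.qnorm y ≤ K * (E.qnorm y₁ + E.qnorm y₂) := by
  obtain ⟨K, hK1, hK⟩ := hE.exists_const
  refine ⟨2 * K, by linarith, fun x₁ x₂ y₁ hy₁ y₂ hy₂ h₁ h₂ => ?_⟩
  have m₁ := hE.toS_rearr hy₁
  have m₂ := hE.toS_rearr hy₂
  set z := toS (rearr y₁) + toS (rearr y₂) with hz
  have hzE : z ∈ E.carrier := hE.add_mem _ m₁.1 _ m₂.1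
  have hR := (isRearr_rearr y₁).add (isRearr_rearr y₂)
  have hzr : ∀ t ∈ Ioo (0 : ℝ) 1, rearr z t = rearr y₁ t + rearr y₂ t := by
    intro t ht
    rw [← hR.rearr_toS ht]
    refine rearr_eq_of_distr_eq (fun s _ => distr_congr ?_ s) ht.1
    filter_upwards [AEEqFun.coeFn_add (toS (rearr y₁)) (toS (rearr y₂)),
      coe_toS (aemeasurable_rearr y₁), coe_toS (aemeasurable_rearr y₂), coe_toS hR.aemeasurable]
      with u h1 h2 h3 h4
    rw [hz, h1, Pi.add_apply, h2, h3, h4]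
  refine ⟨(2 : ℝ) • z, hE.smul_mem _ _ hzE, fun t ht => ?_, ?_⟩
  · have i₁ := (hL1 y₁ hy₁).integrable_rearr
    have i₂ := (hL1 y₂ hy₂).integrable_rearr
    have ht2 : t / 2 ∈ Ioo (0 : ℝ) 1 := ⟨half_pos ht.1, by linarith [ht.1, ht.2]⟩
    have e : calderon (rearr ((2 : ℝ) • z)) t =
        2 * (calderon (rearr y₁) t + calderon (rearr y₂) t) := by
      rw [← calderon_add i₁ i₂ ht, ← calderon_const_mul]
      refine calderon_congr (fun s hs => ?_) ht
      rw [rearr_smul _ _ hs.1, hzr s hs, abs_two]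
    rw [e]
    have h3 := rearr_add_le x₁ x₂ (half_pos ht.1) (half_pos ht.1)
    rw [add_halves] at h3
    have h4 := calderon_half i₁ (fun s _ => rearr_nonneg y₁ s) ht
    have h5 := calderon_half i₂ (fun s _ => rearr_nonneg y₂ s) ht
    linarith [h₁ _ ht2, h₂ _ ht2]
  · rw [hE.qnorm_smul _ _ hzE, abs_two, mul_assoc]
    refine mul_le_mul_of_nonneg_left ?_ two_pos.le
    have := hK _ m₁.1 _ m₂.1
    rwa [m₁.2, m₂.2] at this

/-- Sequences in `S_E` with rapidly decreasing increments converge. -/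
lemma exists_limit_of_increments (hE : IsSymmetricQuasiBanach E)
    (hL1 : ∀ x ∈ E.carrier, MemL1 x) : ∃ δ : ℕ → ℝ, (∀ k, 0 < δ k) ∧ ∀ v : ℕ → S01,
      (∀ k, v (k + 1) - v k ∈ (calderonSpace E).carrier) →
      (∀ k, (calderonSpace E).qnorm (v (k + 1) - v k) < δ k) →
      ∃ x : S01, ∃ s ∈ E.carrier, ∀ j, RearrLeCalderon (v j - x) (((1 / 2 : ℝ) ^ j) • s) := by
  -- The weights $2^{k+1}$ pay for the loss $Sg(2^{-k-1}t)\le2^{k+1}Sg(t)$.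
  obtain ⟨δ, hδ, hdom⟩ := hE.exists_rearr_dominating (fun k => 2 ^ (k + 1)) (fun k => by positivity)
  refine ⟨δ, hδ, fun v hv hvn => ?_⟩
  choose y hy hwy hyn using fun k => exists_of_qnorm_lt (hv k) (hvn k)
  obtain ⟨s, hs, hsum⟩ := hdom y hy (fun k => (hyn k).le)
  have is := (hL1 s hs).integrable_rearr
  have iy := fun k => (hL1 _ (hy k)).integrable_rearr
  have bound : ∀ j, ∀ t ∈ Ioo (0 : ℝ) 1, ∀ n, ∑ k ∈ Finset.range n,
      rearr (v (j + k + 1) - v (j + k)) (t * (1 / 2) ^ (k + 1)) ≤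
        calderon (rearr (((1 / 2 : ℝ) ^ j) • s)) t := by
    intro j t ht n
    have h1 : ∀ k, rearr (v (j + k + 1) - v (j + k)) (t * (1 / 2) ^ (k + 1)) ≤
        2 ^ (k + 1) * calderon (rearr (y (j + k))) t := by
      intro k
      have h2 : ((1 : ℝ) / 2) ^ (k + 1) ≤ 1 := pow_le_one₀ (by norm_num) (by norm_num)
      have h3 : (0 : ℝ) < (1 / 2) ^ (k + 1) := by positivity
      exact (hwy (j + k) _ ⟨mul_pos ht.1 h3, by nlinarith [ht.1, ht.2]⟩).trans
        (calderon_mul_half_pow (iy _) (fun s _ => rearr_nonneg _ s) ht _)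
    have h2 : ∀ n, Integrable (fun s => ∑ k ∈ Finset.range n,
        2 ^ (k + 1) * rearr (y (j + k)) s) m01 := fun n =>
      integrable_finsetSum _ fun k _ => (iy _).const_mul _
    have h3 : ∀ n, ∑ k ∈ Finset.range n, 2 ^ (k + 1) * calderon (rearr (y (j + k))) t =
        calderon (fun s => ∑ k ∈ Finset.range n, 2 ^ (k + 1) * rearr (y (j + k)) s) t := by
      intro n
      induction n with
      | zero => simp [calderon]
      | succ n ih =>
        simp only [Finset.sum_range_succ]
        rw [calderon_add (h2 n) ((iy _).const_mul _) ht, ih, calderon_const_mul]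
    refine (Finset.sum_le_sum fun k _ => h1 k).trans ((h3 n).le.trans ?_)
    rw [calderon_congr (f := rearr (((1 / 2 : ℝ) ^ j) • s))
      (g := fun r => |(1 / 2 : ℝ) ^ j| * rearr s r) (fun r hr => rearr_smul _ _ hr.1) ht]
    refine calderon_mono (h2 n) (is.const_mul _) (fun r hr => ?_) ht
    -- The weight required at index $j+k$ is only $2^{k+1}$ while the available one is $2^{j+k+1}$;
    -- the surplus is the factor $2^{-j}$ in the conclusion.
    rw [abs_of_pos (by positivity), one_div, inv_pow, ← div_eq_inv_mul, le_div_iff₀' (by positivity),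
      Finset.mul_sum]
    refine le_trans ?_ (hsum (j + n) r hr)
    rw [Finset.sum_range_add]
    refine le_add_of_nonneg_of_le (Finset.sum_nonneg fun k _ =>
      mul_nonneg (by positivity) (rearr_nonneg _ _)) (Finset.sum_le_sum fun k _ => le_of_eq ?_)
    rw [← mul_assoc, ← pow_add, add_assoc]
  have hbad := fun j t (ht : t ∈ Ioo (0 : ℝ) 1) =>
    measure_not_sum_abs_le (fun k => v (j + k + 1) - v (j + k)) ht.1 (bound j t ht)
  have hcoe : ∀ᵐ u ∂m01, ∀ k, (v (k + 1) - v k : S01) u = v (k + 1) u - v k u :=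
    ae_all_iff.2 fun k => AEEqFun.coeFn_sub _ _
  -- With $j=0$ and $t$ arbitrarily small, the increments are absolutely summable outside a set of
  -- measure at most $t$.
  have hconv : ∀ᵐ u ∂m01, ∃ l, Tendsto (fun k => v k u) atTop (𝓝 l) := by
    have h0 : m01 {u | ¬ ∃ L, ∀ n, ∑ k ∈ Finset.range n, |(v (0 + k + 1) - v (0 + k) : S01) u| ≤ L}
        = 0 := by
      refine le_antisymm (ENNReal.le_of_forall_pos_le_add fun ε hε _ => ?_) zero_le
      have h1 : (0 : ℝ) < min ε (1 / 2) := lt_min (by exact_mod_cast hε) (by norm_num)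
      have h2 := hbad 0 _ ⟨h1, lt_of_le_of_lt (min_le_right _ _) (by norm_num)⟩
      rw [zero_add]
      refine ((measure_mono fun u hu => ?_).trans h2).trans
        ((ENNReal.ofReal_le_ofReal (min_le_left _ _)).trans (by simp))
      exact fun h => hu ⟨_, h⟩
    have h1 : ∀ᵐ u ∂m01, ∃ L, ∀ n, ∑ k ∈ Finset.range n,
        |(v (0 + k + 1) - v (0 + k) : S01) u| ≤ L := ae_iff.2 h0
    filter_upwards [h1, hcoe] with u ⟨L, hL⟩ hc
    simp only [zero_add, hc] at hL
    have hsm : Summable fun k => v (k + 1) u - v k u :=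
      (summable_of_sum_range_le (fun _ => abs_nonneg _) hL).of_abs
    have h2 := hsm.hasSum.tendsto_sum_nat.add_const (v 0 u)
    simp only [Finset.sum_range_sub (fun k => v k u), sub_add_cancel] at h2
    exact ⟨_, h2⟩
  obtain ⟨f, hf, hlim⟩ := measurable_limit_of_tendsto_metrizable_ae
    (fun k => aemeasurable_coe (v k)) hconv
  refine ⟨toS f, s, hs, fun j t ht => ?_⟩
  have hnn : 0 ≤ calderon (rearr (((1 / 2 : ℝ) ^ j) • s)) t :=
    calderon_nonneg (fun r _ => rearr_nonneg _ r) ht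
  rw [rearr_le_iff _ ht.1 hnn]
  refine le_trans (measure_mono_ae ?_) (hbad j t ht)
  filter_upwards [hlim, hcoe, coe_toS hf.aemeasurable, AEEqFun.coeFn_sub (v j) (toS f)]
    with u hu hc h1 h2 h3 hall
  have h3' : _ < |(v j - toS f : S01) u| := h3
  rw [h2, Pi.sub_apply, h1] at h3'
  have h4 : Tendsto (fun n => |v j u - v (n + j) u|) atTop (𝓝 |v j u - f u|) :=
    (tendsto_const_nhds.sub ((tendsto_add_atTop_iff_nat j).2 hu)).abs
  refine h3'.not_ge (le_of_tendsto' h4 fun n => ?_)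
  refine le_trans ?_ (hall n)
  -- Telescoping: $|v_j-v_{j+n}|$ is at most the sum of the increments from $j$ on, so the limit
  -- inherits the bound off the exceptional set.
  have e : v j u - v (n + j) u = -∑ k ∈ Finset.range n, (v (j + k + 1) u - v (j + k) u) := by
    have h5 := Finset.sum_range_sub (fun k => v (j + k) u) n
    simp only [← add_assoc, add_zero] at h5
    rw [h5, add_comm n j]
    ring
  rw [e, abs_neg]
  simp only [hc]
  exact Finset.abs_sum_le_sum_abs _ _

/-- `S_E` is a symmetric quasi-Banach function space. -/
theorem isSymmetricQuasiBanach_calderonSpace (hE : IsSymmetricQuasiBanach E) (hL1 : ∀ x ∈ E.carrier, MemL1 x) :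
    IsSymmetricQuasiBanach (calderonSpace E) := by
  have hmem := fun {x y : S01} => mem_calderonSpace hL1 (x := x) (y := y)
  have hle := fun {x y : S01} => hE.qnorm_calderonSpace_le (x := x) (y := y)
  obtain ⟨K, hK0, hK⟩ := hE.exists_rearrLeCalderon_add hL1
  have hadd : ∀ x ∈ (calderonSpace E).carrier, ∀ y ∈ (calderonSpace E).carrier,
      x + y ∈ (calderonSpace E).carrier := by
    rintro x₁ ⟨-, y₁, hy₁, h₁⟩ x₂ ⟨-, y₂, hy₂, h₂⟩
    obtain ⟨y, hy, h, -⟩ := hK x₁ x₂ y₁ hy₁ y₂ hy₂ h₁ h₂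
    exact hmem hy h
  have hsmul : ∀ (c : ℝ), ∀ x ∈ (calderonSpace E).carrier,
      c • x ∈ (calderonSpace E).carrier := by
    rintro c x ⟨-, y, hy, h⟩
    exact hmem (hE.smul_mem c y hy) (rearrLeCalderon_smul c h)
  have hsub : ∀ x ∈ (calderonSpace E).carrier, ∀ y ∈ (calderonSpace E).carrier,
      x - y ∈ (calderonSpace E).carrier := by
    intro x hx y hy
    have := hadd x hx _ (hsmul (-1) y hy)
    rwa [neg_one_smul, ← sub_eq_add_neg] at this
  have hmono : ∀ x ∈ (calderonSpace E).carrier, ∀ y : S01,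
      (∀ t ∈ Ioo (0 : ℝ) 1, rearr y t ≤ rearr x t) → y ∈ (calderonSpace E).carrier ∧
        (calderonSpace E).qnorm y ≤ (calderonSpace E).qnorm x := by
    intro x hx y h
    have htr : ∀ z, RearrLeCalderon x z → RearrLeCalderon y z := fun z hz t ht =>
      (h t ht).trans (hz t ht)
    refine ⟨?_, le_of_forall_gt fun r hr => ?_⟩
    · obtain ⟨-, z, hz, hxz⟩ := hx
      exact hmem hz (htr z hxz)
    · obtain ⟨z, hz, hxz, hzr⟩ := exists_of_qnorm_lt hx hr
      exact (hle hz (htr z hxz)).trans_lt hzr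
  have hsmul_le : ∀ (c : ℝ), ∀ x ∈ (calderonSpace E).carrier,
      (calderonSpace E).qnorm (c • x) ≤ |c| * (calderonSpace E).qnorm x := by
    intro c x hx
    refine le_of_forall_pos_le_add fun ε hε => ?_
    obtain ⟨z, hz, hxz, hzr⟩ := exists_of_qnorm_lt hx
      (lt_add_of_pos_right ((calderonSpace E).qnorm x) (div_pos hε (show 0 < |c| + 1 by
        positivity)))
    refine (hle (hE.smul_mem c z hz) (rearrLeCalderon_smul c hxz)).trans ?_
    rw [hE.qnorm_smul c z hz]
    refine (mul_le_mul_of_nonneg_left hzr.le (abs_nonneg c)).trans ?_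
    rw [mul_add]
    have : |c| * (ε / (|c| + 1)) ≤ ε := by
      rw [mul_div_assoc', div_le_iff₀ (by positivity)]
      nlinarith [abs_nonneg c]
    linarith
  have htri : ∀ x ∈ (calderonSpace E).carrier, ∀ y ∈ (calderonSpace E).carrier,
      (calderonSpace E).qnorm (x + y) ≤
        K * ((calderonSpace E).qnorm x + (calderonSpace E).qnorm y) := by
    intro x₁ hx₁ x₂ hx₂
    refine le_of_forall_pos_le_add fun ε hε => ?_
    -- $K+1$ in place of $K$, since only $K\ge0$ is known.
    have hη : 0 < ε / (2 * (K + 1)) := by positivity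
    obtain ⟨y₁, hy₁, h₁, n₁⟩ := exists_of_qnorm_lt hx₁ (lt_add_of_pos_right _ hη)
    obtain ⟨y₂, hy₂, h₂, n₂⟩ := exists_of_qnorm_lt hx₂ (lt_add_of_pos_right _ hη)
    obtain ⟨y, hy, h, n⟩ := hK x₁ x₂ y₁ hy₁ y₂ hy₂ h₁ h₂
    refine (hle hy h).trans (n.trans ((mul_le_mul_of_nonneg_left (add_le_add n₁.le n₂.le)
      hK0).trans ?_))
    have : K * (ε / (2 * (K + 1)) + ε / (2 * (K + 1))) ≤ ε := by
      rw [← add_div, mul_div_assoc', div_le_iff₀ (by positivity)]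
      nlinarith
    linarith
  refine ⟨?_, hadd, hsmul, fun x _ => hE.qnorm_calderonSpace_nonneg x, ?_, ?_, ⟨K, htri⟩, ?_, ?_, ?_⟩
  · refine hmem hE.zero_mem fun t ht => ?_
    rw [rearr_zero ht.1]
    exact calderon_nonneg (fun s _ => rearr_nonneg _ s) ht
  · intro x hx h0
    -- Quasi-norm zero provides majorants $y$ of arbitrarily small quasi-norm, hence of small $L_1$
    -- norm, and $\mu(t;x)\le S\mu(y)(t)\le\|y\|_1/t$.
    obtain ⟨C, hC, hCE⟩ := hE.exists_integral_le hL1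
    refine eq_zero_of_rearr_eq_zero fun t ht => le_antisymm ?_ (rearr_nonneg _ _)
    refine le_of_forall_pos_le_add fun ε hε => ?_
    have hpos : 0 < ε * t / C := div_pos (mul_pos hε ht.1) hC
    obtain ⟨y, hy, hxy, hn⟩ := exists_of_qnorm_lt hx (h0.trans_lt hpos)
    refine (hxy t ht).trans ((calderon_le (hL1 y hy).integrable_rearr
      (fun s _ => rearr_nonneg y s) ht).trans ?_)
    rw [integral_rearr (hL1 y hy), zero_add, one_div, ← div_eq_inv_mul, div_le_iff₀ ht.1]
    refine (hCE y hy).trans ?_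
    rw [lt_div_iff₀' hC] at hn
    exact hn.le
  · intro c x hx
    refine le_antisymm (hsmul_le c x hx) ?_
    rcases eq_or_ne c 0 with rfl | hc
    · simpa using hE.qnorm_calderonSpace_nonneg _
    · have h1 := hsmul_le c⁻¹ _ (hsmul c x hx)
      rw [inv_smul_smul₀ hc, abs_inv, ← div_eq_inv_mul, le_div_iff₀' (abs_pos.2 hc)] at h1
      exact h1
  · intro u hu hcau
    obtain ⟨δ, hδ, hlim⟩ := hE.exists_limit_of_increments hL1
    -- A subsequence with increments below $\delta_k$ converges in $\mathcal S_E$; the Cauchy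
    -- property then carries the whole sequence along.
    obtain ⟨φ, hφ, hφu⟩ := extraction_forall_of_eventually' (P := fun k N => ∀ i ≥ N, ∀ j ≥ N,
      (calderonSpace E).qnorm (u i - u j) < δ k) (fun k => by
        obtain ⟨N, hN⟩ := hcau (δ k) (hδ k)
        exact ⟨N, fun n hn i hi j hj => hN i (hn.trans hi) j (hn.trans hj)⟩)
    obtain ⟨x, s, hs, hxs⟩ := hlim (fun k => u (φ k)) (fun k => hsub _ (hu _) _ (hu _))
      (fun k => hφu k _ (hφ (Nat.lt_succ_self k)).le _ le_rfl)
    have hdiff : ∀ j, u (φ j) - x ∈ (calderonSpace E).carrier := fun j =>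
      hmem (hE.smul_mem _ _ hs) (hxs j)
    have hxm : x ∈ (calderonSpace E).carrier := by
      have := hsub _ (hu (φ 0)) _ (hdiff 0)
      rwa [sub_sub_cancel] at this
    refine ⟨x, hxm, ?_⟩
    have hsmall : Tendsto (fun j : ℕ => (1 / 2 : ℝ) ^ j * E.qnorm s) atTop (𝓝 0) := by
      have := (tendsto_pow_atTop_nhds_zero_of_lt_one (r := (1 / 2 : ℝ)) (by norm_num)
        (by norm_num)).mul_const (E.qnorm s)
      simpa using this
    rw [Metric.tendsto_atTop]
    intro ε hε
    have hη : 0 < ε / (2 * (K + 1)) := by positivity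
    obtain ⟨N, hN⟩ := hcau _ hη
    obtain ⟨j, hj, hjN⟩ := ((hsmall.eventually (gt_mem_nhds hη)).and (eventually_ge_atTop N)).exists
    refine ⟨N, fun n hn => ?_⟩
    rw [Real.dist_eq, sub_zero, abs_of_nonneg (hE.qnorm_calderonSpace_nonneg _)]
    have h1 := htri _ (hsub _ (hu n) _ (hu (φ j))) _ (hdiff j)
    rw [sub_add_sub_cancel] at h1
    have h2 := hN n hn (φ j) (hjN.trans (hφ.id_le j))
    have h3 := hle (hE.smul_mem _ _ hs) (hxs j)
    rw [hE.qnorm_smul _ _ hs, abs_of_pos (by positivity)] at h3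
    have h4 : K * (ε / (2 * (K + 1)) + ε / (2 * (K + 1))) < ε := by
      rw [← add_div, mul_div_assoc', div_lt_iff₀ (by positivity)]
      nlinarith
    exact (h1.trans (mul_le_mul_of_nonneg_left (add_le_add h2.le (h3.trans hj.le)) hK0)).trans_lt h4
  · intro x hx y hxy
    exact hmono x hx y fun t ht => rearr_mono hxy ht.1
  · intro x hx y hxy
    have h1 := hmono x hx y fun t ht => (hxy t ht).le
    exact ⟨h1.1, le_antisymm h1.2 (hmono y h1.1 x fun t ht => (hxy t ht).ge).2⟩

end IsSymmetricQuasiBanach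

/-! ### Martingale transforms -/

/-- Burkholder's function for the weak-type `(1,1)` inequality. -/
def burk (x y : ℝ) : ℝ := if |x| + |y| ≤ 1 then y ^ 2 - x ^ 2 else 1 - 2 * |x|

/-- The slope of `burk` in the first variable. -/
def burkX (x y : ℝ) : ℝ := if |x| + |y| ≤ 1 then -2 * x else if 0 < x then -2 else
  if x < 0 then 2 else 0

/-- The slope of `burk` in the second variable. -/
def burkY (x y : ℝ) : ℝ := if |x| + |y| ≤ 1 then 2 * y else 0

/-- Inside the diamond $|x|+|y|\le1$ the difference is $(1-|x|)^2-y^2\ge0$. -/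
lemma burk_le_one_sub (x y : ℝ) : burk x y ≤ 1 - 2 * |x| := by
  unfold burk
  split_ifs with h
  · rw [← sq_abs x, ← sq_abs y]
    nlinarith [abs_nonneg x, abs_nonneg y]
  · exact le_rfl

lemma burk_nonpos {x y : ℝ} (h : |y| ≤ |x|) : burk x y ≤ 0 := by
  unfold burk
  split_ifs with h1
  · rw [← sq_abs x, ← sq_abs y]
    nlinarith [abs_nonneg x, abs_nonneg y]
  · linarith

lemma neg_two_mul_abs_le_burk (x y : ℝ) : -2 * |x| ≤ burk x y := by
  unfold burk
  split_ifs with h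
  · rw [← sq_abs x, ← sq_abs y]
    nlinarith [abs_nonneg x, abs_nonneg y]
  · linarith

lemma one_sub_le_burk {x y : ℝ} (hy : 1 ≤ |y|) : 1 - 2 * |x| ≤ burk x y := by
  unfold burk
  split_ifs with h
  · rw [← sq_abs x, ← sq_abs y]
    nlinarith [abs_nonneg x, abs_nonneg y]
  · exact le_rfl

lemma abs_burk_le (x y : ℝ) : |burk x y| ≤ 1 + 2 * |x| := by
  rw [abs_le]
  constructor
  · linarith [neg_two_mul_abs_le_burk x y]
  · linarith [burk_le_one_sub x y, abs_nonneg x]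

lemma abs_burkX_le (x y : ℝ) : |burkX x y| ≤ 2 := by
  unfold burkX
  split_ifs with h
  · rw [abs_mul]; norm_num; linarith [abs_nonneg y]
  all_goals norm_num

lemma abs_burkY_le (x y : ℝ) : |burkY x y| ≤ 2 := by
  unfold burkY
  split_ifs with h
  · rw [abs_mul]; norm_num; linarith [abs_nonneg x]
  · norm_num

/-- Concavity of `burk` along directions with $|k|\le|h|$. Inside the diamond the quadratic exceeds
its tangent by $k^2-h^2\le0$. From a point outside, it suffices that `burk` lies below the concave
function $1-2|x|$ everywhere. -/
lemma burk_add_le {x y h k : ℝ} (hk : |k| ≤ |h|) :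
    burk (x + h) (y + k) ≤ burk x y + burkX x y * h + burkY x y * k := by
  by_cases h1 : |x| + |y| ≤ 1
  · have e : burk x y + burkX x y * h + burkY x y * k =
        (y + k) ^ 2 - (x + h) ^ 2 + (h ^ 2 - k ^ 2) := by
      simp only [burk, burkX, burkY, if_pos h1]; ring
    rw [e]
    have hk2 : k ^ 2 ≤ h ^ 2 := sq_le_sq.2 hk
    by_cases h2 : |x + h| + |y + k| ≤ 1
    · simp only [burk, if_pos h2]; linarith
    · simp only [burk, if_neg h2]
      rw [not_le] at h2
      rcases le_or_gt |x + h| 1 with h3 | h3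
      · rw [← sq_abs (x + h), ← sq_abs (y + k)]
        nlinarith [abs_nonneg (x + h), abs_nonneg (y + k)]
      -- Here $|x+h|-1\le|h|-|y|$ because $|x|+|y|\le1$, while $y^2+2yk+h^2\ge(|h|-|y|)^2$.
      · have h4 := abs_add_le x h
        have h5 : (|x + h| - 1) ^ 2 ≤ (|h| - |y|) ^ 2 :=
          pow_le_pow_left₀ (by linarith) (by linarith) 2
        have h6 : -(y * k) ≤ |y| * |h| := by
          calc -(y * k) ≤ |y * k| := neg_le_abs _
            _ = |y| * |k| := abs_mul _ _
            _ ≤ |y| * |h| := mul_le_mul_of_nonneg_left hk (abs_nonneg y)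
        nlinarith [sq_abs (x + h), sq_abs h, sq_abs y]
  · refine (burk_le_one_sub _ _).trans ?_
    simp only [burk, burkX, burkY, if_neg h1]
    rcases lt_trichotomy x 0 with h2 | h2 | h2
    · rw [if_neg h2.not_gt, if_pos h2, abs_of_neg h2]
      linarith [neg_le_abs (x + h)]
    · subst h2
      simp
    · rw [if_pos h2, abs_of_pos h2]
      linarith [le_abs_self (x + h)]

lemma measurable_burk : Measurable fun p : ℝ × ℝ => burk p.1 p.2 :=
  Measurable.ite (measurableSet_le (by fun_prop) (by fun_prop)) (by fun_prop) (by fun_prop)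

lemma measurable_burkX : Measurable fun p : ℝ × ℝ => burkX p.1 p.2 :=
  Measurable.ite (measurableSet_le (by fun_prop) (by fun_prop)) (by fun_prop)
    (Measurable.ite (measurableSet_lt (by fun_prop) (by fun_prop)) (by fun_prop)
    (Measurable.ite (measurableSet_lt (by fun_prop) (by fun_prop)) (by fun_prop) (by fun_prop)))

lemma measurable_burkY : Measurable fun p : ℝ × ℝ => burkY p.1 p.2 :=
  Measurable.ite (measurableSet_le (by fun_prop) (by fun_prop)) (by fun_prop) (by fun_prop)

/-! ### Weak-type and $L_2$ inequalities for martingale transforms. -/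

section Transform

variable {Ω : Type*} {m0 : MeasurableSpace Ω} {μ : Measure Ω} {F : Filtration ℕ m0}
  {f : ℕ → Ω → ℝ} {ε : ℕ → ℝ}

/-- The transform of the sequence `f` by the coefficients `ε`. -/
def mtrans (ε : ℕ → ℝ) (f : ℕ → Ω → ℝ) : ℕ → Ω → ℝ
  | 0 => fun ω => ε 0 * f 0 ω
  | n + 1 => fun ω => mtrans ε f n ω + ε (n + 1) * (f (n + 1) ω - f n ω)

lemma stronglyMeasurable_mtrans (hf : StronglyAdapted F f) (n : ℕ) :
    StronglyMeasurable[F n] (mtrans ε f n) := by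
  induction n with
  | zero => exact (hf 0).const_mul _
  | succ n ih =>
    have h1 := (hf n).mono (F.mono n.le_succ)
    exact (ih.mono (F.mono n.le_succ)).add (((hf (n + 1)).sub h1).const_mul _)

/-- A martingale increment is orthogonal to bounded functions of the past; this removes the
first-order terms in both inequalities below. -/
lemma integral_mul_increment [IsFiniteMeasure μ] (hf : Martingale f F μ) {n : ℕ} {c : Ω → ℝ}
    {C : ℝ} (hc : StronglyMeasurable[F n] c) (hC : ∀ᵐ ω ∂μ, |c ω| ≤ C) :
    Integrable (fun ω => c ω * (f (n + 1) ω - f n ω)) μ ∧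
      ∫ ω, c ω * (f (n + 1) ω - f n ω) ∂μ = 0 := by
  have hd : Integrable (f (n + 1) - f n) μ := (hf.integrable _).sub (hf.integrable _)
  have hi : Integrable (fun ω => c ω * (f (n + 1) - f n) ω) μ :=
    hd.bdd_mul (hc.mono (F.le n)).aestronglyMeasurable hC
  refine ⟨hi, ?_⟩
  have h1 : μ[c * (f (n + 1) - f n) | F n] =ᵐ[μ] 0 := by
    have h2 := condExp_mul_of_stronglyMeasurable_left hc hi hd
    have h3 := condExp_sub (hf.integrable (n + 1)) (hf.integrable n) (F n)
    filter_upwards [h2, h3, hf.2 n (n + 1) n.le_succ, hf.2 n n le_rfl] with ω h2 h3 h4 h5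
    rw [h2, Pi.mul_apply, h3, Pi.sub_apply, h4, h5]
    simp
  have h2 := integral_condExp (f := c * (f (n + 1) - f n)) (μ := μ) (F.le n)
  rw [integral_congr_ae h1] at h2
  simpa using h2.symm

/-- Burkholder's weak-type inequality for martingale transforms. -/
lemma measure_one_le_mtrans [IsFiniteMeasure μ] (hf : Martingale f F μ) (hε : ∀ n, |ε n| ≤ 1)
    (n : ℕ) : μ.real {ω | 1 ≤ |mtrans ε f n ω|} ≤ 2 * ∫ ω, |f n ω| ∂μ := by
  have hmeas : ∀ n, StronglyMeasurable[F n] (mtrans ε f n) := fun n =>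
    stronglyMeasurable_mtrans hf.1 n
  have hpair : ∀ n, Measurable[F n] fun ω => (f n ω, mtrans ε f n ω) := fun n =>
    (hf.1 n).measurable.prodMk (hmeas n).measurable
  have hint : ∀ n, Integrable (fun ω => burk (f n ω) (mtrans ε f n ω)) μ := fun n => by
    refine Integrable.mono' (g := fun ω => 1 + 2 * |f n ω|)
      ((integrable_const _).add ((hf.integrable n).abs.const_mul 2)) ?_
      (Eventually.of_forall fun ω => abs_burk_le _ _)
    exact ((measurable_burk.comp (hpair n)).mono (F.le n) le_rfl).aestronglyMeasurable
  -- The integral of `burk` along the pair (martingale, transform) starts nonpositive and cannot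
  -- increase: `burk_add_le` bounds each step by a term of mean zero.
  have hneg : ∀ n, ∫ ω, burk (f n ω) (mtrans ε f n ω) ∂μ ≤ 0 := by
    intro n
    induction n with
    | zero =>
      refine integral_nonpos fun ω => burk_nonpos ?_
      simp only [mtrans, abs_mul]
      exact mul_le_of_le_one_left (abs_nonneg _) (hε 0)
    | succ n ih =>
      have hcm : StronglyMeasurable[F n] fun ω => burkX (f n ω) (mtrans ε f n ω) +
          ε (n + 1) * burkY (f n ω) (mtrans ε f n ω) :=
        ((measurable_burkX.comp (hpair n)).add
          ((measurable_burkY.comp (hpair n)).const_mul _)).stronglyMeasurable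
      have hcb : ∀ᵐ ω ∂μ, |burkX (f n ω) (mtrans ε f n ω) +
          ε (n + 1) * burkY (f n ω) (mtrans ε f n ω)| ≤ 4 := by
        refine Eventually.of_forall fun ω => (abs_add_le _ _).trans ?_
        rw [abs_mul]
        have h1 := abs_burkX_le (f n ω) (mtrans ε f n ω)
        have h2 := abs_burkY_le (f n ω) (mtrans ε f n ω)
        nlinarith [hε (n + 1), abs_nonneg (ε (n + 1)),
          abs_nonneg (burkY (f n ω) (mtrans ε f n ω))]
      obtain ⟨h1, h2⟩ := integral_mul_increment hf hcm hcb
      have h3 := integral_add (hint n) h1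
      rw [h2, add_zero] at h3
      refine le_trans ?_ (h3.le.trans ih)
      refine integral_mono (hint (n + 1)) ((hint n).add h1) fun ω => ?_
      have h4 := burk_add_le (x := f n ω) (y := mtrans ε f n ω) (h := f (n + 1) ω - f n ω)
        (k := ε (n + 1) * (f (n + 1) ω - f n ω)) (by
          rw [abs_mul]; exact mul_le_of_le_one_left (abs_nonneg _) (hε _))
      rw [add_sub_cancel] at h4
      refine h4.trans (le_of_eq ?_)
      ring
  have hset : MeasurableSet {ω | 1 ≤ |mtrans ε f n ω|} :=
    measurableSet_le measurable_const ((hmeas n).mono (F.le n)).measurable.abs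
  have hI : Integrable ({ω | 1 ≤ |mtrans ε f n ω|}.indicator (1 : Ω → ℝ)) μ :=
    (integrable_const 1).indicator hset
  rw [← integral_indicator_one hset, ← integral_const_mul, ← sub_nonpos,
    ← integral_sub hI ((hf.integrable n).abs.const_mul 2)]
  -- Pointwise, $1_{\{|g|\ge1\}}-2|f|\le$ `burk` $(f,g)$.
  refine (integral_mono (hI.sub ((hf.integrable n).abs.const_mul 2)) (hint n) fun ω => ?_).trans (hneg n)
  by_cases h : 1 ≤ |mtrans ε f n ω|
  · simp only [Pi.sub_apply, indicator_of_mem (show ω ∈ {ω | 1 ≤ |mtrans ε f n ω|} from h),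
      Pi.one_apply]
    exact one_sub_le_burk h
  · simp only [Pi.sub_apply, indicator_of_notMem (show ω ∉ {ω | 1 ≤ |mtrans ε f n ω|} from h)]
    have := neg_two_mul_abs_le_burk (f n ω) (mtrans ε f n ω)
    linarith

lemma mtrans_const_mul (c : ℝ) (n : ℕ) (ω : Ω) :
    mtrans ε (fun n ω => c * f n ω) n ω = c * mtrans ε f n ω := by
  induction n with
  | zero => simp only [mtrans]; ring
  | succ n ih => simp only [mtrans, ih]; ring

lemma measure_le_mtrans [IsFiniteMeasure μ] (hf : Martingale f F μ) (hε : ∀ n, |ε n| ≤ 1)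
    (n : ℕ) {l : ℝ} (hl : 0 < l) :
    μ {ω | l ≤ |mtrans ε f n ω|} ≤ ENNReal.ofReal (2 / l * ∫ ω, |f n ω| ∂μ) := by
  have h := measure_one_le_mtrans (hf.smul (1 / l)) hε n
  have e : (1 / l) • f = fun n ω => 1 / l * f n ω := rfl
  rw [e] at h
  have hs : {ω | 1 ≤ |mtrans ε (fun n ω => 1 / l * f n ω) n ω|} = {ω | l ≤ |mtrans ε f n ω|} := by
    ext ω
    simp only [mem_ofPred_eq, mtrans_const_mul, abs_mul, abs_of_pos (one_div_pos.2 hl)]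
    rw [one_div, ← div_eq_inv_mul, one_le_div hl]
  simp only [hs, abs_mul, abs_of_pos (one_div_pos.2 hl), integral_const_mul] at h
  rw [← ofReal_measureReal]
  refine ENNReal.ofReal_le_ofReal (h.trans (le_of_eq ?_))
  ring

/-- A crude bound; its growth in $n$ is harmless because it only serves integrability. -/
lemma mtrans_bounded {C : ℝ} (hε : ∀ n, |ε n| ≤ 1) {ω : Ω} (hC : ∀ n, |f n ω| ≤ C) (n : ℕ) :
    |mtrans ε f n ω| ≤ (2 * n + 1) * C := by
  induction n with
  | zero =>
    simp only [mtrans, abs_mul]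
    have := mul_le_of_le_one_left (abs_nonneg (f 0 ω)) (hε 0)
    norm_num
    linarith [hC 0]
  | succ n ih =>
    simp only [mtrans]
    refine (abs_add_le _ _).trans ?_
    rw [abs_mul]
    have h1 := mul_le_of_le_one_left (abs_nonneg (f (n + 1) ω - f n ω)) (hε (n + 1))
    have h2 := abs_sub (f (n + 1) ω) (f n ω)
    push_cast
    linarith [hC n, hC (n + 1)]

/-- The `L_2` inequality for transforms of bounded martingales. -/
lemma integral_sq_mtrans_le [IsFiniteMeasure μ] (hf : Martingale f F μ) (hε : ∀ n, |ε n| ≤ 1)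
    {C : ℝ} (hC : ∀ᵐ ω ∂μ, ∀ n, |f n ω| ≤ C) (n : ℕ) :
    Integrable (fun ω => mtrans ε f n ω ^ 2) μ ∧
      ∫ ω, mtrans ε f n ω ^ 2 ∂μ ≤ ∫ ω, f n ω ^ 2 ∂μ := by
  have hmeas : ∀ n, StronglyMeasurable[F n] (mtrans ε f n) := fun n =>
    stronglyMeasurable_mtrans hf.1 n
  have hC0 : ∀ᵐ ω ∂μ, 0 ≤ C := hC.mono fun ω h => (abs_nonneg _).trans (h 0)
  have hg : ∀ n, ∀ᵐ ω ∂μ, |mtrans ε f n ω| ≤ (2 * n + 1) * C := fun n =>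
    hC.mono fun ω h => mtrans_bounded hε h n
  have ig : ∀ n, Integrable (fun ω => mtrans ε f n ω ^ 2) μ := fun n => by
    refine Integrable.of_bound (((hmeas n).mono (F.le n)).pow 2).aestronglyMeasurable
      (((2 * n + 1) * C) ^ 2) ?_
    filter_upwards [hg n] with ω h
    rw [norm_pow, Real.norm_eq_abs]
    exact pow_le_pow_left₀ (abs_nonneg _) h 2
  have jf : ∀ n, Integrable (fun ω => f n ω ^ 2) μ := fun n => by
    refine Integrable.of_bound (((hf.1 n).mono (F.le n)).pow 2).aestronglyMeasurable (C ^ 2) ?_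
    filter_upwards [hC] with ω h
    rw [norm_pow, Real.norm_eq_abs]
    exact pow_le_pow_left₀ (abs_nonneg _) (h n) 2
  refine ⟨ig n, ?_⟩
  rw [← sub_nonpos, ← integral_sub (ig n) (jf n)]
  induction n with
  | zero =>
    refine integral_nonpos fun ω => ?_
    have := sq_le_sq.2 (show |mtrans ε f 0 ω| ≤ |f 0 ω| by
      simp only [mtrans, abs_mul]
      exact mul_le_of_le_one_left (abs_nonneg _) (hε 0))
    simp only [Pi.zero_apply]
    linarith
  | succ n ih =>
    -- With $g$ the transform, the increment of $g_n^2-f_n^2$ is $(2\varepsilon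
    -- g_n-2f_n)\,df+(\varepsilon^2-1)\,df^2$: the first term has mean zero, the second is
    -- nonpositive.
    have hcm : StronglyMeasurable[F n] fun ω => 2 * ε (n + 1) * mtrans ε f n ω - 2 * f n ω :=
      ((hmeas n).const_mul _).sub ((hf.1 n).const_mul _)
    have hcb : ∀ᵐ ω ∂μ, |2 * ε (n + 1) * mtrans ε f n ω - 2 * f n ω| ≤
        2 * ((2 * n + 1) * C) + 2 * C := by
      filter_upwards [hg n, hC] with ω h1 h2
      refine (abs_sub _ _).trans (add_le_add ?_ ?_)
      · rw [abs_mul, abs_mul, abs_two, mul_assoc]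
        refine mul_le_mul_of_nonneg_left ?_ two_pos.le
        exact (mul_le_of_le_one_left (abs_nonneg _) (hε _)).trans h1
      · rw [abs_mul, abs_two]
        exact mul_le_mul_of_nonneg_left (h2 n) two_pos.le
    obtain ⟨h1, h2⟩ := integral_mul_increment hf hcm hcb
    have h3 := integral_add ((ig n).sub (jf n)) h1
    rw [h2, add_zero] at h3
    refine le_trans ?_ (h3.le.trans ih)
    refine integral_mono ((ig (n + 1)).sub (jf (n + 1))) (((ig n).sub (jf n)).add h1) fun ω => ?_
    have h4 : (ε (n + 1) * (f (n + 1) ω - f n ω)) ^ 2 ≤ (f (n + 1) ω - f n ω) ^ 2 :=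
      sq_le_sq.2 (by rw [abs_mul]; exact mul_le_of_le_one_left (abs_nonneg _) (hε _))
    simp only [Pi.sub_apply, mtrans]
    nlinarith

end Transform

/-! ### The partial sums of `T` -/

/-- The dyadic conditional expectation of a function. -/
def dyExp (n : ℕ) (h : ℝ → ℝ) : ℝ → ℝ := condExp (dyadicFiltration n) m01 h

/-- The dyadic martingale differences of a function. -/
def dyDiff : ℕ → (ℝ → ℝ) → ℝ → ℝ
  | 0, h => dyExp 0 h
  | n + 1, h => dyExp (n + 1) h - dyExp n h

/-- The partial sums of `T`. -/
def partialT (N : ℕ) (h : ℝ → ℝ) (t : ℝ) : ℝ := ∑ m ∈ Finset.range N, dyDiff (2 * m) h t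

lemma dyadicDiff_eq (n : ℕ) (x : S01) : dyadicDiff n x = dyDiff n x := by
  cases n <;> rfl

lemma isT_iff {x y : S01} :
    IsT x y ↔ TendstoInMeasure m01 (fun N => partialT N x) atTop (fun t => y t) := by
  simp only [IsT, dyadicDiff_eq]
  rfl

lemma integrable_dyExp (n : ℕ) (h : ℝ → ℝ) : Integrable (dyExp n h) m01 := integrable_condExp

lemma integrable_dyDiff (n : ℕ) (h : ℝ → ℝ) : Integrable (dyDiff n h) m01 := by
  cases n
  · exact integrable_dyExp 0 h
  · exact (integrable_dyExp _ h).sub (integrable_dyExp _ h)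

lemma integrable_partialT (N : ℕ) (h : ℝ → ℝ) : Integrable (partialT N h) m01 :=
  integrable_finsetSum _ fun _ _ => integrable_dyDiff _ _

lemma dyExp_congr {g h : ℝ → ℝ} (H : g =ᵐ[m01] h) (n : ℕ) : dyExp n g =ᵐ[m01] dyExp n h :=
  condExp_congr_ae H

lemma dyDiff_congr_of {g h : ℝ → ℝ} (H : ∀ n, dyExp n g =ᵐ[m01] dyExp n h) (n : ℕ) :
    dyDiff n g =ᵐ[m01] dyDiff n h := by
  cases n
  · exact H 0
  · exact (H _).sub (H _)

lemma partialT_congr {g h : ℝ → ℝ} (H : g =ᵐ[m01] h) (N : ℕ) :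
    partialT N g =ᵐ[m01] partialT N h := by
  have : ∀ᵐ u ∂m01, ∀ n, dyDiff n g u = dyDiff n h u :=
    ae_all_iff.2 fun n => dyDiff_congr_of (dyExp_congr H) n
  filter_upwards [this] with u hu
  simp only [partialT, hu]

lemma dyDiff_add {g h : ℝ → ℝ} (hg : Integrable g m01) (hh : Integrable h m01) (n : ℕ) :
    dyDiff n (g + h) =ᵐ[m01] dyDiff n g + dyDiff n h := by
  cases n with
  | zero => exact condExp_add hg hh _
  | succ n =>
    filter_upwards [condExp_add hg hh (dyadicFiltration n),
      condExp_add hg hh (dyadicFiltration (n + 1))] with u h1 h2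
    simp only [dyDiff, Pi.sub_apply, Pi.add_apply, dyExp] at *
    rw [h1, h2]; ring

lemma partialT_add {g h : ℝ → ℝ} (hg : Integrable g m01) (hh : Integrable h m01) (N : ℕ) :
    partialT N (g + h) =ᵐ[m01] partialT N g + partialT N h := by
  have : ∀ᵐ u ∂m01, ∀ n, dyDiff n (g + h) u = dyDiff n g u + dyDiff n h u :=
    ae_all_iff.2 fun n => dyDiff_add hg hh n
  filter_upwards [this] with u hu
  simp only [partialT, hu, Finset.sum_add_distrib, Pi.add_apply]

/-- The coefficients of `T` as a martingale transform. -/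
def evenCoef (k : ℕ) : ℝ := if Even k then 1 else 0

lemma abs_evenCoef_le (k : ℕ) : |evenCoef k| ≤ 1 := by
  unfold evenCoef; split_ifs <;> norm_num

lemma partialT_succ (N : ℕ) (h : ℝ → ℝ) :
    partialT (N + 1) h = mtrans evenCoef (fun n => dyExp n h) (2 * N) := by
  funext t
  induction N with
  | zero => simp [partialT, mtrans, evenCoef, dyDiff]
  | succ N ih =>
    rw [partialT, Finset.sum_range_succ, ← partialT, ih]
    have e : 2 * (N + 1) = 2 * N + 1 + 1 := by ring
    have h1 : ¬ Even (2 * N + 1) := by simp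
    have h2 : Even (2 * N + 1 + 1) := ⟨N + 1, by ring⟩
    rw [e]
    simp only [mtrans, evenCoef, if_neg h1, if_pos h2, dyDiff, Pi.sub_apply]
    ring

lemma martingale_dyExp (h : ℝ → ℝ) : Martingale (fun n => dyExp n h) dyadicFiltration m01 :=
  martingale_condExp h dyadicFiltration m01

/-- The bound is stated with `dyExp (2 * N) h`, not with `h`: in `exists_isT` only the conditional
expectations of `h` are shown to be small. -/
lemma measure_le_partialT_succ (N : ℕ) (h : ℝ → ℝ) {l : ℝ} (hl : 0 < l) :
    m01 {u | l ≤ |partialT (N + 1) h u|} ≤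
      ENNReal.ofReal (2 / l * ∫ u, |dyExp (2 * N) h u| ∂m01) := by
  rw [partialT_succ]
  exact measure_le_mtrans (martingale_dyExp h) abs_evenCoef_le (2 * N) hl

lemma measure_le_partialT (N : ℕ) (h : ℝ → ℝ) {l : ℝ} (hl : 0 < l) :
    m01 {u | l ≤ |partialT N h u|} ≤ ENNReal.ofReal (2 / l * ∫ u, |h u| ∂m01) := by
  cases N with
  | zero =>
    have e : {u | l ≤ |partialT 0 h u|} = ∅ :=
      eq_empty_iff_forall_notMem.2 fun u hu => by
        have hu' : l ≤ |partialT 0 h u| := hu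
        rw [partialT, Finset.sum_range_zero, abs_zero] at hu'
        exact hu'.not_gt hl
    rw [e, measure_empty]
    exact zero_le
  | succ N =>
    refine (measure_le_partialT_succ N h hl).trans (ENNReal.ofReal_le_ofReal ?_)
    exact mul_le_mul_of_nonneg_left (integral_abs_condExp_le h) (by positivity)

lemma ae_abs_dyExp_le {h : ℝ → ℝ} {C : ℝ} (hC : ∀ᵐ u ∂m01, |h u| ≤ C) :
    ∀ᵐ u ∂m01, ∀ n, |dyExp n h u| ≤ C :=
  ae_all_iff.2 fun _ => ae_bdd_abs_condExp_of_ae_bdd_abs hC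

/-- For functions bounded by $1$ squares are below absolute values, so the $L_2$ contraction gives a
bound by the $L_1$ norm, which for a sign function is the measure of its support. -/
lemma integral_sq_partialT_le {h : ℝ → ℝ} (h1 : ∀ᵐ u ∂m01, |h u| ≤ 1) (N : ℕ) :
    Integrable (fun u => partialT N h u ^ 2) m01 ∧
      ∫ u, partialT N h u ^ 2 ∂m01 ≤ ∫ u, |h u| ∂m01 := by
  cases N with
  | zero => simpa [partialT] using integral_nonneg fun u => abs_nonneg (h u)
  | succ N =>
    rw [partialT_succ]
    have hb := ae_abs_dyExp_le h1
    obtain ⟨i, hi⟩ := integral_sq_mtrans_le (martingale_dyExp h) abs_evenCoef_le hb (2 * N)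
    refine ⟨i, hi.trans (le_trans ?_ (integral_abs_condExp_le (m := dyadicFiltration (2 * N)) h))⟩
    refine integral_mono_of_nonneg (Eventually.of_forall fun u => sq_nonneg _)
      (integrable_dyExp _ h).abs ?_
    filter_upwards [hb] with u hu
    have := hu (2 * N)
    show dyExp (2 * N) h u ^ 2 ≤ |dyExp (2 * N) h u|
    rw [← sq_abs]
    nlinarith [abs_nonneg (dyExp (2 * N) h u)]

/-! ### Self-adjointness of the partial sums on bounded functions. -/

section SelfAdjoint

variable {g h : ℝ → ℝ} {B C : ℝ}

lemma integral_dyExp_mul (hh : Integrable h m01)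
    (hB : ∀ᵐ u ∂m01, |g u| ≤ B) (n : ℕ) :
    ∫ u, dyExp n g u * h u ∂m01 = ∫ u, dyExp n g u * dyExp n h u ∂m01 := by
  have h1 : Integrable (dyExp n g * h) m01 :=
    hh.bdd_mul (integrable_dyExp n g).1 ((ae_abs_dyExp_le hB).mono fun u hu => hu n)
  have hm : StronglyMeasurable[dyadicFiltration n] (dyExp n g) := stronglyMeasurable_condExp
  have h2 := condExp_mul_of_stronglyMeasurable_left hm h1 hh
  have h3 := integral_condExp (f := dyExp n g * h) (μ := m01) (dyadicFiltration.le n)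
  rw [integral_congr_ae h2] at h3
  exact h3.symm

lemma integral_dyExp_mul_comm (hg : Integrable g m01) (hh : Integrable h m01)
    (hB : ∀ᵐ u ∂m01, |g u| ≤ B) (hC : ∀ᵐ u ∂m01, |h u| ≤ C) (n : ℕ) :
    ∫ u, dyExp n g u * h u ∂m01 = ∫ u, g u * dyExp n h u ∂m01 := by
  rw [integral_dyExp_mul hh hB]
  have := integral_dyExp_mul hg hC n
  simp only [mul_comm (dyExp n h _)] at this
  exact this.symm

lemma integral_dyDiff_mul_comm (hg : Integrable g m01) (hh : Integrable h m01)
    (hB : ∀ᵐ u ∂m01, |g u| ≤ B) (hC : ∀ᵐ u ∂m01, |h u| ≤ C) (n : ℕ) :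
    ∫ u, dyDiff n g u * h u ∂m01 = ∫ u, g u * dyDiff n h u ∂m01 := by
  cases n with
  | zero => exact integral_dyExp_mul_comm hg hh hB hC 0
  | succ n =>
    simp only [dyDiff, Pi.sub_apply, sub_mul, mul_sub]
    rw [integral_sub, integral_sub, integral_dyExp_mul_comm hg hh hB hC,
      integral_dyExp_mul_comm hg hh hB hC]
    · exact (integrable_dyExp _ h).bdd_mul hg.1 hB
    · exact (integrable_dyExp _ h).bdd_mul hg.1 hB
    · exact (integrable_dyExp _ g).mul_bdd hh.1 hC
    · exact (integrable_dyExp _ g).mul_bdd hh.1 hC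

lemma integral_partialT_mul_comm (hg : Integrable g m01) (hh : Integrable h m01)
    (hB : ∀ᵐ u ∂m01, |g u| ≤ B) (hC : ∀ᵐ u ∂m01, |h u| ≤ C) (N : ℕ) :
    ∫ u, partialT N g u * h u ∂m01 = ∫ u, g u * partialT N h u ∂m01 := by
  simp only [partialT, Finset.sum_mul, Finset.mul_sum]
  rw [integral_finsetSum, integral_finsetSum]
  · exact Finset.sum_congr rfl fun m _ => integral_dyDiff_mul_comm hg hh hB hC _
  · exact fun m _ => (integrable_dyDiff _ h).bdd_mul hg.1 hB
  · exact fun m _ => (integrable_dyDiff _ g).mul_bdd hh.1 hC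

end SelfAdjoint

/-! ### Convergence in measure -/

lemma measure_abs_sub_le (u v w : ℝ → ℝ) (ε : ℝ) : m01 {t | ε ≤ |u t - w t|} ≤
    m01 {t | ε / 2 ≤ |u t - v t|} + m01 {t | ε / 2 ≤ |v t - w t|} := by
  refine (measure_mono fun t ht => ?_).trans (measure_union_le _ _)
  by_contra hcon
  simp only [mem_union, mem_ofPred_eq, not_or, not_le] at hcon
  have h1 : ε ≤ |u t - w t| := ht
  have := abs_sub_le (u t) (v t) (w t)
  linarith

/-- Completeness of convergence in measure: along a fast subsequence the exceptional sets are
summable, and Borel–Cantelli gives an a.e. limit. -/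
lemma exists_tendstoInMeasure {u : ℕ → ℝ → ℝ} (hu : ∀ n, AEStronglyMeasurable (u n) m01)
    (hc : ∀ ε > 0, ∃ N, ∀ i ≥ N, ∀ j ≥ N, m01 {t | ε ≤ |u i t - u j t|} ≤ ENNReal.ofReal ε) :
    ∃ y : S01, TendstoInMeasure m01 u atTop (fun t => y t) := by
  obtain ⟨φ, hφ, hφu⟩ := extraction_forall_of_eventually' (P := fun k N => ∀ i ≥ N, ∀ j ≥ N,
    m01 {t | (1 / 2 : ℝ) ^ k ≤ |u i t - u j t|} ≤ ENNReal.ofReal ((1 / 2 : ℝ) ^ k)) (fun k => by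
      obtain ⟨N, hN⟩ := hc ((1 / 2 : ℝ) ^ k) (by positivity)
      exact ⟨N, fun n hn i hi j hj => hN i (hn.trans hi) j (hn.trans hj)⟩)
  have hfin : ∑' k, m01 {t | (1 / 2 : ℝ) ^ k ≤ |u (φ (k + 1)) t - u (φ k) t|} ≠ ∞ := by
    refine ne_top_of_le_ne_top ?_ (ENNReal.tsum_le_tsum fun k =>
      hφu k _ (hφ (Nat.lt_succ_self k)).le _ le_rfl)
    rw [← ENNReal.ofReal_tsum_of_nonneg (fun k => by positivity) summable_geometric_two]
    exact ENNReal.ofReal_ne_top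
  have hconv : ∀ᵐ t ∂m01, ∃ l, Tendsto (fun k => u (φ k) t) atTop (𝓝 l) := by
    filter_upwards [ae_eventually_notMem hfin] with t ht
    refine cauchySeq_tendsto_of_complete (cauchySeq_of_summable_dist ?_)
    refine Summable.of_norm_bounded_eventually_nat summable_geometric_two ?_
    filter_upwards [ht] with k hk
    simp only [not_le] at hk
    rw [Real.norm_eq_abs, abs_of_nonneg dist_nonneg, dist_comm, Real.dist_eq]
    exact hk.le
  obtain ⟨f, hf, hlim⟩ := measurable_limit_of_tendsto_metrizable_ae
    (fun k => (hu (φ k)).aemeasurable) hconv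
  have h1 : TendstoInMeasure m01 (fun k => u (φ k)) atTop f :=
    tendstoInMeasure_of_tendsto_ae (fun k => hu (φ k)) hlim
  refine ⟨toS f, TendstoInMeasure.congr_right (coe_toS hf.aemeasurable).symm ?_⟩
  rw [tendstoInMeasure_iff_norm] at h1 ⊢
  intro ε hε
  rw [ENNReal.tendsto_nhds_zero]
  intro η hη
  have hη2 : 0 < η / 2 := ENNReal.half_pos hη.ne'
  obtain ⟨d, hd0, hdη⟩ : ∃ d : ℝ, 0 < d ∧ ENNReal.ofReal d ≤ η / 2 := by
    rcases eq_or_ne (η / 2) ∞ with h | h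
    · exact ⟨1, one_pos, by rw [h]; exact le_top⟩
    · exact ⟨(η / 2).toReal, ENNReal.toReal_pos hη2.ne' h, by rw [ENNReal.ofReal_toReal h]⟩
  obtain ⟨N, hN⟩ := hc (min d (ε / 2)) (lt_min hd0 (half_pos hε))
  obtain ⟨k, hk, hkN⟩ := ((ENNReal.tendsto_nhds_zero.1 (h1 (ε / 2) (half_pos hε)) (η / 2) hη2).and
    (eventually_ge_atTop N)).exists
  filter_upwards [eventually_ge_atTop N] with n hn
  refine (measure_abs_sub_le (u n) (u (φ k)) f ε).trans ?_
  rw [← ENNReal.add_halves η]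
  refine add_le_add ?_ hk
  refine (measure_mono fun t ht => ?_).trans ((hN n hn (φ k) (hkN.trans (hφ.id_le k))).trans
    ((ENNReal.ofReal_le_ofReal (min_le_left _ _)).trans hdη))
  exact (min_le_right _ _).trans (show ε / 2 ≤ |u n t - u (φ k) t| from ht)

lemma dyExp_sub_dyExp {h : ℝ → ℝ} (hh : Integrable h m01) {k n : ℕ} (hkn : k ≤ n) :
    dyExp n (h - dyExp k h) =ᵐ[m01] dyExp n h - dyExp k h := by
  have h1 := condExp_sub hh (integrable_dyExp k h) (dyadicFiltration n)
  have h2 : dyExp n (dyExp k h) = dyExp k h :=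
    condExp_of_stronglyMeasurable (dyadicFiltration.le n)
      ((stronglyMeasurable_condExp (f := h)).mono (dyadicFiltration.mono hkn)) (integrable_dyExp k h)
  filter_upwards [h1] with u hu
  have h3 : dyExp n (h - dyExp k h) u = (condExp (dyadicFiltration n) m01 h -
    dyExp n (dyExp k h)) u := hu
  rw [h3, h2]
  rfl

/-- For integrable functions the series defining `T` converges in measure. -/
lemma exists_isT {x : S01} (hx : MemL1 x) : ∃ y, IsT x y := by
  simp only [isT_iff]
  refine exists_tendstoInMeasure (fun n => (integrable_partialT n x).1) fun ε hε => ?_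
  set f : ℕ → ℝ → ℝ := fun n => dyExp n x
  obtain ⟨g, hg, hlim⟩ : ∃ g : ℝ → ℝ, Integrable g m01 ∧
      Tendsto (fun n => ∫ u, |f n u - g u| ∂m01) atTop (𝓝 0) := by
    -- Taking the conditional expectation onto the join as the limit avoids having to identify that
    -- $\sigma$-algebra.
    refine ⟨condExp (⨆ n, dyadicFiltration n) m01 x, integrable_condExp, ?_⟩
    have h1 := tendsto_eLpNorm_condExp (μ := m01) (ℱ := dyadicFiltration) (fun t => x t)
    rw [← ENNReal.tendsto_toReal_iff (fun n => ?_) ENNReal.zero_ne_top] at h1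
    · refine h1.congr fun n => ?_
      rw [eLpNorm_one_eq_lintegral_enorm, ← integral_norm_eq_lintegral_enorm
        (integrable_condExp.sub integrable_condExp).1]
      rfl
    · exact (memLp_one_iff_integrable.2 (integrable_condExp.sub integrable_condExp)).2.ne
  have hη : 0 < ε ^ 2 / 16 := by positivity
  obtain ⟨k, hk⟩ := eventually_atTop.1 (hlim.eventually (gt_mem_nhds hη))
  have hcau : ∀ n ≥ k, ∫ u, |f n u - f k u| ∂m01 ≤ ε ^ 2 / 8 := by
    intro n hn
    have i : ∀ n, Integrable (fun u => |f n u - g u|) m01 := fun n =>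
      ((integrable_dyExp n x).sub hg).abs
    have h1 : ∫ u, |f n u - f k u| ∂m01 ≤ ∫ u, (|f n u - g u| + |f k u - g u|) ∂m01 := by
      refine integral_mono ((integrable_dyExp n x).sub (integrable_dyExp k x)).abs
        ((i n).add (i k)) fun u => ?_
      have := abs_sub_le (f n u) (g u) (f k u)
      rwa [abs_sub_comm (g u)] at this
    rw [integral_add (i n) (i k)] at h1
    linarith [hk n hn, hk k le_rfl]
  -- Past level $k$, $x$ and $h=x-\mathbb E_kx$ have the same differences, and $\mathbb E_nh=\mathbb
  -- E_nx-\mathbb E_kx$ is small in $L_1$, so the weak-type bound applies to $h$.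
  set h : ℝ → ℝ := (fun t => x t) - f k with hh
  have hexp : ∀ n ≥ k, dyExp n h =ᵐ[m01] f n - f k := fun n hn => dyExp_sub_dyExp hx hn
  have hdiff : ∀ m, k + 1 ≤ m → ∀ᵐ u ∂m01, dyDiff (2 * m) x u = dyDiff (2 * m) h u := by
    intro m hm
    obtain ⟨p, rfl⟩ := Nat.exists_eq_add_of_le' (show 1 ≤ m by omega)
    have e : 2 * (p + 1) = 2 * p + 1 + 1 := by ring
    rw [e]
    filter_upwards [hexp (2 * p + 1 + 1) (by omega), hexp (2 * p + 1) (by omega)] with u h1 h2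
    simp only [dyDiff, Pi.sub_apply, h1, h2, f]
    ring
  have hdiff' : ∀ᵐ u ∂m01, ∀ m, k + 1 ≤ m → dyDiff (2 * m) x u = dyDiff (2 * m) h u :=
    ae_all_iff.2 fun m => by
      by_cases hm : k + 1 ≤ m
      · filter_upwards [hdiff m hm] with u hu _ using hu
      · exact Eventually.of_forall fun u hc => absurd hc hm
  have hT : ∀ᵐ u ∂m01, ∀ n, partialT (k + 1 + n) x u - partialT (k + 1) x u =
      partialT (k + 1 + n) h u - partialT (k + 1) h u := by
    filter_upwards [hdiff'] with u hu n
    simp only [partialT, Finset.sum_range_add, add_sub_cancel_left]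
    exact Finset.sum_congr rfl fun m _ => hu _ (by omega)
  have hsmall : ∀ n, m01 {u | ε / 2 ≤ |partialT (k + 1 + n) h u - 0|} ≤
      ENNReal.ofReal (ε / 2) := by
    intro n
    have e : k + 1 + n = k + n + 1 := by ring
    simp only [sub_zero]
    rw [e]
    refine (measure_le_partialT_succ (k + n) h (half_pos hε)).trans (ENNReal.ofReal_le_ofReal ?_)
    have h1 : ∫ u, |dyExp (2 * (k + n)) h u| ∂m01 = ∫ u, |f (2 * (k + n)) u - f k u| ∂m01 :=
      integral_congr_ae ((hexp (2 * (k + n)) (by omega)).mono fun u hu => by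
        show |_| = |_|
        rw [hu, Pi.sub_apply])
    rw [h1]
    calc 2 / (ε / 2) * ∫ u, |f (2 * (k + n)) u - f k u| ∂m01
        ≤ 2 / (ε / 2) * (ε ^ 2 / 8) :=
          mul_le_mul_of_nonneg_left (hcau _ (by omega)) (by positivity)
      _ = ε / 2 := by field_simp; ring
  refine ⟨k + 1, fun i hi j hj => ?_⟩
  obtain ⟨a, rfl⟩ := Nat.exists_eq_add_of_le hi
  obtain ⟨b, rfl⟩ := Nat.exists_eq_add_of_le hj
  have h1 : m01 {t | ε ≤ |partialT (k + 1 + a) x t - partialT (k + 1 + b) x t|} =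
      m01 {t | ε ≤ |partialT (k + 1 + a) h t - partialT (k + 1 + b) h t|} := by
    refine measure_congr ?_
    filter_upwards [hT] with u hu
    have e : partialT (k + 1 + a) x u - partialT (k + 1 + b) x u =
        partialT (k + 1 + a) h u - partialT (k + 1 + b) h u := by linarith [hu a, hu b]
    show (ε ≤ |_|) = (ε ≤ |_|)
    rw [e]
  rw [h1]
  refine (measure_abs_sub_le _ (fun _ => 0) _ ε).trans ?_
  have h2 := hsmall b
  simp only [sub_zero] at h2
  simp only [zero_sub, abs_neg]
  refine (add_le_add (hsmall a) h2).trans ?_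
  rw [← ENNReal.ofReal_add (by positivity) (by positivity), add_halves]

/-! ### The Hardy–Littlewood inequality -/

/-- The layer-cake formula applied twice, first under the measure with density $|h|$. -/
lemma lintegral_mul_eq_lintegral_measure_inter {f h : ℝ → ℝ} (hf : AEMeasurable f m01)
    (hh : AEMeasurable h m01) : ∫⁻ u, ENNReal.ofReal |h u| * ENNReal.ofReal |f u| ∂m01 =
      ∫⁻ s in Ioi 0, ∫⁻ r in Ioi 0, m01 ({u | r < |h u|} ∩ {u | s < |f u|}) := by
  have hhm : AEMeasurable (fun u => ENNReal.ofReal |h u|) m01 := by fun_prop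
  have h1 := lintegral_withDensity_eq_lintegral_mul₀ hhm
    (show AEMeasurable (fun u => ENNReal.ofReal |f u|) m01 by fun_prop)
  have h2 := lintegral_eq_lintegral_meas_lt (m01.withDensity fun u => ENNReal.ofReal |h u|)
    (f := fun u => |f u|) (Eventually.of_forall fun _ => abs_nonneg _)
    ((show AEMeasurable (fun u => |f u|) m01 by fun_prop).mono_ac
      (withDensity_absolutelyContinuous _ _))
  rw [h2] at h1
  simp only [Pi.mul_apply] at h1
  rw [← h1]
  refine lintegral_congr fun s => ?_
  rw [withDensity_apply', lintegral_eq_lintegral_meas_lt (m01.restrict {u | s < |f u|})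
    (Eventually.of_forall fun _ => abs_nonneg _)
    (show AEMeasurable (fun u => |h u|) m01 by fun_prop).restrict]
  refine lintegral_congr fun r => ?_
  rw [Measure.restrict_apply₀]
  exact nullMeasurableSet_lt aemeasurable_const
    (show AEMeasurable (fun u => |h u|) m01 by fun_prop).restrict

/-- For rearrangements the level sets are nested, so their intersection has the largest measure
possible, the minimum of the two. -/
lemma lintegral_mul_le_lintegral_rearr (f h : S01) :
    ∫⁻ u, ENNReal.ofReal |h u| * ENNReal.ofReal |f u| ∂m01 ≤
      ∫⁻ u, ENNReal.ofReal |rearr h u| * ENNReal.ofReal |rearr f u| ∂m01 := by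
  rw [lintegral_mul_eq_lintegral_measure_inter (aemeasurable_coe f) (aemeasurable_coe h),
    lintegral_mul_eq_lintegral_measure_inter (aemeasurable_rearr f) (aemeasurable_rearr h)]
  refine setLIntegral_mono' measurableSet_Ioi fun s hs => setLIntegral_mono' measurableSet_Ioi
    fun r hr => ?_
  have e : m01 ({u | r < |rearr h u|} ∩ {u | s < |rearr f u|}) = min (distr h r) (distr f s) := by
    rw [m01_apply, inter_inter_distrib_right, setOf_lt_rearr h (le_of_lt hr),
      setOf_lt_rearr f (le_of_lt hs), Ioo_inter_Ioo, Real.volume_Ioo, max_self, sub_zero,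
      ENNReal.ofReal_min, ENNReal.ofReal_toReal (distr_ne_top _ _),
      ENNReal.ofReal_toReal (distr_ne_top _ _)]
  rw [e]
  exact le_min (measure_mono inter_subset_left) (measure_mono inter_subset_right)

lemma integral_abs_mul_le {f h : S01} {K : ℝ → ℝ} (hK : Integrable K m01)
    (hle : ∀ s ∈ Ioo (0 : ℝ) 1, rearr h s * rearr f s ≤ K s) :
    ∫ u, |h u| * |f u| ∂m01 ≤ ∫ u, K u ∂m01 := by
  have hf := aemeasurable_coe f
  have hh := aemeasurable_coe h
  have hK0 : ∀ᵐ s ∂m01, rearr h s * rearr f s ≤ K s := ae_mem_Ioo.mono fun s hs => hle s hs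
  have hK1 : 0 ≤ᵐ[m01] K := hK0.mono fun s hs =>
    (mul_nonneg (rearr_nonneg h s) (rearr_nonneg f s)).trans hs
  rw [integral_eq_lintegral_of_nonneg_ae
    (Eventually.of_forall fun u => mul_nonneg (abs_nonneg _) (abs_nonneg _))
    (show AEMeasurable (fun u => |h u| * |f u|) m01 by fun_prop).aestronglyMeasurable,
    integral_eq_lintegral_of_nonneg_ae hK1 hK.1]
  have hfin := (hasFiniteIntegral_iff_ofReal hK1).1 hK.2
  refine ENNReal.toReal_mono hfin.ne ?_
  simp only [ENNReal.ofReal_mul (abs_nonneg _)]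
  refine (lintegral_mul_le_lintegral_rearr f h).trans (lintegral_mono_ae ?_)
  filter_upwards [hK0] with s hs
  rw [← ENNReal.ofReal_mul (abs_nonneg _), abs_of_nonneg (rearr_nonneg h s),
    abs_of_nonneg (rearr_nonneg f s)]
  exact ENNReal.ofReal_le_ofReal hs

/-! ### The upper estimate for `T` -/

lemma measurable_dyExp (n : ℕ) (h : ℝ → ℝ) : Measurable (dyExp n h) :=
  ((stronglyMeasurable_condExp (f := h)).mono (dyadicFiltration.le n)).measurable

lemma measurable_partialT (N : ℕ) (h : ℝ → ℝ) : Measurable (partialT N h) := by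
  refine Finset.measurable_sum _ fun m _ => ?_
  cases 2 * m with
  | zero => exact measurable_dyExp 0 h
  | succ n => exact (measurable_dyExp _ h).sub (measurable_dyExp _ h)

lemma rearr_partialT_le_integral (N : ℕ) (h : ℝ → ℝ) {t : ℝ} (ht : 0 < t) :
    rearr (toS (partialT N h)) t ≤ 2 / t * ∫ u, |h u| ∂m01 := by
  have h0 : 0 ≤ ∫ u, |h u| ∂m01 := integral_nonneg fun u => abs_nonneg _
  refine le_of_forall_gt_imp_ge_of_dense fun l hl => ?_
  have hl0 : 0 < l := lt_of_le_of_lt (by positivity) hl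
  rw [rearr_le_iff _ ht hl0.le, distr_toS (measurable_partialT N h).aemeasurable]
  have hsub : {u | l < |partialT N h u|} ⊆ {u | l ≤ |partialT N h u|} := fun u hu =>
    le_of_lt (show l < |partialT N h u| from hu)
  refine (measure_mono hsub).trans ((measure_le_partialT N h hl0).trans
    (ENNReal.ofReal_le_ofReal ?_))
  rw [div_mul_eq_mul_div, div_lt_iff₀ ht] at hl
  rw [div_mul_eq_mul_div, div_le_iff₀ hl0]
  linarith

lemma rearr_partialT_le_sqrt (N : ℕ) {h : ℝ → ℝ} (h1 : ∀ᵐ u ∂m01, |h u| ≤ 1) {b t : ℝ}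
    (hb : ∫ u, |h u| ∂m01 ≤ b) (hb0 : 0 < b) (ht : 0 < t) :
    rearr (toS (partialT N h)) t ≤ √(b / t) := by
  have hs : 0 < √(b / t) := Real.sqrt_pos.2 (div_pos hb0 ht)
  rw [rearr_le_iff _ ht hs.le, distr_toS (measurable_partialT N h).aemeasurable]
  obtain ⟨hi, hle⟩ := integral_sq_partialT_le h1 N
  have h2 := mul_meas_ge_le_integral_of_nonneg
    (Eventually.of_forall fun u => sq_nonneg (partialT N h u)) hi (b / t)
  refine (measure_mono fun u hu => ?_).trans (?_ : m01 {u | b / t ≤ partialT N h u ^ 2} ≤ _)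
  · have hu' : √(b / t) < |partialT N h u| := hu
    show b / t ≤ partialT N h u ^ 2
    rw [← sq_abs, ← Real.sq_sqrt (div_pos hb0 ht).le]
    exact pow_le_pow_left₀ hs.le hu'.le 2
  · rw [← ofReal_measureReal]
    refine ENNReal.ofReal_le_ofReal ?_
    have h3 := h2.trans (hle.trans hb)
    rw [div_mul_eq_mul_div, div_le_iff₀ ht] at h3
    exact le_of_mul_le_mul_left h3 hb0

lemma restrict_m01 {A : Set ℝ} (hA : MeasurableSet A) (h : A ⊆ Ioo 0 1) :
    m01.restrict A = volume.restrict A := by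
  rw [m01, Measure.restrict_restrict hA, inter_eq_left.2 h]

lemma integral_rpow_neg_half {t : ℝ} (ht : 0 < t) :
    IntegrableOn (fun s : ℝ => s ^ (-(1 / 2) : ℝ)) (Ioo 0 t) ∧
      ∫ s in Ioo 0 t, s ^ (-(1 / 2) : ℝ) = 2 * √t := by
  constructor
  · rw [← intervalIntegrable_iff_integrableOn_Ioo_of_le ht.le]
    exact intervalIntegral.intervalIntegrable_rpow' (by norm_num)
  · rw [← integral_Ioc_eq_integral_Ioo, ← intervalIntegral.integral_of_le ht.le,
      integral_rpow (Or.inl (by norm_num)), Real.sqrt_eq_rpow]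
    norm_num
    ring

/-- The estimate for `T` on functions truncated at height `μ(t; x)`. -/
lemma rearr_partialT_le_of_bounded (N : ℕ) {x : S01} (hx : MemL1 x) {t : ℝ}
    (ht : t ∈ Ioo (0 : ℝ) 1) {h : ℝ → ℝ} (hm : AEMeasurable h m01)
    (h1 : ∀ᵐ u ∂m01, |h u| ≤ rearr x t) (h2 : ∀ᵐ u ∂m01, |h u| ≤ |x u|) :
    rearr (toS (partialT N h)) (t / 2) ≤
      3 * rearr x t + 2 * ∫ s in t..1, rearr x s / s := by
  have ht0 := ht.1
  set a := rearr x t with ha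
  have ha0 : 0 ≤ a := rearr_nonneg x t
  have hI0 : 0 ≤ ∫ s in t..1, rearr x s / s := by
    rw [intervalIntegral.integral_of_le ht.2.le]
    exact setIntegral_nonneg measurableSet_Ioc fun s hs =>
      div_nonneg (rearr_nonneg x s) (ht0.trans hs.1).le
  have hint : Integrable h m01 := Integrable.of_bound hm.aestronglyMeasurable a h1
  refine le_of_forall_lt_imp_le_of_dense fun l hl => ?_
  rcases lt_or_ge l 0 with hl0 | hl0
  · linarith
  set p := partialT N h with hp
  have hpm : Measurable p := measurable_partialT N h
  rw [lt_rearr_iff _ (half_pos ht0) hl0, distr_toS hpm.aemeasurable] at hl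
  set B : Set ℝ := {u | l < |p u|} with hB
  have hBm : MeasurableSet B := measurableSet_lt measurable_const hpm.abs
  set b := m01.real B with hb
  have hbt : t / 2 < b := by
    have := (ENNReal.ofReal_lt_iff_lt_toReal (half_pos ht0).le (measure_ne_top m01 B)).1 hl
    exact this
  have hb0 : 0 < b := (half_pos ht0).trans hbt
  -- Duality: $g=\mathrm{sgn}(p)1_B$ gives $l\,m(B)\le\int p\,g=\int h\,T_Ng$, where $T_N$ is the
  -- $N$-th partial sum, moved from $h$ to $g$ by self-adjointness.
  set g : ℝ → ℝ := B.indicator (fun u => if 0 ≤ p u then 1 else -1) with hg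
  have hgm : Measurable g := (Measurable.ite (measurableSet_le measurable_const hpm)
    measurable_const measurable_const).indicator hBm
  have hgabs : ∀ u, |g u| = B.indicator (1 : ℝ → ℝ) u := by
    intro u
    by_cases hu : u ∈ B
    · rw [hg, indicator_of_mem hu, indicator_of_mem hu, Pi.one_apply]
      split_ifs <;> norm_num
    · rw [hg, indicator_of_notMem hu, indicator_of_notMem hu, abs_zero]
  have hg1 : ∀ u, |g u| ≤ 1 := by
    intro u
    rw [hgabs]
    exact indicator_le_self' (fun _ _ => zero_le_one) u
  have hgb : ∫ u, |g u| ∂m01 = b := by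
    simp only [hgabs]
    exact integral_indicator_one hBm
  have hgi : Integrable g m01 :=
    Integrable.of_bound hgm.aestronglyMeasurable 1 (Eventually.of_forall hg1)
  have hpg : ∀ u, l * |g u| ≤ p u * g u := by
    intro u
    rw [hgabs]
    by_cases hu : u ∈ B
    · have hu' : l < |p u| := hu
      rw [hg, indicator_of_mem hu, indicator_of_mem hu, Pi.one_apply]
      split_ifs with h0
      · rw [abs_of_nonneg h0] at hu'; linarith
      · rw [abs_of_neg (not_le.1 h0)] at hu'; linarith
    · rw [hg, indicator_of_notMem hu, indicator_of_notMem hu]; simp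
  have hpgi : Integrable (fun u => p u * g u) m01 :=
    (integrable_partialT N h).mul_bdd hgi.1 (Eventually.of_forall hg1)
  have step1 : l * b ≤ ∫ u, h u * partialT N g u ∂m01 := by
    rw [← integral_partialT_mul_comm hint hgi h1 (Eventually.of_forall hg1), ← hgb,
      ← integral_const_mul]
    exact integral_mono (hgi.abs.const_mul l) hpgi hpg
  set y := toS (partialT N g) with hy
  have hyc := coe_toS (measurable_partialT N g).aemeasurable
  have hhc := coe_toS hm
  have step2 : ∫ u, h u * partialT N g u ∂m01 ≤ ∫ u, |y u| * |toS h u| ∂m01 := by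
    have hi : Integrable (fun u => h u * partialT N g u) m01 :=
      (integrable_partialT N g).bdd_mul hint.1 h1
    have e : ∫ u, |y u| * |toS h u| ∂m01 = ∫ u, |h u * partialT N g u| ∂m01 := by
      refine integral_congr_ae ?_
      filter_upwards [hyc, hhc] with u h3 h4
      rw [h3, h4, abs_mul, mul_comm]
    rw [e]
    exact integral_mono hi hi.abs fun u => le_abs_self _
  obtain ⟨hr1, hr2⟩ := integral_rpow_neg_half ht0
  have hsub1 : Ioo 0 t ⊆ Ioo (0 : ℝ) 1 := Ioo_subset_Ioo_right ht.2.le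
  have hsub2 : Ico t 1 ⊆ Ioo (0 : ℝ) 1 := fun s hs => ⟨ht0.trans_le hs.1, hs.2⟩
  -- For $s<t$ the $L_2$ bound $\sqrt{b/s}$ on $T_Ng$, integrable at $0$, is paired with $\mu(h)\le
  -- a$. For $s\ge t$ the weak-type bound $2b/s$ is paired with $\mu(h)\le\mu(x)$.
  set k₁ : ℝ → ℝ := fun s => a * √b * s ^ (-(1 / 2) : ℝ)
  set k₂ : ℝ → ℝ := fun s => 2 * b * (rearr x s / s)
  have i₁ : IntegrableOn k₁ (Ioo 0 t) m01 := by
    rw [IntegrableOn, restrict_m01 measurableSet_Ioo hsub1]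
    exact Integrable.const_mul hr1 _
  have i₂ : IntegrableOn k₂ (Ico t 1) m01 := by
    rw [IntegrableOn, restrict_m01 measurableSet_Ico hsub2]
    refine Integrable.const_mul ?_ _
    exact (intervalIntegrable_iff_integrableOn_Ico_of_le ht.2.le).1
      (intervalIntegrable_div hx.integrable_rearr ht0 ht.2.le le_rfl)
  have step3 := integral_abs_mul_le (f := toS h) (h := y)
    ((i₁.integrable_indicator measurableSet_Ioo).add (i₂.integrable_indicator measurableSet_Ico))
    (by
      intro s hs
      have hx1 : rearr (toS h) s ≤ a := by
        rw [rearr_le_iff _ hs.1 ha0]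
        have : distr (toS h) a = 0 := by
          rw [distr_toS hm]
          refine measure_mono_null (t := {u | ¬ |h u| ≤ a}) (fun u hu => not_le.2 hu) h1
        rw [this]; exact zero_le
      have hx2 : rearr (toS h) s ≤ rearr x s := by
        refine rearr_mono (abs_le_abs_iff.2 ?_) hs.1
        filter_upwards [hhc, h2] with u h3 h4
        rwa [h3]
      have hy1 : rearr y s ≤ √(b / s) :=
        rearr_partialT_le_sqrt N (Eventually.of_forall hg1) hgb.le hb0 hs.1
      have hy2 : rearr y s ≤ 2 / s * b := by
        rw [← hgb]; exact rearr_partialT_le_integral N g hs.1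
      rw [Pi.add_apply]
      rcases lt_or_ge s t with hst | hst
      · rw [indicator_of_mem (show s ∈ Ioo 0 t from ⟨hs.1, hst⟩),
          indicator_of_notMem (fun hc => hc.1.not_gt hst), add_zero]
        calc rearr y s * rearr (toS h) s ≤ √(b / s) * a :=
              mul_le_mul hy1 hx1 (rearr_nonneg _ _) (Real.sqrt_nonneg _)
          _ = k₁ s := by
              simp only [k₁]
              rw [Real.sqrt_div hb0.le, Real.rpow_neg hs.1.le, ← Real.sqrt_eq_rpow]
              ring
      · rw [indicator_of_notMem (fun hc => hc.2.not_ge hst),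
          indicator_of_mem (show s ∈ Ico t 1 from ⟨hst, hs.2⟩), zero_add]
        calc rearr y s * rearr (toS h) s ≤ (2 / s * b) * rearr x s :=
              mul_le_mul hy2 hx2 (rearr_nonneg _ _) (by have := hs.1; positivity)
          _ = k₂ s := by simp only [k₂]; ring)
  have e₃ : ∫ u, ((Ioo 0 t).indicator k₁ + (Ico t 1).indicator k₂) u ∂m01 =
      a * √b * (2 * √t) + 2 * b * ∫ s in t..1, rearr x s / s := by
    rw [integral_add' (i₁.integrable_indicator measurableSet_Ioo)
      (i₂.integrable_indicator measurableSet_Ico), integral_indicator measurableSet_Ioo,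
      integral_indicator measurableSet_Ico, restrict_m01 measurableSet_Ioo hsub1,
      restrict_m01 measurableSet_Ico hsub2, integral_const_mul, integral_const_mul, hr2,
      intervalIntegral.integral_of_le ht.2.le, integral_Ico_eq_integral_Ioo,
      integral_Ioc_eq_integral_Ioo]
  -- This uses $t<2b$, which is why the estimate is made at $t/2$.
  have e₄ : √b * √t ≤ 3 / 2 * b := by
    rw [← Real.sqrt_mul hb0.le, Real.sqrt_le_left (by positivity)]
    nlinarith
  have key : l * b ≤ (3 * a + 2 * ∫ s in t..1, rearr x s / s) * b := by
    refine (step1.trans (step2.trans step3)).trans ?_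
    rw [e₃]
    nlinarith [mul_le_mul_of_nonneg_left e₄ ha0]
  exact le_of_mul_le_mul_right key hb0

lemma rearr_le_average {x : S01} (hx : MemL1 x) {t : ℝ} (ht : t ∈ Ioo (0 : ℝ) 1) :
    rearr x t ≤ 1 / t * ∫ s in (0 : ℝ)..t, rearr x s := by
  rw [one_div, ← div_eq_inv_mul, le_div_iff₀ ht.1]
  have h := intervalIntegral.integral_mono_on_of_le_Ioo (f := fun _ => rearr x t) ht.1.le
    intervalIntegrable_const (intervalIntegrable_m01 hx.integrable_rearr le_rfl ht.1.le ht.2.le)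
    fun s hs => rearr_antitone x hs.1 ht.1 hs.2.le
  rw [intervalIntegral.integral_const, sub_zero, smul_eq_mul] at h
  linarith

/-- The uniform estimate for the partial sums of `T`. -/
lemma rearr_partialT_le_calderon (N : ℕ) {x : S01} (hx : MemL1 x) {t : ℝ}
    (ht : t ∈ Ioo (0 : ℝ) 1) :
    rearr (toS (partialT N x)) t ≤ 7 * calderon (rearr x) t := by
  have ht0 := ht.1
  have hxm := aemeasurable_coe x
  set a := rearr x t with ha
  have ha0 : 0 ≤ a := rearr_nonneg x t
  -- $x_2$ is $x$ truncated to $[-a,a]$; the remainder $x_1$ lives on $\{|x|>a\}$, of measure at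
  -- most $t$, so its rearrangement vanishes beyond $t$.
  set x₂ : ℝ → ℝ := fun u => max (min (x u) a) (-a) with hx2
  set x₁ : ℝ → ℝ := fun u => x u - x₂ u with hx1
  have m₂ : AEMeasurable x₂ m01 := by fun_prop
  have m₁ : AEMeasurable x₁ m01 := by fun_prop
  have b₂ : ∀ u, |x₂ u| ≤ a := fun u => abs_le.2
    ⟨le_max_right _ _, max_le (min_le_right _ _) (by linarith)⟩
  have c₂ : ∀ u, |x₂ u| ≤ |x u| := fun u => by
    refine abs_le.2 ⟨?_, ?_⟩
    · rcases le_total (x u) a with h | h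
      · refine le_trans (neg_abs_le (x u)) ?_
        simp only [hx2, min_eq_left h, le_max_left]
      · simp only [hx2, min_eq_right h]
        exact le_max_of_le_left (by linarith [abs_nonneg (x u)])
    · refine max_le ((min_le_left _ _).trans (le_abs_self _)) (by linarith [abs_nonneg (x u)])
  have c₁ : ∀ u, |x₁ u| ≤ |x u| := fun u => by
    simp only [hx1, hx2]
    rcases le_total (x u) a with h | h
    · rw [min_eq_left h]
      rcases le_total (-a) (x u) with h' | h'
      · rw [max_eq_left h', sub_self, abs_zero]; exact abs_nonneg _
      · rw [max_eq_right h', abs_of_nonpos (by linarith), abs_of_nonpos (by linarith)]; linarith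
    · rw [min_eq_right h, max_eq_left (by linarith), abs_of_nonneg (by linarith),
        abs_of_nonneg (by linarith)]; linarith
  have z₁ : ∀ u, |x u| ≤ a → x₁ u = 0 := fun u hu => by
    obtain ⟨h, h'⟩ := abs_le.1 hu
    simp only [hx1, hx2]
    rw [min_eq_left h', max_eq_left h, sub_self]
  have i₁ : Integrable x₁ m01 := Integrable.mono hx m₁.aestronglyMeasurable
    (Eventually.of_forall c₁)
  have i₂ : Integrable x₂ m01 := Integrable.mono hx m₂.aestronglyMeasurable
    (Eventually.of_forall c₂)
  have hsum : ∀ᵐ u ∂m01, |toS (partialT N x) u| ≤ |toS (partialT N x₁) u| +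
      |toS (partialT N x₂) u| := by
    have e : (x : ℝ → ℝ) = x₁ + x₂ := by
      funext u; simp [hx1]
    filter_upwards [coe_toS (measurable_partialT N x).aemeasurable,
      coe_toS (measurable_partialT N x₁).aemeasurable,
      coe_toS (measurable_partialT N x₂).aemeasurable, partialT_add i₁ i₂ N] with u h1 h2 h3 h4
    rw [h1, h2, h3]
    have h5 : partialT N x u = partialT N x₁ u + partialT N x₂ u := by rw [← Pi.add_apply, ← h4, e]
    rw [h5]
    exact abs_add_le _ _
  have h1 := rearr_le_add hsum (half_pos ht0) (half_pos ht0)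
  rw [add_halves] at h1
  have h2 := rearr_partialT_le_of_bounded N hx ht m₂ (Eventually.of_forall b₂)
    (Eventually.of_forall c₂)
  have h3 := rearr_partialT_le_integral N x₁ (half_pos ht0)
  have hx1L : MemL1 (toS x₁) := i₁.congr (coe_toS m₁).symm
  have h4 : ∫ u, |x₁ u| ∂m01 ≤ ∫ s in (0 : ℝ)..t, rearr x s := by
    have e1 : ∫ u, |x₁ u| ∂m01 = ∫ u, |toS x₁ u| ∂m01 :=
      integral_congr_ae ((coe_toS m₁).mono fun u hu => by
        have hu' : toS x₁ u = x₁ u := hu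
        show |x₁ u| = |toS x₁ u|
        rw [hu'])
    have j := hx1L.integrable_rearr
    have j0 := intervalIntegrable_m01 j le_rfl ht0.le ht.2.le
    have j1 := intervalIntegrable_m01 j ht0.le ht.2.le le_rfl
    rw [e1, ← integral_rearr hx1L, integral_m01,
      ← intervalIntegral.integral_add_adjacent_intervals j0 j1]
    have e2 : ∫ s in t..1, rearr (toS x₁) s = 0 := by
      rw [intervalIntegral.integral_of_le ht.2.le]
      refine setIntegral_eq_zero_of_forall_eq_zero fun s hs => ?_
      have hs0 : 0 < s := ht0.trans hs.1
      refine le_antisymm ?_ (rearr_nonneg _ _)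
      rw [rearr_le_iff _ hs0 le_rfl, distr_toS m₁]
      refine (measure_mono fun u hu => ?_).trans (((rearr_le_iff x ht0 ha0).1 le_rfl).trans
        (ENNReal.ofReal_le_ofReal hs.1.le))
      have hu' : 0 < |x₁ u| := hu
      show a < |x u|
      by_contra hcon
      rw [z₁ u (not_lt.1 hcon), abs_zero] at hu'
      exact lt_irrefl _ hu'
    rw [e2, add_zero]
    refine intervalIntegral.integral_mono_on_of_le_Ioo ht0.le j0
      (intervalIntegrable_m01 hx.integrable_rearr le_rfl ht0.le ht.2.le) fun s hs => ?_
    refine rearr_mono (abs_le_abs_iff.2 ?_) hs.1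
    filter_upwards [coe_toS m₁] with u hu
    rw [hu]
    exact c₁ u
  have h5 : 2 / (t / 2) * ∫ u, |x₁ u| ∂m01 ≤ 4 * (1 / t * ∫ s in (0 : ℝ)..t, rearr x s) := by
    refine (mul_le_mul_of_nonneg_left h4 (by positivity)).trans (le_of_eq ?_)
    field_simp; ring
  -- The term $3\mu(t;x)$ is absorbed into the mean: $4+3=7$.
  have h6 := rearr_le_average hx ht
  have h7 : 0 ≤ ∫ s in t..1, rearr x s / s := by
    rw [intervalIntegral.integral_of_le ht.2.le]
    exact setIntegral_nonneg measurableSet_Ioc fun s hs =>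
      div_nonneg (rearr_nonneg x s) (ht0.trans hs.1).le
  simp only [calderon]
  linarith

/-- `μ(Tx) ≤ 14 S μ(x)`. -/
theorem IsT.rearrLeCalderon {x y : S01} (hx : MemL1 x) (h : IsT x y) :
    RearrLeCalderon y ((14 : ℝ) • x) := by
  intro t ht
  have ht0 := ht.1
  have ht2 : t / 2 ∈ Ioo (0 : ℝ) 1 := ⟨half_pos ht0, by linarith [ht.2]⟩
  rw [calderon_congr (g := fun s => |(14 : ℝ)| * rearr x s) (fun s hs => rearr_smul _ _ hs.1) ht,
    calderon_const_mul, abs_of_pos (by norm_num)]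
  refine le_of_forall_pos_le_add fun ε hε => ?_
  rw [isT_iff, tendstoInMeasure_iff_norm] at h
  obtain ⟨N, hN⟩ := (ENNReal.tendsto_nhds_zero.1 (h ε hε) (ENNReal.ofReal (t / 2))
    (ENNReal.ofReal_pos.2 ht2.1)).exists
  have hm := (measurable_partialT N x).aemeasurable (μ := m01)
  -- Half of $t$ is spent on the error of the limit in measure; the other half costs the factor $2$
  -- that turns $7$ into $14$.
  have h1 : rearr (y - toS (partialT N x)) (t / 2) ≤ ε := by
    rw [rearr_le_iff _ ht2.1 hε.le]
    refine le_trans (measure_mono_ae ?_) hN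
    filter_upwards [coe_toS hm, AEEqFun.coeFn_sub y (toS (partialT N x))] with u h2 h3 h4
    have h4' : ε < |(y - toS (partialT N x) : S01) u| := h4
    rw [h3, Pi.sub_apply, h2, abs_sub_comm] at h4'
    exact h4'.le
  have h2 := rearr_add_le (toS (partialT N x)) (y - toS (partialT N x)) ht2.1 ht2.1
  rw [add_halves, add_sub_cancel] at h2
  have h3 := rearr_partialT_le_calderon N hx ht2
  have h4 := calderon_half hx.integrable_rearr (fun s _ => rearr_nonneg x s) ht
  linarith

/-! ### Functions constant on dyadic shells -/

/-- The dyadic shell `[2^{-k-1}, 2^{-k})`. -/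
def shell (k : ℕ) : Set ℝ := Ico ((1 / 2 : ℝ) ^ (k + 1)) ((1 / 2) ^ k)

/-- The function with value `v k` on the `k`-th dyadic shell. -/
def radial (v : ℕ → ℝ) (u : ℝ) : ℝ := v (-⌊Real.logb 2 u⌋ - 1).toNat

lemma radial_of_mem {v : ℕ → ℝ} {k : ℕ} {u : ℝ} (hu : u ∈ shell k) : radial v u = v k := by
  have hu0 : 0 < u := lt_of_lt_of_le (by positivity) hu.1
  have h : ⌊Real.logb 2 u⌋ = -((k : ℤ) + 1) := by
    rw [Int.floor_eq_iff]
    have e1 : ((1 / 2 : ℝ) ^ (k + 1)) = 2 ^ (((-((k : ℤ) + 1) : ℤ) : ℝ)) := by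
      rw [Real.rpow_intCast, zpow_neg, one_div, inv_pow]
      norm_cast
    have e2 : ((1 / 2 : ℝ) ^ k) = 2 ^ (((-((k : ℤ) + 1) : ℤ) : ℝ) + 1) := by
      have : ((-((k : ℤ) + 1) : ℤ) : ℝ) + 1 = ((-(k : ℤ) : ℤ) : ℝ) := by push_cast; ring
      rw [this, Real.rpow_intCast, zpow_neg, one_div, inv_pow]
      norm_cast
    constructor
    · rw [Real.le_logb_iff_rpow_le one_lt_two hu0, ← e1]; exact hu.1
    · rw [Real.logb_lt_iff_lt_rpow one_lt_two hu0, ← e2]; exact hu.2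
  rw [radial, h]
  congr 1
  omega

lemma measurable_radial (v : ℕ → ℝ) : Measurable (radial v) := by
  have h1 : Measurable fun u : ℝ => ⌊Real.logb 2 u⌋ :=
    Int.measurable_floor.comp (Real.measurable_log.div_const _)
  exact (measurable_from_top (f := fun i : ℤ => v (-i - 1).toNat)).comp h1

lemma exists_mem_shell {u : ℝ} (hu : u ∈ Ioo (0 : ℝ) 1) : ∃ k, u ∈ shell k := by
  obtain ⟨n, hn1, hn2⟩ := exists_mem_Ico_zpow hu.1 one_lt_two
  have hn : n < 0 := by
    by_contra! h
    have : (1 : ℝ) ≤ 2 ^ n := one_le_zpow₀ one_lt_two.le h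
    linarith [hu.2]
  obtain ⟨k, rfl⟩ : ∃ k : ℕ, n = -((k : ℤ) + 1) := ⟨(-n - 1).toNat, by omega⟩
  refine ⟨k, ?_, ?_⟩
  · convert hn1 using 1
    rw [zpow_neg, one_div, inv_pow]
    norm_cast
  · convert hn2 using 1
    rw [show -((k : ℤ) + 1) + 1 = -(k : ℤ) by ring, zpow_neg, one_div, inv_pow]
    norm_cast

lemma half_pow_le_one (n : ℕ) : (1 / 2 : ℝ) ^ n ≤ 1 := pow_le_one₀ (by norm_num) (by norm_num)

lemma half_pow_anti {m n : ℕ} (h : m ≤ n) : (1 / 2 : ℝ) ^ n ≤ (1 / 2) ^ m :=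
  pow_le_pow_of_le_one (by norm_num) (by norm_num) h

lemma measurableSet_dyadic_shell {k n : ℕ} (h : k < n) :
    MeasurableSet[dyadicFiltration n] (shell k) := by
  refine dyadicFiltration.mono (Nat.succ_le_of_lt h) _ ?_
  refine MeasurableSpace.measurableSet_generateFrom ⟨1, Nat.one_lt_two_pow (Nat.succ_ne_zero k), ?_⟩
  rw [shell, one_div, inv_pow, inv_pow, pow_succ]
  congr 1
  · simp
  · push_cast; field_simp; norm_num

lemma measurableSet_dyadic_zero (n : ℕ) :
    MeasurableSet[dyadicFiltration n] (Ico 0 ((1 / 2 : ℝ) ^ n)) := by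
  refine MeasurableSpace.measurableSet_generateFrom ⟨0, by positivity, ?_⟩
  simp

/-- $[0,2^{-n})$ is an atom of $\mathcal F_n$, as the property passes from the generators to
complements and unions. -/
lemma dyadic_zero_subset_or_disjoint {n : ℕ} {s : Set ℝ}
    (hs : MeasurableSet[dyadicFiltration n] s) :
    Ico 0 ((1 / 2 : ℝ) ^ n) ⊆ s ∨ Disjoint s (Ico 0 ((1 / 2 : ℝ) ^ n)) := by
  refine MeasurableSpace.generateFrom_induction
    {A : Set ℝ | ∃ k : ℕ, k < 2 ^ n ∧ A = Ico ((k : ℝ) / 2 ^ n) (((k : ℝ) + 1) / 2 ^ n)}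
    (fun s _ => Ico 0 ((1 / 2 : ℝ) ^ n) ⊆ s ∨ Disjoint s (Ico 0 ((1 / 2 : ℝ) ^ n)))
    ?_ ?_ ?_ ?_ s hs
  · rintro _ ⟨k, -, rfl⟩ -
    rcases Nat.eq_zero_or_pos k with rfl | hk
    · left; simp
    · right
      rw [disjoint_left]
      intro u hu hu'
      have h1 : (1 / 2 : ℝ) ^ n ≤ (k : ℝ) / 2 ^ n := by
        rw [one_div, inv_pow, ← one_div]
        have : (1 : ℝ) ≤ k := by exact_mod_cast hk
        gcongr
      linarith [hu.1, hu'.2]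
  · exact Or.inr (disjoint_left.2 fun u hu => hu.elim)
  · rintro t - (h | h)
    · exact Or.inr (disjoint_left.2 fun u hu hu' => hu (h hu'))
    · exact Or.inl fun u hu hu' => disjoint_left.1 h hu' hu
  · intro A _ hA
    by_cases h : ∃ i, Ico 0 ((1 / 2 : ℝ) ^ n) ⊆ A i
    · obtain ⟨i, hi⟩ := h
      exact Or.inl (hi.trans (subset_iUnion A i))
    · push Not at h
      exact Or.inr (disjoint_iUnion_left.2 fun i => (hA i).resolve_left (h i))

lemma stronglyMeasurable_radial_indicator (v : ℕ → ℝ) (n : ℕ) :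
    StronglyMeasurable[dyadicFiltration n] ((Ico ((1 / 2 : ℝ) ^ n) 1).indicator (radial v)) := by
  induction n with
  | zero => simp only [pow_zero, Ico_self, indicator_empty]; exact stronglyMeasurable_zero
  | succ n ih =>
    have hdisj : Disjoint (shell n) (Ico ((1 / 2 : ℝ) ^ n) 1) :=
      disjoint_left.2 fun u hu hu' => hu.2.not_ge hu'.1
    have e : (Ico ((1 / 2 : ℝ) ^ (n + 1)) 1).indicator (radial v) =
        (shell n).indicator (fun _ => v n) + (Ico ((1 / 2 : ℝ) ^ n) 1).indicator (radial v) := by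
      have hun : shell n ∪ Ico ((1 / 2 : ℝ) ^ n) 1 = Ico ((1 / 2 : ℝ) ^ (n + 1)) 1 :=
        Ico_union_Ico_eq_Ico (half_pow_anti n.le_succ) (half_pow_le_one n)
      rw [← hun, indicator_union_of_disjoint hdisj]
      funext u
      simp only [Pi.add_apply]
      congr 1
      by_cases hu : u ∈ shell n
      · simp only [indicator_of_mem hu, radial_of_mem hu]
      · simp only [indicator_of_notMem hu]
    rw [e]
    exact (stronglyMeasurable_const.indicator (measurableSet_dyadic_shell n.lt_succ_self)).add
      (ih.mono (dyadicFiltration.mono n.le_succ))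

lemma m01_restrict_Ico_half_pow (n : ℕ) :
    m01.restrict (Ico 0 ((1 / 2 : ℝ) ^ n)) = volume.restrict (Ioo 0 ((1 / 2 : ℝ) ^ n)) := by
  rw [m01, Measure.restrict_restrict measurableSet_Ico]
  congr 1
  ext u
  simp only [mem_inter_iff, mem_Ico, mem_Ioo]
  constructor
  · rintro ⟨⟨-, h1⟩, h2, -⟩; exact ⟨h2, h1⟩
  · rintro ⟨h1, h2⟩; exact ⟨⟨h1.le, h2⟩, h1, h2.trans_le (half_pow_le_one n)⟩

/-- The average of the radial function over `(0, 2^{-n})`. -/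
def radialAvg (v : ℕ → ℝ) (n : ℕ) : ℝ := 2 ^ n * ∫ u in (0 : ℝ)..(1 / 2) ^ n, radial v u

/-- Shells $k<n$ belong to $\mathcal F_n$, so a radial function is changed only on the atom at $0$,
where it is averaged. -/
lemma dyExp_radial {v : ℕ → ℝ} (hv : Integrable (radial v) m01) (n : ℕ) :
    ∀ᵐ u ∂m01, dyExp n (radial v) u =
      if u < (1 / 2 : ℝ) ^ n then radialAvg v n else radial v u := by
  set I : Set ℝ := Ico 0 ((1 / 2 : ℝ) ^ n) with hI
  have hIm : MeasurableSet I := measurableSet_Ico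
  set P : ℝ → ℝ := I.indicator (fun _ => radialAvg v n) +
    (Ico ((1 / 2 : ℝ) ^ n) 1).indicator (radial v) with hP
  have hPm : StronglyMeasurable[dyadicFiltration n] P :=
    (stronglyMeasurable_const.indicator (measurableSet_dyadic_zero n)).add
      (stronglyMeasurable_radial_indicator v n)
  have hPi : Integrable P m01 :=
    ((integrable_const _).indicator hIm).add (hv.indicator measurableSet_Ico)
  have hPin : ∀ u ∈ I, P u = radialAvg v n := fun u hu => by
    rw [hP, Pi.add_apply, indicator_of_mem hu, indicator_of_notMem (fun h => h.1.not_gt hu.2),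
      add_zero]
  have hPout : ∀ u ∈ Ioo (0 : ℝ) 1, u ∉ I → P u = radial v u := fun u hu huI => by
    rw [hP, Pi.add_apply, indicator_of_notMem huI, zero_add, indicator_of_mem]
    exact ⟨not_lt.1 fun h => huI ⟨hu.1.le, h⟩, hu.2⟩
  have hzero : ∫ u in I, (radial v u - P u) ∂m01 = 0 := by
    have h1 : ∫ u in I, (radial v u - P u) ∂m01 = ∫ u in I, (radial v u - radialAvg v n) ∂m01 :=
      setIntegral_congr_fun hIm fun u hu => by simp only [hPin u hu]
    rw [h1, integral_sub hv.integrableOn (integrable_const _), hI, m01_restrict_Ico_half_pow,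
      setIntegral_const, radialAvg, intervalIntegral.integral_of_le (by positivity),
      integral_Ioc_eq_integral_Ioo, Measure.real, Real.volume_Ioo, sub_zero,
      ENNReal.toReal_ofReal (by positivity), smul_eq_mul, ← mul_assoc, ← mul_pow]
    norm_num
  have hdiff : ∀ s : Set ℝ, MeasurableSet[dyadicFiltration n] s →
      ∫ u in s, (radial v u - P u) ∂m01 = 0 := by
    intro s hs
    have hsm : MeasurableSet s := dyadicFiltration.le n _ hs
    rcases dyadic_zero_subset_or_disjoint hs with h | h
    · have hi : Integrable (fun u => radial v u - P u) m01 := hv.sub hPi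
      have hs' : s = I ∪ s \ I := (union_sdiff_cancel h).symm
      rw [hs', setIntegral_union disjoint_sdiff_right (hsm.diff hIm) hi.integrableOn
        hi.integrableOn, hzero, zero_add]
      refine integral_eq_zero_of_ae ?_
      filter_upwards [ae_restrict_mem (hsm.diff hIm), ae_restrict_of_ae ae_mem_Ioo] with u h1 h2
      simp [hPout u h2 h1.2]
    · refine integral_eq_zero_of_ae ?_
      filter_upwards [ae_restrict_mem hsm, ae_restrict_of_ae ae_mem_Ioo] with u h1 h2
      simp [hPout u h2 (disjoint_left.1 h h1)]
  have key : P =ᵐ[m01] dyExp n (radial v) := by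
    refine ae_eq_condExp_of_forall_setIntegral_eq (dyadicFiltration.le n) hv
      (fun s _ _ => hPi.integrableOn) (fun s hs _ => ?_) hPm.aestronglyMeasurable
    have := hdiff s hs
    rw [integral_sub hv.integrableOn hPi.integrableOn] at this
    linarith
  filter_upwards [key, ae_mem_Ioo] with u hu hu1
  rw [← hu]
  split_ifs with h
  · exact hPin u ⟨hu1.1.le, h⟩
  · exact hPout u hu1 fun h' => h h'.2

lemma intervalIntegrable_radial {v : ℕ → ℝ} (hv : Integrable (radial v) m01) (m n : ℕ) :
    IntervalIntegrable (radial v) volume ((1 / 2 : ℝ) ^ m) ((1 / 2) ^ n) := by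
  have h0 : ∀ m : ℕ, (0 : ℝ) ≤ (1 / 2) ^ m := fun m => by positivity
  rcases le_total ((1 / 2 : ℝ) ^ m) ((1 / 2) ^ n) with h | h
  · exact intervalIntegrable_m01 hv (h0 m) h (half_pow_le_one n)
  · exact (intervalIntegrable_m01 hv (h0 n) h (half_pow_le_one m)).symm

lemma integral_radial_succ {v : ℕ → ℝ} (hv : Integrable (radial v) m01) (n : ℕ) :
    ∫ u in (0 : ℝ)..(1 / 2) ^ n, radial v u =
      (∫ u in (0 : ℝ)..(1 / 2) ^ (n + 1), radial v u) + v n * (1 / 2) ^ (n + 1) := by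
  rw [← intervalIntegral.integral_add_adjacent_intervals
    (intervalIntegrable_m01 hv le_rfl (by positivity) (half_pow_le_one (n + 1)))
    (intervalIntegrable_radial hv (n + 1) n)]
  congr 1
  have hle : (1 / 2 : ℝ) ^ (n + 1) ≤ (1 / 2) ^ n := half_pow_anti n.le_succ
  rw [intervalIntegral.integral_of_le hle, ← integral_Ico_eq_integral_Ioc]
  have h1 : ∫ u in Ico ((1 / 2 : ℝ) ^ (n + 1)) ((1 / 2) ^ n), radial v u =
      ∫ u in Ico ((1 / 2 : ℝ) ^ (n + 1)) ((1 / 2) ^ n), v n :=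
    setIntegral_congr_fun measurableSet_Ico fun u hu => radial_of_mem hu
  rw [h1, setIntegral_const, Measure.real, Real.volume_Ico, ENNReal.toReal_ofReal (sub_nonneg.2 hle),
    smul_eq_mul, mul_comm]
  congr 1
  rw [pow_succ]; ring

lemma integral_radial_nonneg {v : ℕ → ℝ} (hv0 : ∀ k, 0 ≤ v k) (n : ℕ) :
    0 ≤ ∫ u in (0 : ℝ)..(1 / 2) ^ n, radial v u :=
  intervalIntegral.integral_nonneg (by positivity) fun _ _ => hv0 _

lemma dyDiff_radial_of_lt {v : ℕ → ℝ} {u : ℝ} {m : ℕ}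
    (hu : ∀ n, dyExp n (radial v) u =
      if u < (1 / 2 : ℝ) ^ n then radialAvg v n else radial v u)
    (h : u < (1 / 2 : ℝ) ^ (m + 1)) :
    dyDiff (m + 1) (radial v) u = radialAvg v (m + 1) - radialAvg v m := by
  rw [dyDiff, Pi.sub_apply, hu, hu, if_pos h, if_pos (h.trans_le (half_pow_anti m.le_succ))]

/-- The value of `T (radial v)` on the `2j`-th shell, when `v` vanishes at odd integers. -/
lemma partialT_radial {v : ℕ → ℝ} (hv : Integrable (radial v) m01)
    (hodd : ∀ k, v (2 * k + 1) = 0) (j : ℕ) : ∀ᵐ u ∂m01, u ∈ shell (2 * j) → ∀ N, j + 1 ≤ N →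
      partialT N (radial v) u =
        radialAvg v 0 + ∑ m ∈ Finset.range j, radialAvg v (2 * (m + 1)) / 2 := by
  have hae := ae_all_iff.2 fun n => dyExp_radial hv n
  filter_upwards [hae, ae_mem_Ioo] with u hu hu1 hus N hN
  -- The odd shell contributes no mass, so extending the interval across it halves the average.
  -- Hence $\mathbb E_{2m}-\mathbb E_{2m-1}$ equals half the average at level $2m$ near $0$, with no
  -- change of sign when $v\ge0$.
  have hhalf : ∀ k, radialAvg v (2 * k + 1) = radialAvg v (2 * (k + 1)) / 2 := by
    intro k
    rw [radialAvg, radialAvg, integral_radial_succ hv, hodd]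
    rw [show 2 * (k + 1) = 2 * k + 1 + 1 by ring, pow_succ 2 (2 * k + 1)]
    ring
  obtain ⟨p, rfl⟩ := Nat.exists_eq_add_of_le hN
  -- From level $2j+1$ on, $u$ lies outside the atom at $0$, so the conditional expectations have
  -- stabilised at $u$.
  have hlast : ∀ p, partialT (j + 1 + p) (radial v) u = partialT (j + 1) (radial v) u := by
    intro p
    rw [partialT, Finset.sum_range_add, partialT]
    refine add_eq_left.2 (Finset.sum_eq_zero fun i _ => ?_)
    have e : 2 * (j + 1 + i) = 2 * j + 1 + 2 * i + 1 := by ring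
    have h1 : ∀ q, ¬ u < (1 / 2 : ℝ) ^ (2 * j + 1 + q) := fun q =>
      not_lt.2 ((half_pow_anti (Nat.le_add_right _ q)).trans hus.1)
    rw [e, dyDiff, Pi.sub_apply, hu, hu, if_neg (h1 (2 * i)), add_assoc (2 * j + 1),
      if_neg (h1 _), sub_self]
  rw [hlast, partialT, Finset.sum_range_succ', add_comm]
  congr 1
  · rw [mul_zero, dyDiff, hu, if_pos (by simpa using hu1.2)]
  · refine Finset.sum_congr rfl fun m hm => ?_
    have hm' : m < j := Finset.mem_range.1 hm
    have e : 2 * (m + 1) = 2 * m + 1 + 1 := by ring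
    rw [e, dyDiff_radial_of_lt hu (hus.2.trans_le (half_pow_anti (by omega))), ← e, hhalf]
    ring

/-! ### The lower estimate for `T` -/

/-- The shell values of the extremal function associated with the decreasing function `g`. -/
def extremalSeq (g : ℝ → ℝ) (k : ℕ) : ℝ := if Even k then g ((1 / 2) ^ k) else 0

section Lower

variable {y : S01}

lemma extremalSeq_nonneg (y : S01) (k : ℕ) : 0 ≤ extremalSeq (rearr y) k := by
  unfold extremalSeq
  split_ifs
  · exact rearr_nonneg _ _
  · exact le_rfl

lemma extremalSeq_even (g : ℝ → ℝ) (k : ℕ) : extremalSeq g (2 * k) = g ((1 / 2) ^ (2 * k)) := by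
  rw [extremalSeq, if_pos (even_two_mul k)]

lemma extremalSeq_odd (g : ℝ → ℝ) (k : ℕ) : extremalSeq g (2 * k + 1) = 0 := by
  rw [extremalSeq, if_neg (by simp)]

/-- The shell value is taken at the right endpoint, where $\mu(y)$ is smallest. This is what places
the extremal function in $E$. -/
lemma abs_radial_extremalSeq_le {u : ℝ} (hu : u ∈ Ioo (0 : ℝ) 1) :
    |radial (extremalSeq (rearr y)) u| ≤ rearr y u := by
  obtain ⟨k, hk⟩ := exists_mem_shell hu
  rw [radial_of_mem hk, abs_of_nonneg (extremalSeq_nonneg y k), extremalSeq]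
  split_ifs
  · exact rearr_antitone y hu.1 (show (0 : ℝ) < (1 / 2) ^ k by positivity) hk.2.le
  · exact rearr_nonneg y u

lemma integrable_radial_extremalSeq (hy : MemL1 y) :
    Integrable (radial (extremalSeq (rearr y))) m01 := by
  refine Integrable.mono' hy.integrable_rearr (measurable_radial _).aestronglyMeasurable ?_
  filter_upwards [ae_mem_Ioo] with u hu using abs_radial_extremalSeq_le hu

lemma integral_rearr_four (hy : MemL1 y) (n : ℕ) :
    ∫ u in (1 / 2 : ℝ) ^ (2 * (n + 1))..(1 / 2) ^ (2 * n), rearr y u ≤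
      3 * (1 / 2) ^ (2 * (n + 1)) * extremalSeq (rearr y) (2 * (n + 1)) := by
  have hle : (1 / 2 : ℝ) ^ (2 * (n + 1)) ≤ (1 / 2) ^ (2 * n) := half_pow_anti (by omega)
  have hpos : (0 : ℝ) < (1 / 2) ^ (2 * (n + 1)) := by positivity
  have h := intervalIntegral.integral_mono_on_of_le_Ioo (g := fun _ => rearr y
    ((1 / 2) ^ (2 * (n + 1)))) hle (intervalIntegrable_m01 hy.integrable_rearr hpos.le hle
    (half_pow_le_one _)) intervalIntegrable_const
    fun s hs => rearr_antitone y hpos (hpos.trans hs.1) hs.1.le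
  rw [intervalIntegral.integral_const, smul_eq_mul] at h
  rw [extremalSeq_even]
  refine h.trans (le_of_eq ?_)
  rw [show 2 * (n + 1) = 2 * n + 2 by ring, pow_add]
  ring

/-- On $[4^{-n-1},4^{-n})$ the mass of $\mu(y)$ is at most $3\cdot4^{-n-1}v_{2n+2}$, while $f$ has
mass $\frac12 4^{-n-1}v_{2n+2}$ on the shell just to the left of that interval. The ratio is $6$ and
the index shifts by one; telescoping sums these comparisons. -/
lemma integral_rearr_le_radial (hy : MemL1 y) (n : ℕ) :
    ∫ u in (0 : ℝ)..(1 / 2) ^ (2 * n), rearr y u ≤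
      6 * ∫ u in (0 : ℝ)..(1 / 2) ^ (2 * (n + 1)), radial (extremalSeq (rearr y)) u := by
  set v := extremalSeq (rearr y)
  have hv := integrable_radial_extremalSeq hy
  set R : ℕ → ℝ := fun n => ∫ u in (0 : ℝ)..(1 / 2) ^ (2 * n), rearr y u with hR
  set Q : ℕ → ℝ := fun n => ∫ u in (0 : ℝ)..(1 / 2) ^ (2 * n), radial v u with hQ
  have hstep : ∀ n, R n - R (n + 1) ≤ 6 * (Q (n + 1) - Q (n + 2)) := by
    intro n
    have hle : (1 / 2 : ℝ) ^ (2 * (n + 1)) ≤ (1 / 2) ^ (2 * n) := half_pow_anti (by omega)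
    have h1 := intervalIntegral.integral_add_adjacent_intervals
      (intervalIntegrable_m01 hy.integrable_rearr le_rfl (by positivity)
        (half_pow_le_one (2 * (n + 1))))
      (intervalIntegrable_m01 hy.integrable_rearr (by positivity) hle (half_pow_le_one _))
    have h2 := integral_rearr_four hy n
    have h3 := integral_radial_succ hv (2 * (n + 1))
    have h4 := integral_radial_succ hv (2 * (n + 1) + 1)
    rw [extremalSeq_odd, zero_mul, add_zero] at h4
    have h5 : Q (n + 1) = Q (n + 2) + v (2 * (n + 1)) * (1 / 2) ^ (2 * (n + 1) + 1) := by
      simp only [hQ]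
      rw [h3, h4]
      congr 1
    rw [h5, pow_succ]
    simp only [hR]
    rw [← h1]
    simp only [v]
    linarith
  have htel : ∀ M, R n - R (n + M) ≤ 6 * (Q (n + 1) - Q (n + 1 + M)) := by
    intro M
    induction M with
    | zero => simp
    | succ M ih =>
      have := hstep (n + M)
      rw [show n + 1 + (M + 1) = n + M + 2 by ring, ← add_assoc n M 1]
      rw [show n + 1 + M = n + M + 1 by ring] at ih
      linarith
  have hlim : Tendsto (fun M => R (n + M)) atTop (𝓝 0) := by
    have hc := intervalIntegral.continuousOn_primitive_interval (μ := volume) (a := 0) (b := 1)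
      (f := rearr y) (by
        rw [uIcc_of_le zero_le_one, integrableOn_Icc_iff_integrableOn_Ioo]
        exact hy.integrable_rearr)
    have h0 := hc 0 left_mem_uIcc
    have h1 : Tendsto (fun M : ℕ => (1 / 2 : ℝ) ^ (2 * (n + M))) atTop (𝓝[uIcc 0 1] 0) := by
      refine tendsto_nhdsWithin_iff.2 ⟨?_, Eventually.of_forall fun M => ?_⟩
      · refine (tendsto_pow_atTop_nhds_zero_of_lt_one (r := (1 / 2 : ℝ)) (by norm_num)
          (by norm_num)).comp (tendsto_atTop_mono (fun M => ?_) tendsto_id)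
        simp only [id]; omega
      · rw [uIcc_of_le zero_le_one]
        exact ⟨by positivity, half_pow_le_one _⟩
    have h2 := h0.tendsto.comp h1
    rw [intervalIntegral.integral_same] at h2
    exact h2
  have h6 : Tendsto (fun M => R n - R (n + M)) atTop (𝓝 (R n - 0)) := hlim.const_sub _
  rw [sub_zero] at h6
  refine le_of_tendsto' h6 fun M => (htel M).trans ?_
  have : 0 ≤ Q (n + 1 + M) := integral_radial_nonneg (extremalSeq_nonneg y) _
  have h7 : 6 * (Q (n + 1) - Q (n + 1 + M)) ≤ 6 * Q (n + 1) := by linarith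
  exact h7

lemma integral_rearr_div_le (hy : MemL1 y) (n : ℕ) :
    ∫ u in (1 / 2 : ℝ) ^ (2 * n)..1, rearr y u / u ≤
      3 * ∑ m ∈ Finset.range n, extremalSeq (rearr y) (2 * (m + 1)) := by
  induction n with
  | zero => simp
  | succ n ih =>
    have hle : (1 / 2 : ℝ) ^ (2 * (n + 1)) ≤ (1 / 2) ^ (2 * n) := half_pow_anti (by omega)
    have hpos : (0 : ℝ) < (1 / 2) ^ (2 * (n + 1)) := by positivity
    have hi := hy.integrable_rearr
    rw [← intervalIntegral.integral_add_adjacent_intervals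
      (intervalIntegrable_div hi hpos hle (half_pow_le_one _))
      (intervalIntegrable_div hi (by positivity) (half_pow_le_one _) le_rfl),
      Finset.sum_range_succ, mul_add (3 : ℝ), add_comm]
    refine add_le_add ih ((intervalIntegral_div_le hi (fun s _ => rearr_nonneg y s) hpos hle
      (half_pow_le_one _)).trans ?_)
    refine (mul_le_mul_of_nonneg_left (integral_rearr_four hy n) (by positivity)).trans
      (le_of_eq ?_)
    field_simp

lemma radialAvg_nonneg (y : S01) (n : ℕ) : 0 ≤ radialAvg (extremalSeq (rearr y)) n :=
  mul_nonneg (by positivity) (integral_radial_nonneg (extremalSeq_nonneg y) n)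

/-- The $n$-th shell fills half of $(0,2^{-n})$. -/
lemma extremalSeq_le_radialAvg (hy : MemL1 y) (n : ℕ) :
    extremalSeq (rearr y) n ≤ 2 * radialAvg (extremalSeq (rearr y)) n := by
  rw [radialAvg, integral_radial_succ (integrable_radial_extremalSeq hy)]
  have h1 := integral_radial_nonneg (extremalSeq_nonneg y) (n + 1)
  have h2 : (0 : ℝ) ≤ 2 ^ n * ∫ u in (0 : ℝ)..(1 / 2) ^ (n + 1),
    radial (extremalSeq (rearr y)) u := mul_nonneg (by positivity) h1
  have h3 : (2 : ℝ) ^ n * (1 / 2) ^ (n + 1) = 1 / 2 := by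
    rw [pow_succ, ← mul_assoc, ← mul_pow]; norm_num
  linear_combination 2 * h2 + (-2 * extremalSeq (rearr y) n) * h3

/-- On the `2n`-th shell, `T` of the extremal function dominates the Calderón operator. -/
lemma calderon_le_radialAvg (hy : MemL1 y) {n : ℕ} (hn : 1 ≤ n) :
    calderon (rearr y) ((1 / 2) ^ (2 * n)) ≤
      24 * (radialAvg (extremalSeq (rearr y)) 0 +
        ∑ m ∈ Finset.range n, radialAvg (extremalSeq (rearr y)) (2 * (m + 1)) / 2) := by
  set v := extremalSeq (rearr y)
  have hv := integrable_radial_extremalSeq hy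
  have h1 := integral_rearr_le_radial hy n
  have h2 := integral_rearr_div_le hy n
  have h3 : ∑ m ∈ Finset.range n, v (2 * (m + 1)) ≤
      ∑ m ∈ Finset.range n, 2 * radialAvg v (2 * (m + 1)) :=
    Finset.sum_le_sum fun m _ => extremalSeq_le_radialAvg hy _
  have h4 : 1 / (1 / 2 : ℝ) ^ (2 * n) * (∫ u in (0 : ℝ)..(1 / 2) ^ (2 * n), rearr y u) ≤
      6 * radialAvg v (2 * n) := by
    have h5 : ∫ u in (0 : ℝ)..(1 / 2) ^ (2 * (n + 1)), radial v u ≤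
        ∫ u in (0 : ℝ)..(1 / 2) ^ (2 * n), radial v u := by
      rw [integral_radial_succ hv (2 * n), integral_radial_succ hv (2 * n + 1)]
      have h6 : 0 ≤ v (2 * n) * (1 / 2) ^ (2 * n + 1) :=
        mul_nonneg (extremalSeq_nonneg y _) (by positivity)
      have h7 : 0 ≤ v (2 * n + 1) * (1 / 2) ^ (2 * n + 1 + 1) :=
        mul_nonneg (extremalSeq_nonneg y _) (by positivity)
      rw [show 2 * (n + 1) = 2 * n + 1 + 1 by ring]
      linarith
    have h6 : 1 / (1 / 2 : ℝ) ^ (2 * n) = 2 ^ (2 * n) := by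
      rw [one_div, one_div, inv_pow, inv_inv]
    rw [h6, radialAvg]
    have h8 : (0 : ℝ) < 2 ^ (2 * n) := by positivity
    nlinarith
  -- $n\ge1$ makes the average at level $2n$ a term of the sum. With $A_m$ the average at level
  -- $2m$, the total is $6A_n+3\cdot2\sum A_m\le12\sum A_m=24\sum A_m/2$.
  have h5 : radialAvg v (2 * n) ≤ ∑ m ∈ Finset.range n, radialAvg v (2 * (m + 1)) := by
    obtain ⟨p, rfl⟩ := Nat.exists_eq_add_of_le' hn
    exact Finset.single_le_sum (f := fun m => radialAvg v (2 * (m + 1)))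
      (fun m _ => radialAvg_nonneg y _) (Finset.self_mem_range_succ p)
  rw [← Finset.mul_sum] at h3
  rw [← Finset.sum_div]
  have h6 := radialAvg_nonneg y 0
  simp only [calderon]
  linarith

/-- `S μ(y) ≤ 24 μ(·/8; T f)` for the extremal function `f`. -/
lemma calderon_le_rearr_of_isT (hy : MemL1 y) {z : S01}
    (hz : IsT (toS (radial (extremalSeq (rearr y)))) z) {t : ℝ} (ht : t ∈ Ioo (0 : ℝ) 1) :
    calderon (rearr y) t ≤ 24 * rearr z (t / 8) := by
  set v := extremalSeq (rearr y)
  have hv := integrable_radial_extremalSeq hy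
  obtain ⟨k, hk⟩ := exists_mem_shell ht
  -- With $t\in[2^{-k-1},2^{-k})$: $2n\ge k+1$ gives $2^{-2n}\le t$, and $2n\le k+2$ gives the shell
  -- $2n$ measure $2^{-2n-1}\ge2^{-k-3}>t/8$.
  obtain ⟨n, hn, hkn, hkn'⟩ : ∃ n, 1 ≤ n ∧ k + 1 ≤ 2 * n ∧ 2 * n ≤ k + 2 :=
    ⟨k / 2 + 1, by omega, by omega, by omega⟩
  have h8 : 0 < t / 8 := by linarith [ht.1]
  have hτ : (1 / 2 : ℝ) ^ (2 * n) ∈ Ioo (0 : ℝ) 1 :=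
    ⟨by positivity, pow_lt_one₀ (by norm_num) (by norm_num) (by omega)⟩
  refine (calderon_antitone hy.integrable_rearr (isRearr_rearr y) hτ ht
    ((half_pow_anti hkn).trans hk.1)).trans ((calderon_le_radialAvg hy hn).trans ?_)
  set V := radialAvg v 0 + ∑ m ∈ Finset.range n, radialAvg v (2 * (m + 1)) / 2
  refine mul_le_mul_of_nonneg_left ?_ (by norm_num)
  by_contra! hcon
  -- On this shell the partial sums are eventually equal to $V$, so an a.e. convergent subsequence
  -- identifies $Tf$ there.
  have hzV : ∀ᵐ u ∂m01, u ∈ shell (2 * n) → z u = V := by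
    rw [isT_iff] at hz
    obtain ⟨φ, hφ, hlim⟩ := hz.exists_seq_tendsto_ae
    have hc : ∀ᵐ u ∂m01, ∀ N, partialT N (toS (radial v)) u = partialT N (radial v) u :=
      ae_all_iff.2 fun N => partialT_congr (coe_toS (measurable_radial v).aemeasurable) N
    filter_upwards [hlim, hc, partialT_radial hv (extremalSeq_odd _) n] with u h1 h2 h3 hu
    refine tendsto_nhds_unique h1 (tendsto_const_nhds.congr' ?_)
    filter_upwards [hφ.tendsto_atTop.eventually_ge_atTop (n + 1)] with N hN
    rw [h2, h3 hu _ hN]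
  have h1 : distr z (rearr z (t / 8)) ≤ ENNReal.ofReal (t / 8) :=
    (rearr_le_iff z h8 (rearr_nonneg z _)).1 le_rfl
  have h2 : m01 (shell (2 * n)) ≤ distr z (rearr z (t / 8)) := by
    refine measure_mono_ae ?_
    filter_upwards [hzV] with u hu hus
    show rearr z (t / 8) < |z u|
    rw [hu hus]
    exact hcon.trans_le (le_abs_self V)
  have h3 : m01 (shell (2 * n)) = ENNReal.ofReal ((1 / 2) ^ (2 * n + 1)) := by
    rw [m01_apply, inter_eq_left.2, shell, Real.volume_Ico]
    · congr 1; rw [pow_succ]; ring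
    · intro u hu
      exact ⟨lt_of_lt_of_le (by positivity) hu.1, hu.2.trans_le (half_pow_le_one _)⟩
  have h4 := h3.symm.le.trans (h2.trans h1)
  rw [ENNReal.ofReal_le_ofReal_iff h8.le] at h4
  have h5 : (1 / 2 : ℝ) ^ (k + 3) ≤ (1 / 2) ^ (2 * n + 1) := half_pow_anti (by omega)
  have h6 : (1 / 2 : ℝ) ^ (k + 3) = (1 / 2) ^ k / 8 := by rw [pow_add]; norm_num; ring
  linarith [hk.2]

end Lower

/-! ### Optimality -/

lemma isBoundedT_calderonSpace {E : FunSpace} (hE : IsSymmetricQuasiBanach E)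
    (hL1 : ∀ x ∈ E.carrier, MemL1 x) : IsBoundedT E (calderonSpace E) := by
  refine ⟨14, fun x hx => ?_⟩
  obtain ⟨y, hy⟩ := exists_isT (hL1 x hx)
  have h1 := hy.rearrLeCalderon (hL1 x hx)
  have h2 := hE.smul_mem 14 x hx
  refine ⟨y, IsSymmetricQuasiBanach.mem_calderonSpace hL1 h2 h1, hy,
    (hE.qnorm_calderonSpace_le h2 h1).trans ?_⟩
  rw [hE.qnorm_smul 14 x hx, abs_of_pos (by norm_num)]

/-- For $x$ dominated by $S\mu(y)$, the lower estimate gives $\mu(t;x)\le24\,\mu(t/8;Tf)$; three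
applications of the dilation bound in $G$ undo the factor $8$. -/
lemma continuouslyEmbedded_calderonSpace {E G : FunSpace} (hE : IsSymmetricQuasiBanach E)
    (hL1 : ∀ x ∈ E.carrier, MemL1 x) (hG : IsSymmetricQuasiBanach G) (hT : IsBoundedT E G) :
    ContinuouslyEmbedded (calderonSpace E) G := by
  obtain ⟨C, hC⟩ := hT
  obtain ⟨K, hK1, hK⟩ := hG.exists_dilation
  have hK0 : 0 < K := by linarith
  have key : ∀ x y : S01, y ∈ E.carrier → RearrLeCalderon x y →
      x ∈ G.carrier ∧ G.qnorm x ≤ 24 * K ^ 3 * (|C| + 1) * E.qnorm y := by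
    intro x y hy hxy
    have hyL := hL1 y hy
    set f := toS (radial (extremalSeq (rearr y)))
    have hf : f ∈ E.carrier ∧ E.qnorm f ≤ E.qnorm y := by
      have h1 := hE.toS_rearr hy
      have h2 := hE.solid _ h1.1 f (by
        rw [abs_le_abs_iff]
        filter_upwards [coe_toS (aemeasurable_rearr y),
          coe_toS (measurable_radial (extremalSeq (rearr y))).aemeasurable, ae_mem_Ioo]
          with u h2 h3 hu
        rw [h2, h3, abs_of_nonneg (rearr_nonneg y u)]
        exact abs_radial_extremalSeq_le hu)
      exact ⟨h2.1, h2.2.trans h1.2.le⟩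
    obtain ⟨z, hz, hfz, hzn⟩ := hC f hf.1
    obtain ⟨z₁, hz₁, hn₁, h₁⟩ := hK z hz
    obtain ⟨z₂, hz₂, hn₂, h₂⟩ := hK z₁ hz₁
    obtain ⟨z₃, hz₃, hn₃, h₃⟩ := hK z₂ hz₂
    have hle := hG.of_rearr_le (y := x) (hG.smul_mem 24 z₃ hz₃) fun t ht => by
      rw [rearr_smul _ _ ht.1, abs_of_pos (by norm_num)]
      refine (hxy t ht).trans ((calderon_le_rearr_of_isT hyL hfz ht).trans ?_)
      refine mul_le_mul_of_nonneg_left ?_ (by norm_num)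
      have e : t / 8 = t / 2 / 2 / 2 := by ring
      rw [e]
      have ht0 := ht.1
      have ht1 := ht.2
      exact (h₁ _ ⟨by linarith, by linarith⟩).trans
        ((h₂ _ ⟨by linarith, by linarith⟩).trans (h₃ t ht))
    refine ⟨hle.1, hle.2.trans ?_⟩
    rw [hG.qnorm_smul 24 z₃ hz₃, abs_of_pos (by norm_num)]
    have hfn := hE.nonneg f hf.1
    -- $C$ may be zero or negative; $|C|+1$ keeps the final constant positive, so that it can be
    -- divided out when passing to the infimum over $y$.
    have h4 : G.qnorm z ≤ (|C| + 1) * E.qnorm y := by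
      refine hzn.trans ((mul_le_mul_of_nonneg_right (b := C) (c := |C| + 1) ?_ hfn).trans
        (mul_le_mul_of_nonneg_left hf.2 (by positivity)))
      linarith [le_abs_self C]
    have h5 : G.qnorm z₃ ≤ K * (K * (K * ((|C| + 1) * E.qnorm y))) :=
      hn₃.trans (mul_le_mul_of_nonneg_left (hn₂.trans (mul_le_mul_of_nonneg_left (hn₁.trans
        (mul_le_mul_of_nonneg_left h4 hK0.le)) hK0.le)) hK0.le)
    linear_combination 24 * h5
  have hD : 0 < 24 * K ^ 3 * (|C| + 1) := by positivity
  refine ⟨24 * K ^ 3 * (|C| + 1), fun x hx => ⟨?_, ?_⟩⟩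
  · obtain ⟨-, y, hy, hxy⟩ := hx
    exact (key x y hy hxy).1
  · rw [← div_le_iff₀' hD]
    refine le_of_forall_gt fun r hr => ?_
    obtain ⟨y, hy, hxy, hyr⟩ := IsSymmetricQuasiBanach.exists_of_qnorm_lt hx hr
    refine lt_of_le_of_lt ?_ hyr
    rw [div_le_iff₀' hD]
    exact (key x y hy hxy).2

end

theorem mainTheorem3 (E : FunSpace) (hE : IsSymmetricQuasiBanach E)
    (hL1 : ∀ x ∈ E.carrier, MemL1 x) :
    IsOptimalSymmetricRangeT E (calderonSpace E) :=
  ⟨hE.isSymmetricQuasiBanach_calderonSpace hL1, isBoundedT_calderonSpace hE hL1,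
    fun _ hG hT => continuouslyEmbedded_calderonSpace hE hL1 hG hT⟩
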